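/- **Setting.** Let $Y=(0,1]^3$, let $D\subset Y$ be measurable (the inclusions), $H=Y\setminus D$, and let $\alpha\in Y^*=(-\pi,\pi]^3$. Let $L^2_\#$ be the space of $\alpha$-quasiperiodic, locally square integrable fields $u:\mathbb R^3\to\mathbb C^3$ with inner product $(u,v)=\int_Y u\cdot\overline v$. Let $J_\#$ be the space of $u\in L^2_\#$ with square integrable weak gradient ($\alpha$-quasiperiodic), $\nabla\cdot u=0$ and, if $\alpha=0$, $\int_Y u=0$, with inner product $\langle u,v\rangle=\int_Y\nabla\times u\cdot\overline{\nabla\times v}$. For $k\in\mathbb C$ put $B_k(u,w)=k\int_H\nabla\times u\cdot\overline{\nabla\times w}+\int_D\nabla\times u\cdot\overline{\nabla\times w}$ and define $T_k$ on $J_\#$ by $\langle T_ku,w\rangle=B_k(u,w)$. Define $(-\Delta_\alpha)^{-1}:L^2_\#\to J_\#$ by $\langle(-\Delta_\alpha)^{-1}u,v\rangle=(u,v)$ for all $v\in J_\#$. A number $\xi\in\mathbb C$ is a *Bloch eigenvalue* for $k$ if some $0\ne h\in J_\#$ satisfies $B_k(h,w)=\xi\,(h,w)$ for all $w\in J_\#$,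 the weak form of $\nabla\times\big((k\chi_H+\chi_D)\nabla\times h\big)=\xi h$. Let $T$ be given by $\langle Tu,w\rangle=\frac12\int_H\nabla\times u\cdot\overline{\nabla\times w}-\frac12\int_D\nabla\times u\cdot\overline{\nabla\times w}$, let $W_1=\{\nabla\times u=0\text{ in }D\}$, $W_2=\{\nabla\times u=0\text{ in }H\}$, $W_3=(W_1\oplus W_2)^\perp$ in $J_\#$, with orthogonal projections $P_1,P_2,P_3$. Let $R=\sigma(T|_{W_3})\subset[-\frac12,\frac12]$, $\mu^-=\inf R$, $z^*=(\mu^-+\frac12)/(\mu^--\frac12)$, and $$Z=\{0\}\cup\Big\{\tfrac{\mu-1/2}{\mu+1/2}:\ \mu\in R,\ \mu\ne-\tfrac12\Big\}.$$ As operators on $L^2_\#$ put $B(k)=T_k^{-1}(-\Delta_\alpha)^{-1}$ and $$A(z)=\Big(zP_1+P_2+z\big[(\tfrac12+T)+z(\tfrac12-T)\big]^{-1}P_3\Big)(-\Delta_\alpha)^{-1},$$ the inverse being taken on $W_3$. **Theorem.** 1. $\mathbb C\setminus Z$ is open; $k\mapsto T_k$ is holomorphic there, $T_k$ is boundedly invertible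 for $k\notin Z$, and $k\mapsto T_k^{-1}$ and $k\mapsto B(k)$ are holomorphic on $\mathbb C\setminus Z$ in operator norm. 2. For $k\notin Z$ the operator $B(k)=A(1/k)$ is compact, and $\xi$ is a Bloch eigenvalue for $k$ if and only if $\xi\neq0$ and $1/\xi\in\sigma(A(1/k))$; that is, the Bloch eigenvalues are $\lambda_j(k,\alpha)=1/\beta_j^\alpha(1/k)$, where the $\beta_j^\alpha(1/k)$ are the nonzero points of $\sigma(A(1/k))$. For $\xi\ne0$ the eigenspace of the Bloch problem for $\xi$ is that of $A(1/k)$ for $1/\xi$. Every bounded set contains finitely many Bloch eigenvalues, and each has finite geometric and finite algebraic multiplicity (the latter as the dimension of the generalized eigenspace of $A(1/k)$ for $1/\xi$). 3. Suppose $-\frac12<\mu^-<0$. Let $0\neq\beta_0\in\sigma(A(0))$ have multiplicity $m$, and let $\Gamma$ be a closed piecewise $C^1$ contour whose winding number about each point off $\Gamma$ is $0$ or $1$, which does not meet $\sigma(A(0))$ and encloses $\beta_0$ and no other point of $\sigma(A(0))$. Let $d=\operatorname{dist}(\Gamma,\sigma(A(0)))$ and $$r^*=\frac{|\alpha|^2\,d\,|z^*|}{\frac{1}{1/2-\mu^-}+|\alpha|^2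 d}\quad(\alpha\ne0),\qquad r^*=\frac{4\pi^2 d\,|z^*|}{\frac{1}{1/2-\mu^-}+4\pi^2 d}\quad(\alpha=0).$$ Then $r^*>0$, $m>0$, and $\{|k|>1/r^*\}\cap Z=\emptyset$. For $|z|<r^*$ the contour $\Gamma$ lies in the resolvent set of $A(z)$; the spectrum of $A(z)$ inside $\Gamma$ consists of finitely many nonzero eigenvalues of finite algebraic multiplicity, with total algebraic multiplicity $m$; and $P(z)=\frac1{2\pi i}\oint_\Gamma(\zeta-A(z))^{-1}d\zeta$ is a projection onto the sum of their generalized eigenspaces. Let $\beta_1(z),\dots,\beta_m(z)$ be these eigenvalues, repeated by algebraic multiplicity. Then $A(z)$, $P(z)$, the sums $\sum_i\beta_i(z)^p$ for all $p\in\mathbb Z$, and in particular the means $\frac1m\sum_i\beta_i(z)$ and $\frac1m\sum_i1/\beta_i(z)$, are analytic for $|z|<r^*$. Hence the mean $\frac1m\sum_i 1/\beta_i(1/k)$ of the corresponding group of Bloch eigenvalues is analytic for $|k|>1/r^*$ including $k=\infty$, and so in any neighborhood of infinity contained in $|k|>1/r^*$. -/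

import Mathlib

namespace PhotonicCrystal
noncomputable section

open MeasureTheory Set
open scoped ComplexConjugate ContDiff

/-- Points of `ℝ³` (only Lebesgue measure and coordinates are used). -/
abbrev R3 : Type := Fin 3 → ℝ
/-- Values of the fields. -/
abbrev C3 : Type := EuclideanSpace ℂ (Fin 3)

/-- The period cell `Y = (0, 1]³`. -/
def unitCell : Set R3 := {x | ∀ i, x i ∈ Ioc (0 : ℝ) 1}

/-- `L²(Y, ℂ³)`. For each `α` it is the space `L²_#(α, Y, ℂ³)` of `α`-quasiperiodic fields with the
inner product over `Y`, a quasiperiodic field being determined by its values on the cell. -/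
abbrev L2Y : Type := Lp C3 2 (volume.restrict unitCell)

/-- The first Brillouin zone `Y* = (-π, π]³`. -/
def brillouinZone : Set R3 := {α | ∀ i, α i ∈ Ioc (-Real.pi) Real.pi}

theorem measurableSet_unitCell : MeasurableSet unitCell :=
  MeasurableSet.univ_pi' (fun _ => measurableSet_Ioc)

theorem unitCell_eq : unitCell = {x : R3 | ∀ i, x i ∈ Ioc ((0 : R3) i) ((0 : R3) i + 1)} := by
  ext x; simp [unitCell]

theorem volume_unitCell : volume unitCell = 1 := by
  have : unitCell = Set.univ.pi (fun _ : Fin 3 => Ioc (0 : ℝ) 1) := by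
    ext x; simp [unitCell]
  rw [this, volume_pi_pi]; simp

instance isProbabilityMeasure_cell : IsProbabilityMeasure (volume.restrict unitCell) :=
  ⟨by simp [volume_unitCell]⟩

/-- the frequency vector `2πn + α` -/
def freq (α : R3) (n : Fin 3 → ℤ) (j : Fin 3) : ℝ := 2 * Real.pi * n j + α j

/-- the plane wave `exp(i(2πn+α)·x)` -/
def planeWave (α : R3) (n : Fin 3 → ℤ) (x : R3) : ℂ :=
  Complex.exp (Complex.I * ∑ j, (freq α n j : ℂ) * (x j : ℂ))

/-- Fourier coefficient -/
def coeff (α : R3) (u : R3 → C3) (n : Fin 3 → ℤ) : C3 :=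
  ∫ x in unitCell, conj (planeWave α n x) • u x

theorem norm_planeWave (α : R3) (n : Fin 3 → ℤ) (x : R3) : ‖planeWave α n x‖ = 1 := by
  rw [planeWave, mul_comm]
  have : (∑ j, (freq α n j : ℂ) * (x j : ℂ)) = ((∑ j, freq α n j * x j : ℝ) : ℂ) := by
    push_cast; rfl
  rw [this, Complex.norm_exp_ofReal_mul_I]

theorem contDiff_planeWave (α : R3) (n : Fin 3 → ℤ) : ContDiff ℝ ∞ (planeWave α n) := by
  unfold planeWave
  have h : ∀ j, ContDiff ℝ ∞ (fun x : R3 => ((x j : ℝ) : ℂ)) := fun j =>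
    Complex.ofRealCLM.contDiff.comp (contDiff_apply ℝ ℝ j)
  exact (contDiff_const.mul (ContDiff.sum fun j _ => contDiff_const.mul (h j))).cexp

section
attribute [local instance] instMeasureSpaceUnitAddCircle

/-- the representative in the unit cell of a point of the torus -/
def torusRep (t : UnitAddTorus (Fin 3)) : R3 := (UnitAddTorus.measurableEquivPiIoc 0 t).1

theorem measurable_torusRep : Measurable torusRep :=
  measurable_subtype_coe.comp (UnitAddTorus.measurableEquivPiIoc (0 : R3)).measurable

theorem torusRep_coe {x : R3} (hx : x ∈ unitCell) :
    torusRep (fun i => (x i : UnitAddCircle)) = x := by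
  have hx' : ∀ i, x i ∈ Ioc ((0 : R3) i) ((0 : R3) i + 1) := by
    rw [unitCell_eq] at hx; exact hx
  have := (UnitAddTorus.measurableEquivPiIoc (0 : R3)).apply_symm_apply ⟨x, hx'⟩
  rw [UnitAddTorus.coe_symm_measurableEquivPiIoc_apply] at this
  simp only [torusRep]
  rw [this]

theorem parseval_scalar (f : R3 → ℂ) (hf : StronglyMeasurable f)
    (hf2 : MemLp f 2 (volume.restrict unitCell)) (α : R3) :
    HasSum (fun n => ‖∫ x in unitCell, conj (planeWave α n x) * f x‖ ^ 2)
      (∫ x in unitCell, ‖f x‖ ^ 2) := by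
  let G : R3 → ℂ := fun x => conj (planeWave α 0 x) * f x
  have hGm : StronglyMeasurable G :=
    ((Complex.continuous_conj.comp (contDiff_planeWave α 0).continuous).stronglyMeasurable).mul hf
  have hGn : ∀ x, ‖G x‖ = ‖f x‖ := fun x => by simp [G, norm_planeWave]
  let F : UnitAddTorus (Fin 3) → ℂ := fun t => G (torusRep t)
  have hFm : StronglyMeasurable F := hGm.comp_measurable measurable_torusRep
  have hF : MemLp F 2 volume := by
    refine ⟨hFm.aestronglyMeasurable, ?_⟩
    have h2 := hf2.2
    rw [eLpNorm_lt_top_iff_lintegral_rpow_enorm_lt_top (by norm_num) (by norm_num)] at h2 ⊢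
    rw [UnitAddTorus.lintegral_preimage _ (0 : R3), ← unitCell_eq]
    convert h2 using 1
    refine setLIntegral_congr_fun measurableSet_unitCell fun x hx => ?_
    simp only [F, torusRep_coe hx]
    rw [← ofReal_norm, ← ofReal_norm, hGn]
  have key := UnitAddTorus.hasSum_sq_mFourierCoeff hF.toLp
  have h1 : ∫ t, ‖hF.toLp F t‖ ^ 2 = ∫ x in unitCell, ‖f x‖ ^ 2 := by
    have : ∫ t, ‖hF.toLp F t‖ ^ 2 = ∫ t, ‖F t‖ ^ 2 := by
      apply integral_congr_ae
      filter_upwards [hF.coeFn_toLp] with t ht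
      rw [ht]
    rw [this, UnitAddTorus.integral_preimage _ (0 : R3), ← unitCell_eq]
    refine setIntegral_congr_fun measurableSet_unitCell fun x hx => ?_
    simp only [F, torusRep_coe hx, hGn]
  rw [h1] at key
  refine key.congr_fun ?_ |> fun h => h
  intro n
  congr 2
  have : UnitAddTorus.mFourierCoeff (hF.toLp F) n = UnitAddTorus.mFourierCoeff F n := by
    apply integral_congr_ae
    filter_upwards [hF.coeFn_toLp] with t ht
    rw [ht]
  rw [this, UnitAddTorus.mFourierCoeff_eq_integral _ _ (0 : R3), ← unitCell_eq]
  refine setIntegral_congr_fun measurableSet_unitCell fun x hx => ?_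
  simp only [F, torusRep_coe hx, G, smul_eq_mul, ← mul_assoc]
  congr 1
  rw [UnitAddTorus.mFourier_neg, ← map_mul]
  congr 1
  simp only [UnitAddTorus.mFourier, ContinuousMap.coe_mk, fourier_coe_apply, planeWave, freq,
    ← Complex.exp_sum, ← Complex.exp_add]
  congr 1
  simp only [Fin.sum_univ_three]
  push_cast
  simp
  ring

end


theorem exists_bound {ψ : R3 → ℂ} (hψ : Continuous ψ) :
    ∃ C, ∀ᵐ x ∂(volume.restrict unitCell), ‖ψ x‖ ≤ C := by
  obtain ⟨C, hC⟩ := (isCompact_Icc (a := (0 : R3)) (b := 1)).exists_bound_of_continuousOn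
    hψ.continuousOn
  refine ⟨C, ?_⟩
  filter_upwards [ae_restrict_mem measurableSet_unitCell] with x hx
  exact hC x ⟨fun i => (hx i).1.le, fun i => (hx i).2⟩

section
variable {E : Type*} [NormedAddCommGroup E] [NormedSpace ℂ E]

theorem integrable_smul_L2 {ψ : R3 → ℂ} (hψ : Continuous ψ)
    (u : Lp E 2 (volume.restrict unitCell)) :
    Integrable (fun x => ψ x • u x) (volume.restrict unitCell) := by
  obtain ⟨C, hC⟩ := exists_bound hψ
  exact ((Lp.memLp u).integrable (by norm_num)).bdd_smul C hψ.aestronglyMeasurable hC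

/-- The continuous linear map `u ↦ ∫_Y ψ u`, for a continuous function `ψ`. -/
def pairing (ψ : R3 → ℂ) (hψ : Continuous ψ) :
    Lp E 2 (volume.restrict unitCell) →L[ℂ] E :=
  LinearMap.mkContinuousOfExistsBound
    { toFun := fun u => ∫ x in unitCell, ψ x • u x
      map_add' := fun u v => by
        rw [← integral_add (integrable_smul_L2 hψ u) (integrable_smul_L2 hψ v)]
        refine integral_congr_ae ?_
        filter_upwards [Lp.coeFn_add u v] with x hx
        rw [hx, Pi.add_apply, smul_add]
      map_smul' := fun c u => by
        simp only [RingHom.id_apply]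
        rw [← integral_smul]
        refine integral_congr_ae ?_
        filter_upwards [Lp.coeFn_smul c u] with x hx
        rw [hx, Pi.smul_apply, smul_comm] }
    (by
      obtain ⟨C, hC⟩ := exists_bound hψ
      refine ⟨C, fun u => ?_⟩
      have h1 : ‖∫ x in unitCell, ψ x • u x‖ ≤ ∫ x in unitCell, C * ‖u x‖ := by
        refine norm_integral_le_of_norm_le
          (((Lp.memLp u).integrable (by norm_num)).norm.const_mul C) ?_
        filter_upwards [hC] with x hx
        rw [norm_smul]
        gcongr
      have hC0 : 0 ≤ C := by
        obtain ⟨x, hx⟩ := hC.exists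
        exact (norm_nonneg _).trans hx
      have h2 : ∫ x in unitCell, ‖u x‖ ≤ ‖u‖ := by
        have hi : Integrable u (volume.restrict unitCell) :=
          (Lp.memLp u).integrable (by norm_num)
        rw [integral_norm_eq_lintegral_enorm hi.1, Lp.norm_def,
          ← eLpNorm_one_eq_lintegral_enorm]
        exact ENNReal.toReal_mono (Lp.eLpNorm_ne_top u)
          (eLpNorm_le_eLpNorm_of_exponent_le (by norm_num) hi.1)
      calc _ ≤ _ := h1
        _ = C * ∫ x in unitCell, ‖u x‖ := integral_const_mul _ _
        _ ≤ C * ‖u‖ := by gcongr)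

theorem pairing_apply (ψ : R3 → ℂ) (hψ : Continuous ψ)
    (u : Lp E 2 (volume.restrict unitCell)) :
    pairing ψ hψ u = ∫ x in unitCell, ψ x • u x := rfl

theorem pairing_compLpL {F : Type*} [NormedAddCommGroup F] [NormedSpace ℂ F]
    [CompleteSpace E] [CompleteSpace F] (ψ : R3 → ℂ) (hψ : Continuous ψ) (L : E →L[ℂ] F)
    (u : Lp E 2 (volume.restrict unitCell)) :
    pairing ψ hψ (L.compLpL 2 (volume.restrict unitCell) u) = L (pairing ψ hψ u) := by
  rw [pairing_apply, pairing_apply, ← L.integral_comp_comm (integrable_smul_L2 hψ u)]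
  refine integral_congr_ae ?_
  filter_upwards [L.coeFn_compLpL u] with x hx
  simp [hx]

end

theorem continuous_conj_planeWave (α : R3) (n : Fin 3 → ℤ) :
    Continuous fun x => conj (planeWave α n x) :=
  Complex.continuous_conj.comp (contDiff_planeWave α n).continuous

theorem parseval (α : R3) (u : L2Y) :
    HasSum (fun n => ‖coeff α u n‖ ^ 2) (‖u‖ ^ 2) := by
  have hm : ∀ i, StronglyMeasurable (fun x => u x i) := fun i =>
    (EuclideanSpace.proj (𝕜 := ℂ) i).continuous.comp_stronglyMeasurable (Lp.stronglyMeasurable u)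
  have hL : ∀ i, MemLp (fun x => u x i) 2 (volume.restrict unitCell) := fun i =>
    (EuclideanSpace.proj (𝕜 := ℂ) (ι := Fin 3) i).comp_memLp' (Lp.memLp u)
  have hs := hasSum_sum (s := Finset.univ) fun i (_ : i ∈ Finset.univ) =>
    parseval_scalar _ (hm i) (hL i) α
  convert hs using 1
  · funext n
    rw [EuclideanSpace.norm_sq_eq]
    refine Finset.sum_congr rfl fun i _ => ?_
    congr 2
    have hi : Integrable (fun x => conj (planeWave α n x) • u x) (volume.restrict unitCell) := 
      integrable_smul_L2 (continuous_conj_planeWave α n) u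
    have := (EuclideanSpace.proj (𝕜 := ℂ) (ι := Fin 3) i).integral_comp_comm hi
    simpa [coeff] using this.symm
  · rw [← integral_finsetSum]
    · have h1 : ‖u‖ ^ 2 = RCLike.re (inner ℂ u u) := norm_sq_eq_re_inner (𝕜 := ℂ) u
      rw [h1, L2.inner_def, ← integral_re (L2.integrable_inner u u)]
      refine integral_congr_ae (Filter.Eventually.of_forall fun x => ?_)
      simp only
      rw [← norm_sq_eq_re_inner (𝕜 := ℂ), EuclideanSpace.norm_sq_eq]
    · intro i _
      exact (hL i).integrable_norm_pow (by norm_num)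

/-- Smooth `α`-quasiperiodic functions, the test functions on the cell. -/
structure IsTest (α : R3) (φ : R3 → ℂ) : Prop where
  smooth : ContDiff ℝ ∞ φ
  quasiperiodic : ∀ (x : R3) (n : Fin 3 → ℤ),
    φ (x + fun i => (n i : ℝ)) = Complex.exp (Complex.I * ∑ i, (α i : ℂ) * (n i : ℂ)) * φ x

/-- `g` is the weak partial derivative `∂_j u` of the `α`-quasiperiodic field `u`. -/
def HasWeakPartial (α : R3) (j : Fin 3) (u g : L2Y) : Prop :=
  ∀ φ : R3 → ℂ, IsTest α φ →
    ∫ x in unitCell, conj (fderiv ℝ φ x (Pi.single j 1)) • u x =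
      -∫ x in unitCell, conj (φ x) • g x

/-- `v ↦ e_j × v` on `ℂ³`. -/
def crossBasis (j : Fin 3) : C3 →L[ℂ] C3 :=
  LinearMap.toContinuousLinearMap
    ((WithLp.linearEquiv 2 ℂ (Fin 3 → ℂ)).symm.toLinearMap ∘ₗ
      crossProduct (Pi.single j 1 : Fin 3 → ℂ) ∘ₗ
      (WithLp.linearEquiv 2 ℂ (Fin 3 → ℂ)).toLinearMap)

/-- `∇ × u = ∑_j e_j × ∂_j u`, in terms of the partial derivatives `g j = ∂_j u`. -/
def curlOf (g : Fin 3 → L2Y) : L2Y :=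
  ∑ j, (crossBasis j).compLpL 2 (volume.restrict unitCell) (g j)

/-- `div u = ∑_j (∂_j u)_j`, in terms of the partial derivatives `g j = ∂_j u`. -/
def divOf (g : Fin 3 → L2Y) : Lp ℂ 2 (volume.restrict unitCell) :=
  ∑ j, (EuclideanSpace.proj (𝕜 := ℂ) j : C3 →L[ℂ] ℂ).compLpL 2 (volume.restrict unitCell) (g j)

theorem IsTest.continuous_conj {α : R3} {φ : R3 → ℂ} (h : IsTest α φ) :
    Continuous fun x => conj (φ x) :=
  Complex.continuous_conj.comp h.smooth.continuous

theorem IsTest.continuous_conj_fderiv {α : R3} {φ : R3 → ℂ} (h : IsTest α φ) (j : Fin 3) :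
    Continuous fun x => conj (fderiv ℝ φ x (Pi.single j 1)) :=
  Complex.continuous_conj.comp
    ((h.smooth.continuous_fderiv (by simp)).clm_apply continuous_const)

theorem hasWeakPartial_iff {α : R3} {j : Fin 3} {u g : L2Y} :
    HasWeakPartial α j u g ↔ ∀ (φ : R3 → ℂ) (h : IsTest α φ),
      pairing _ (h.continuous_conj_fderiv j) u + pairing _ h.continuous_conj g = 0 := by
  refine forall_congr' fun φ => forall_congr' fun h => ?_
  rw [pairing_apply, pairing_apply, eq_neg_iff_add_eq_zero]

theorem integral_eq_pairing (u : L2Y) :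
    ∫ x in unitCell, u x = pairing (fun _ => 1) continuous_const u := by
  simp [pairing_apply]

/-- The space `J_#(α, Y, ℂ³)` of divergence-free `α`-quasiperiodic fields with square integrable
weak gradient, of mean zero if `α = 0`. An element is a field together with its weak partial
derivatives (which it determines). -/
def jSubmodule (α : R3) : Submodule ℂ (L2Y × (Fin 3 → L2Y)) where
  carrier := {p | (∀ j, HasWeakPartial α j p.1 (p.2 j)) ∧ divOf p.2 = 0 ∧
    (α = 0 → ∫ x in unitCell, p.1 x = 0)}
  add_mem' := by
    rintro p q ⟨h1, h2, h3⟩ ⟨k1, k2, k3⟩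
    refine ⟨fun j => hasWeakPartial_iff.2 fun φ h => ?_, ?_, fun h => ?_⟩
    · have e1 := hasWeakPartial_iff.1 (h1 j) φ h
      have e2 := hasWeakPartial_iff.1 (k1 j) φ h
      simp only [Prod.fst_add, Prod.snd_add, Pi.add_apply, map_add]
      rw [← add_zero (0 : C3)]
      nth_rw 1 [← e1]
      rw [← e2]
      abel
    · simp only [divOf, Prod.snd_add, Pi.add_apply, map_add, Finset.sum_add_distrib] at *
      rw [h2, k2, add_zero]
    · have e1 := h3 h
      have e2 := k3 h
      rw [integral_eq_pairing] at *
      rw [Prod.fst_add, map_add, e1, e2, add_zero]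
  zero_mem' := by
    refine ⟨fun j => hasWeakPartial_iff.2 fun φ h => by simp, by simp [divOf], fun _ => ?_⟩
    rw [integral_eq_pairing]; simp
  smul_mem' := by
    rintro c p ⟨h1, h2, h3⟩
    refine ⟨fun j => hasWeakPartial_iff.2 fun φ h => ?_, ?_, fun h => ?_⟩
    · have e1 := hasWeakPartial_iff.1 (h1 j) φ h
      simp only [Prod.smul_fst, Prod.smul_snd, Pi.smul_apply, map_smul]
      rw [← smul_add, e1, smul_zero]
    · simp only [divOf, Prod.smul_snd, Pi.smul_apply, map_smul, ← Finset.smul_sum] at *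
      rw [h2, smul_zero]
    · have e1 := h3 h
      rw [integral_eq_pairing] at *
      rw [Prod.smul_fst, map_smul, e1, smul_zero]

theorem isClosed_jSubmodule (α : R3) : IsClosed (jSubmodule α : Set (L2Y × (Fin 3 → L2Y))) := by
  have : (jSubmodule α : Set (L2Y × (Fin 3 → L2Y))) =
      (⋂ j : Fin 3, ⋂ φ : R3 → ℂ, ⋂ h : IsTest α φ,
        {p | pairing _ (h.continuous_conj_fderiv j) p.1 +
          pairing _ h.continuous_conj (p.2 j) = 0}) ∩
      ({p | divOf p.2 = 0} ∩ ⋂ _ : α = 0, {p | pairing (fun _ => 1) continuous_const p.1 = 0}) := by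
    ext p
    simp only [jSubmodule, hasWeakPartial_iff, integral_eq_pairing, Submodule.coe_set_mk,
      AddSubmonoid.coe_set_mk, AddSubsemigroup.coe_set_mk, mem_ofPred_eq, mem_inter_iff, mem_iInter]
  rw [this]
  refine IsClosed.inter (isClosed_iInter fun j => isClosed_iInter fun φ => isClosed_iInter fun h =>
    isClosed_eq (by fun_prop) continuous_const) (IsClosed.inter ?_ (isClosed_iInter fun h =>
    isClosed_eq (by fun_prop) continuous_const))
  exact isClosed_eq (by unfold divOf; fun_prop) continuous_const

theorem planeWave_isTest (α : R3) (n : Fin 3 → ℤ) : IsTest α (planeWave α n) := by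
  refine ⟨contDiff_planeWave α n, fun x m => ?_⟩
  have h1 : Complex.exp (((∑ j, n j * m j : ℤ) : ℂ) * (2 * Real.pi * Complex.I)) = 1 :=
    Complex.exp_int_mul_two_pi_mul_I _
  rw [planeWave, planeWave, ← Complex.exp_add, ← one_mul (Complex.exp (_ + _)), ← h1,
    ← Complex.exp_add]
  congr 1
  simp only [freq, Fin.sum_univ_three, Pi.add_apply]
  push_cast
  ring

theorem fderiv_planeWave (α : R3) (n : Fin 3 → ℤ) (j : Fin 3) (x : R3) :
    fderiv ℝ (planeWave α n) x (Pi.single j 1) =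
      (Complex.I * freq α n j) * planeWave α n x := by
  have h0 : ∀ i, HasFDerivAt (fun x : R3 => ((x i : ℝ) : ℂ))
      (Complex.ofRealCLM.comp (ContinuousLinearMap.proj i)) x := fun i =>
    (Complex.ofRealCLM.comp (ContinuousLinearMap.proj (R := ℝ) (φ := fun _ : Fin 3 => ℝ) i)).hasFDerivAt
  have h1 := ((HasFDerivAt.fun_sum (u := Finset.univ) fun i _ =>
    (h0 i).const_mul (freq α n i : ℂ)).const_mul Complex.I).cexp
  have h2 : fderiv ℝ (planeWave α n) x = _ := h1.fderiv
  rw [h2]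
  change _ = _ * Complex.exp (Complex.I * ∑ i, (freq α n i : ℂ) * (x i : ℂ))
  generalize Complex.exp (Complex.I * ∑ i, (freq α n i : ℂ) * (x i : ℂ)) = z
  simp only [_root_.smul_apply, _root_.sum_apply,
    ContinuousLinearMap.comp_apply, ContinuousLinearMap.proj_apply, Complex.ofRealCLM_apply,
    smul_eq_mul]
  rw [Finset.sum_eq_single j (fun b _ hb => by simp [Pi.single_eq_of_ne hb]) (by simp)]
  simp
  ring

theorem coeff_eq_pairing (α : R3) (u : L2Y) (n : Fin 3 → ℤ) :
    coeff α u n = pairing _ (continuous_conj_planeWave α n) u := rfl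

theorem coeff_partial {α : R3} {j : Fin 3} {u g : L2Y} (h : HasWeakPartial α j u g)
    (n : Fin 3 → ℤ) : coeff α g n = (Complex.I * freq α n j) • coeff α u n := by
  have h1 := h _ (planeWave_isTest α n)
  rw [← neg_eq_iff_eq_neg] at h1
  rw [coeff, ← h1, coeff, ← integral_smul, ← integral_neg]
  congr 1
  funext x
  rw [fderiv_planeWave, ← neg_smul, smul_smul]
  simp

theorem crossBasis_apply (j : Fin 3) (v : C3) :
    crossBasis j v = WithLp.toLp 2 (crossProduct (Pi.single j 1 : Fin 3 → ℂ) v.ofLp) := rfl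

theorem norm_coeff_curl {α : R3} {p : L2Y × (Fin 3 → L2Y)} (hp : p ∈ jSubmodule α)
    (n : Fin 3 → ℤ) :
    ‖coeff α (curlOf p.2) n‖ ^ 2 = (∑ j, freq α n j ^ 2) * ‖coeff α p.1 n‖ ^ 2 := by
  obtain ⟨h1, h2, -⟩ := hp
  have hg := fun j => coeff_partial (h1 j) n
  set a := coeff α p.1 n with ha
  have hc : coeff α (curlOf p.2) n =
      ∑ j, crossBasis j ((Complex.I * freq α n j) • a) := by
    simp only [coeff_eq_pairing, curlOf, map_sum, pairing_compLpL] at hg ⊢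
    simp only [hg, ha, coeff_eq_pairing]
  have hd : ∑ j, (Complex.I * freq α n j) * a j = 0 := by
    have h3 := congrArg (pairing _ (continuous_conj_planeWave α n)) h2
    simp only [divOf, map_sum, pairing_compLpL, map_zero, ← coeff_eq_pairing, hg] at h3
    simpa using h3
  have hd' : ∑ j, (freq α n j : ℂ) * a j = 0 := by
    have : Complex.I * ∑ j, (freq α n j : ℂ) * a j = 0 := by
      rw [Finset.mul_sum, ← hd]
      exact Finset.sum_congr rfl fun j _ => by ring
    simpa using this
  rw [hc]
  clear hc hd h1 h2 hg ha
  generalize freq α n = ξ at *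
  generalize a = b at *
  have hre := congrArg Complex.re hd'
  have him := congrArg Complex.im hd'
  simp only [Fin.sum_univ_three, Complex.add_re, Complex.add_im, Complex.mul_re, Complex.mul_im,
    Complex.ofReal_re, Complex.ofReal_im, zero_mul, sub_zero, add_zero, Complex.zero_re,
    Complex.zero_im] at hre him
  have e : ∀ i, (∑ j, crossBasis j ((Complex.I * (ξ j : ℂ)) • b)) i =
      Complex.I * (crossProduct (fun j => (ξ j : ℂ)) b.ofLp) i := by
    intro i
    fin_cases i <;>
    simp [Fin.sum_univ_three, crossBasis_apply, cross_apply] <;> ring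
  simp only [EuclideanSpace.norm_sq_eq, e, norm_mul, Complex.norm_I, one_mul]
  simp only [Fin.sum_univ_three, cross_apply, Complex.sq_norm, Complex.normSq_apply]
  simp only [Fin.isValue, Matrix.cons_val_zero, Matrix.cons_val_one, Matrix.cons_val_two,
    Matrix.head_cons, Matrix.tail_cons,
    Complex.sub_re, Complex.sub_im, Complex.mul_re, Complex.mul_im, Complex.ofReal_re,
    Complex.ofReal_im, zero_mul, sub_zero, add_zero]
  linear_combination (-(ξ 0 * (b.ofLp 0).re + ξ 1 * (b.ofLp 1).re + ξ 2 * (b.ofLp 2).re)) * hre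
    - (ξ 0 * (b.ofLp 0).im + ξ 1 * (b.ofLp 1).im + ξ 2 * (b.ofLp 2).im) * him

theorem le_freq_sq {α : R3} (hα : α ∈ brillouinZone) (n : Fin 3 → ℤ) (h : α ≠ 0 ∨ n ≠ 0) :
    (if α = 0 then 4 * Real.pi ^ 2 else ∑ j, α j ^ 2) ≤ ∑ j, freq α n j ^ 2 := by
  split_ifs with h0
  · subst h0
    have hn : n ≠ 0 := by simpa using h
    obtain ⟨i, hi⟩ := Function.ne_iff.1 hn
    have h1 : (1 : ℝ) ≤ (n i : ℝ) ^ 2 := by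
      have hi' : n i ≠ 0 := hi
      have h2 : 0 < (n i) ^ 2 := by positivity
      exact_mod_cast h2
    calc 4 * Real.pi ^ 2 ≤ freq 0 n i ^ 2 := by
          simp only [freq, Pi.zero_apply, add_zero]
          nlinarith [sq_nonneg Real.pi, Real.pi_pos]
      _ ≤ _ := Finset.single_le_sum (f := fun j => freq 0 n j ^ 2)
          (fun j _ => sq_nonneg _) (Finset.mem_univ i)
  · refine Finset.sum_le_sum fun j _ => ?_
    obtain ⟨h1, h2⟩ := hα j
    have : 0 ≤ (n j : ℝ) * (Real.pi * n j + α j) := by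
      rcases lt_trichotomy (n j) 0 with h3 | h3 | h3
      · have : (n j : ℝ) ≤ -1 := by exact_mod_cast (by omega : n j ≤ -1)
        apply mul_nonneg_of_nonpos_of_nonpos (by linarith)
        nlinarith [Real.pi_pos]
      · simp [h3]
      · have : (1 : ℝ) ≤ n j := by exact_mod_cast h3
        apply mul_nonneg (by linarith)
        nlinarith [Real.pi_pos]
    simp only [freq]
    nlinarith [Real.pi_pos, mul_nonneg Real.pi_pos.le this]

theorem waveConst_pos {α : R3} :
    0 < (if α = 0 then 4 * Real.pi ^ 2 else ∑ j, α j ^ 2) := by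
  split_ifs with h0
  · positivity
  · obtain ⟨i, hi⟩ := Function.ne_iff.1 h0
    refine Finset.sum_pos' (fun j _ => sq_nonneg _) ⟨i, Finset.mem_univ i, ?_⟩
    have : α i ≠ 0 := hi
    positivity

theorem poincare_sq {α : R3} (hα : α ∈ brillouinZone) {p : L2Y × (Fin 3 → L2Y)}
    (hp : p ∈ jSubmodule α) :
    (if α = 0 then 4 * Real.pi ^ 2 else ∑ j, α j ^ 2) * ‖p.1‖ ^ 2 ≤ ‖curlOf p.2‖ ^ 2 := by
  refine hasSum_le (fun n => ?_) ((parseval α p.1).mul_left _) (parseval α (curlOf p.2))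
  rw [norm_coeff_curl hp]
  by_cases h : α ≠ 0 ∨ n ≠ 0
  · exact mul_le_mul_of_nonneg_right (le_freq_sq hα n h) (sq_nonneg _)
  · push Not at h
    obtain ⟨rfl, rfl⟩ := h
    have : coeff 0 p.1 0 = 0 := by
      have := hp.2.2 rfl
      simpa [coeff, planeWave, freq] using this
    simp [this]

theorem norm_partial_le {α : R3} {p : L2Y × (Fin 3 → L2Y)}
    (hp : p ∈ jSubmodule α) (j : Fin 3) : ‖p.2 j‖ ≤ ‖curlOf p.2‖ := by
  refine (abs_le_of_sq_le_sq' ?_ (norm_nonneg _)).2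
  refine hasSum_le (fun n => ?_) (parseval α (p.2 j)) (parseval α (curlOf p.2))
  rw [norm_coeff_curl hp, coeff_partial (hp.1 j), norm_smul, mul_pow]
  refine mul_le_mul_of_nonneg_right ?_ (sq_nonneg _)
  simp only [norm_mul, Complex.norm_I, one_mul, Complex.norm_real, Real.norm_eq_abs, sq_abs]
  exact Finset.single_le_sum (f := fun j => freq α n j ^ 2)
          (fun j _ => sq_nonneg _) (Finset.mem_univ j)

/-- `J_#(α, Y, ℂ³)` as a type; it carries the inner product `⟨u, v⟩ = ∫_Y ∇×u · conj (∇×v)`. -/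
def JSpace (α : brillouinZone) : Type := jSubmodule α.1

variable (α : brillouinZone)

instance JSpace.addCommGroup : AddCommGroup (JSpace α) :=
  inferInstanceAs (AddCommGroup (jSubmodule α.1))

instance JSpace.module : Module ℂ (JSpace α) :=
  inferInstanceAs (Module ℂ (jSubmodule α.1))

/-- The field underlying an element of `JSpace α`. -/
def fieldLin : JSpace α →ₗ[ℂ] L2Y :=
  LinearMap.fst ℂ L2Y (Fin 3 → L2Y) ∘ₗ (jSubmodule α.1).subtype

theorem continuous_curlOf : Continuous curlOf := by
  unfold curlOf; fun_prop

/-- The curl of an element of `JSpace α`. -/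
def curlLin : JSpace α →ₗ[ℂ] L2Y :=
  { toFun := curlOf
    map_add' := fun g h => by simp [curlOf, Finset.sum_add_distrib]
    map_smul' := fun c g => by simp [curlOf, Finset.smul_sum] } ∘ₗ
  LinearMap.snd ℂ L2Y (Fin 3 → L2Y) ∘ₗ (jSubmodule α.1).subtype

theorem norm_field_le (u : JSpace α) :
    ‖fieldLin α u‖ ≤
      (Real.sqrt (if α.1 = 0 then 4 * Real.pi ^ 2 else ∑ j, α.1 j ^ 2))⁻¹ * ‖curlLin α u‖ := by
  have h1 : _ * ‖fieldLin α u‖ ^ 2 ≤ ‖curlLin α u‖ ^ 2 := poincare_sq α.2 u.2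
  have h2 := waveConst_pos (α := α.1)
  generalize (if α.1 = 0 then 4 * Real.pi ^ 2 else ∑ j, α.1 j ^ 2) = c at *
  rw [le_inv_mul_iff₀ (Real.sqrt_pos.2 h2)]
  refine (abs_le_of_sq_le_sq' ?_ (norm_nonneg _)).2
  rwa [mul_pow, Real.sq_sqrt h2.le]

theorem curlLin_injective : Function.Injective (curlLin α) := by
  rw [injective_iff_map_eq_zero]
  intro u hu
  have h1 : fieldLin α u = 0 := by
    have := norm_field_le α u
    rw [hu, norm_zero, mul_zero] at this
    exact norm_le_zero_iff.1 this
  have h2 : ∀ j, u.1.2 j = 0 := fun j => by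
    have : ‖u.1.2 j‖ ≤ ‖curlLin α u‖ := norm_partial_le u.2 j
    rw [hu, norm_zero] at this
    exact norm_le_zero_iff.1 this
  exact Subtype.ext (Prod.ext h1 (funext h2))

instance JSpace.normedAddCommGroup : NormedAddCommGroup (JSpace α) :=
  NormedAddCommGroup.induced (JSpace α) L2Y (curlLin α) (curlLin_injective α)

instance JSpace.innerProductSpace : InnerProductSpace ℂ (JSpace α) where
  inner u v := inner ℂ (curlLin α u) (curlLin α v)
  norm_smul_le c u := by
    change ‖curlLin α (c • u)‖ ≤ ‖c‖ * ‖curlLin α u‖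
    rw [map_smul, norm_smul]
  norm_sq_eq_re_inner u := norm_sq_eq_re_inner (𝕜 := ℂ) (curlLin α u)
  conj_inner_symm u v := inner_conj_symm _ _
  add_left u v w := by
    change inner ℂ (curlLin α (u + v)) (curlLin α w) = _
    rw [map_add, inner_add_left]
  smul_left u v c := by
    change inner ℂ (curlLin α (c • u)) (curlLin α v) = _
    rw [map_smul, inner_smul_left]

/-- The curl, an isometry of `JSpace α` into `L²(Y, ℂ³)`. -/
def curl : JSpace α →ₗᵢ[ℂ] L2Y := ⟨curlLin α, fun _ => rfl⟩

theorem inner_JSpace (u v : JSpace α) :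
    inner ℂ u v = ∫ x in unitCell, inner ℂ (curl α u x) (curl α v x) := by
  change inner ℂ (curl α u) (curl α v) = _
  rw [L2.inner_def]

instance JSpace.completeSpace : CompleteSpace (JSpace α) := by
  have hcl := isClosed_jSubmodule α.1
  have : CompleteSpace (jSubmodule α.1) := hcl.completeSpace_coe
  let c : jSubmodule α.1 → L2Y := curlLin α
  have hc : UniformContinuous c := by
    let c' : jSubmodule α.1 →L[ℂ] L2Y :=
      ⟨curlLin α, continuous_curlOf.comp (continuous_snd.comp continuous_subtype_val)⟩
    exact c'.uniformContinuous
  set K : ℝ := (Real.sqrt (if α.1 = 0 then 4 * Real.pi ^ 2 else ∑ j, α.1 j ^ 2))⁻¹ + 1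
  have hK0 : 0 ≤ (Real.sqrt (if α.1 = 0 then 4 * Real.pi ^ 2 else ∑ j, α.1 j ^ 2))⁻¹ := by
    positivity
  have hK : AntilipschitzWith K.toNNReal c := by
    have hb : ∀ u : jSubmodule α.1, ‖u‖ ≤ K * ‖c u‖ := by
      intro u
      refine max_le ((norm_field_le α u).trans ?_) ?_
      · exact mul_le_mul_of_nonneg_right (by simp [K]) (norm_nonneg _)
      · refine (pi_norm_le_iff_of_nonneg (by positivity)).2 fun j => ?_
        refine (norm_partial_le u.2 j).trans ?_
        exact le_mul_of_one_le_left (norm_nonneg _) (by simp only [K]; linarith)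
    refine AntilipschitzWith.of_le_mul_dist fun u v => ?_
    rw [dist_eq_norm, dist_eq_norm, Real.coe_toNNReal _ (by positivity)]
    have h3 : c u - c v = c (u - v) := ((curlLin α).map_sub u v).symm
    rw [h3]
    exact hb _
  have hr : IsComplete (range (curl α)) := (hK.isClosed_range hc).isComplete
  exact (completeSpace_iff_isComplete_range (curl α).isometry.isUniformInducing).2 hr

/-- The embedding `J_#(α, Y, ℂ³) → L²_#(α, Y, ℂ³)`. -/
def emb : JSpace α →L[ℂ] L2Y := (fieldLin α).mkContinuous _ (norm_field_le α)

/-- The operator `(-Δ_α)⁻¹ : L²_# → J_#`, determined by `⟨(-Δ_α)⁻¹ u, v⟩ = ∫_Y u · conj v`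
for all `v ∈ J_#`. -/
def invLaplacian : L2Y →L[ℂ] JSpace α := ContinuousLinearMap.adjoint (emb α)

theorem inner_invLaplacian (u : L2Y) (v : JSpace α) :
    inner ℂ v (invLaplacian α u) = ∫ x in unitCell, inner ℂ (emb α v x) (u x) := by
  rw [invLaplacian, ContinuousLinearMap.adjoint_inner_right, L2.inner_def]

/-- The part `D ⊆ Y` of the cell occupied by the inclusions. No regularity of its boundary is
needed for what follows. -/
structure Inclusion where
  carrier : Set R3
  measurable : MeasurableSet carrier
  subset : carrier ⊆ unitCell

/-- The host `H = Y \ D`. -/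
def Inclusion.host (D : Inclusion) : Set R3 := unitCell \ D.carrier

/-- The sesquilinear form `B_k(u, w) = k ∫_H ∇×u · conj (∇×w) + ∫_D ∇×u · conj (∇×w)`. -/
def blochForm (D : Inclusion) (k : ℂ) (u w : JSpace α) : ℂ :=
  k * (∫ x in D.host, inner ℂ (curl α w x) (curl α u x)) +
    ∫ x in D.carrier, inner ℂ (curl α w x) (curl α u x)

/-- The curl restricted to a subset `S` of the cell. -/
def curlOn (S : Set R3) : JSpace α →L[ℂ] Lp C3 2 ((volume.restrict unitCell).restrict S) :=
  LpToLpRestrictCLM R3 C3 ℂ (volume.restrict unitCell) 2 S ∘L (curl α).toContinuousLinearMap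

/-- The operator `X` with `⟨X u, w⟩ = ∫_S ∇×u · conj (∇×w)`. -/
def energyOp (S : Set R3) : JSpace α →L[ℂ] JSpace α :=
  ContinuousLinearMap.adjoint (curlOn α S) ∘L curlOn α S

theorem inner_energyOp {S : Set R3} (hS : MeasurableSet S) (hSY : S ⊆ unitCell)
    (u w : JSpace α) :
    inner ℂ w (energyOp α S u) = ∫ x in S, inner ℂ (curl α w x) (curl α u x) := by
  have e : (volume.restrict unitCell).restrict S = volume.restrict S := by
    rw [Measure.restrict_restrict hS, inter_eq_left.2 hSY]
  rw [energyOp, ContinuousLinearMap.comp_apply, ContinuousLinearMap.adjoint_inner_right,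
    L2.inner_def]
  rw [← e]
  refine integral_congr_ae ?_
  filter_upwards [LpToLpRestrictCLM_coeFn ℂ S (curl α u), LpToLpRestrictCLM_coeFn ℂ S (curl α w)]
    with x hx hy
  change inner ℂ (LpToLpRestrictCLM R3 C3 ℂ (volume.restrict unitCell) 2 S (curl α w) x)
    (LpToLpRestrictCLM R3 C3 ℂ (volume.restrict unitCell) 2 S (curl α u) x) = _
  rw [hx, hy]

variable (D : Inclusion)

/-- The operator `T_k^α` of the form `B_k`: `⟨T_k u, w⟩ = B_k(u, w)`. -/
def opTk (k : ℂ) : JSpace α →L[ℂ] JSpace α :=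
  k • energyOp α D.host + energyOp α D.carrier

theorem inner_opTk (k : ℂ) (u w : JSpace α) :
    inner ℂ w (opTk α D k u) = blochForm α D k u w := by
  have hH : MeasurableSet D.host := measurableSet_unitCell.diff D.measurable
  simp only [opTk, _root_.add_apply, _root_.smul_apply, inner_add_right, inner_smul_right,
    inner_energyOp α D.measurable D.subset, inner_energyOp α hH sdiff_subset, blochForm]

/-- `T^α`, with `⟨T u, w⟩ = ½ ∫_H ∇×u · conj (∇×w) - ½ ∫_D ∇×u · conj (∇×w)`. -/
def opT : JSpace α →L[ℂ] JSpace α :=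
  (1 / 2 : ℂ) • energyOp α D.host - (1 / 2 : ℂ) • energyOp α D.carrier

/-- `W₁ = {u ∈ J_# : ∇×u = 0 in D}`. -/
def W1 : Submodule ℂ (JSpace α) := (curlOn α D.carrier).ker

/-- `W₂ = {u ∈ J_# : ∇×u = 0 in H}`. -/
def W2 : Submodule ℂ (JSpace α) := (curlOn α D.host).ker

/-- `W₃`, the orthogonal complement of `W₁ ⊕ W₂` in `J_#`. -/
def W3 : Submodule ℂ (JSpace α) := (W1 α D ⊔ W2 α D)ᗮ

instance W1.completeSpace : CompleteSpace (W1 α D) :=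
  ContinuousLinearMap.completeSpace_ker (curlOn α D.carrier)

instance W2.completeSpace : CompleteSpace (W2 α D) :=
  ContinuousLinearMap.completeSpace_ker (curlOn α D.host)

instance W3.completeSpace : CompleteSpace (W3 α D) :=
  Submodule.instOrthogonalCompleteSpace _

/-- The restriction of `T^α` to `W₃`, which is an invariant subspace. -/
def opT3 : W3 α D →L[ℂ] W3 α D :=
  (W3 α D).orthogonalProjectionOnto ∘L opT α D ∘L (W3 α D).subtypeL

/-- The quasiperiodic resonance spectrum `{μ_n(α)} = σ(T^α; W₃)`; as `T^α` is self-adjoint, it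
consists of real numbers. -/
def resonances : Set ℝ := {μ | (μ : ℂ) ∈ spectrum ℂ (opT3 α D)}

/-- The set `Z` of excluded values of `k`: the numbers `(μ - 1/2)/(μ + 1/2)` for the
`μ ≠ -1/2` in the resonance spectrum, and for `μ = 1/2`, the eigenvalue of `T^α` on `W₁`,
the number `0`. -/
def excludedSet : Set ℂ :=
  {k | k = 0 ∨ ∃ μ ∈ resonances α D, μ ≠ -1 / 2 ∧ k = (((μ - 1 / 2) / (μ + 1 / 2) : ℝ) : ℂ)}

/-- The lowest resonance `μ⁻(α)`. -/
def muMinus : ℝ := sInf (resonances α D)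

/-- `z*(α) = (μ⁻ + 1/2)/(μ⁻ - 1/2)`. -/
def zStar : ℝ := (muMinus α D + 1 / 2) / (muMinus α D - 1 / 2)

/-- The radius `r*`, as a function of the distance `d`. -/
def rStar (d : ℝ) : ℝ :=
  if α.1 = 0 then
    4 * Real.pi ^ 2 * d * |zStar α D| / (1 / (1 / 2 - muMinus α D) + 4 * Real.pi ^ 2 * d)
  else
    (∑ i, α.1 i ^ 2) * d * |zStar α D| / (1 / (1 / 2 - muMinus α D) + (∑ i, α.1 i ^ 2) * d)

/-- `B^α(k) = (T_k^α)⁻¹ (-Δ_α)⁻¹` as an operator on `L²_#`. -/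
def opB (k : ℂ) : L2Y →L[ℂ] L2Y :=
  emb α ∘L Ring.inverse (opTk α D k) ∘L invLaplacian α

/-- `A^α(z) = (z P₁ + P₂ + z ∑_μ [(1/2 + μ) + z (1/2 - μ)]⁻¹ P_μ) (-Δ_α)⁻¹` as an operator on
`L²_#`, the sum over the resonances being `[(1/2 + T) + z (1/2 - T)]⁻¹` on `W₃`. -/
def opA (z : ℂ) : L2Y →L[ℂ] L2Y :=
  emb α ∘L
    (z • (W1 α D).starProjection + (W2 α D).starProjection +
      z • ((W3 α D).subtypeL ∘L
        Ring.inverse (((1 / 2 : ℂ) • 1 + opT3 α D) + z • ((1 / 2 : ℂ) • 1 - opT3 α D)) ∘L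
        (W3 α D).orthogonalProjectionOnto)) ∘L
    invLaplacian α

/-- The solutions `h ∈ J_#` of the weak Bloch eigenvalue problem `∇×(a ∇×h) = ξ h`, that is
`B_k(h, w) = ξ ∫_Y h · conj w` for all `w ∈ J_#`. -/
def blochEigenspace (k ξ : ℂ) : Submodule ℂ (JSpace α) where
  carrier := {h | ∀ w : JSpace α,
    blochForm α D k h w = ξ * ∫ x in unitCell, inner ℂ (emb α w x) (emb α h x)}
  add_mem' := by
    intro a b ha hb w
    have h1 := ha w
    have h2 := hb w
    rw [← inner_opTk, ← L2.inner_def] at *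
    rw [map_add, map_add, inner_add_right, inner_add_right, h1, h2, mul_add]
  zero_mem' := by
    intro w
    rw [← inner_opTk, ← L2.inner_def]
    simp
  smul_mem' := by
    intro c a ha w
    have h1 := ha w
    rw [← inner_opTk, ← L2.inner_def] at *
    rw [map_smul, map_smul, inner_smul_right, inner_smul_right, h1]
    ring

/-- `ξ` is a Bloch eigenvalue for the coupling constant `k`. -/
def IsBlochEigenvalue (k ξ : ℂ) : Prop := blochEigenspace α D k ξ ≠ ⊥

/-- The winding number of the closed curve `γ : [0, 1] → ℂ` about `b`. -/
def windingNumber (γ : ℝ → ℂ) (b : ℂ) : ℂ :=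
  (2 * Real.pi * Complex.I)⁻¹ * ∫ t in (0 : ℝ)..1, deriv γ t / (γ t - b)

/-- Positively oriented piecewise `C¹` closed contours `γ : [0, 1] → ℂ`, such as Jordan curves:
the winding number about a point off the curve is `1` (inside) or `0` (outside). -/
structure IsContour (γ : ℝ → ℂ) : Prop where
  continuousOn : ContinuousOn γ (Icc 0 1)
  closed : γ 0 = γ 1
  piecewise : ∃ s : Finset ℝ, (∀ t ∈ Ioo (0 : ℝ) 1 \ s, DifferentiableAt ℝ γ t) ∧
    ContinuousOn (deriv γ) (Ioo (0 : ℝ) 1 \ s) ∧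
    ∃ C, ∀ t ∈ Ioo (0 : ℝ) 1 \ s, ‖deriv γ t‖ ≤ C
  simple : ∀ b ∉ γ '' Icc 0 1, windingNumber γ b = 0 ∨ windingNumber γ b = 1

/-- `γ` does not meet `K`, encloses the point `β` and no other point of `K`. -/
def Isolates (γ : ℝ → ℂ) (K : Set ℂ) (β : ℂ) : Prop :=
  Disjoint (γ '' Icc 0 1) K ∧ windingNumber γ β = 1 ∧
    ∀ b ∈ K, b ≠ β → windingNumber γ b = 0

/-- `dist(γ, K) = inf_{ζ ∈ γ} dist(ζ, K)`. -/
def contourDist (γ : ℝ → ℂ) (K : Set ℂ) : ℝ :=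
  sInf ((fun ζ => Metric.infDist ζ K) '' (γ '' Icc 0 1))

/-- The spectrum of `A` inside `γ`. -/
def spectrumInside (A : L2Y →L[ℂ] L2Y) (γ : ℝ → ℂ) : Set ℂ :=
  {β | β ∈ spectrum ℂ A ∧ windingNumber γ β = 1}

/-- The eigenspace of `A` for `β`. -/
def eigSpace (A : L2Y →L[ℂ] L2Y) (β : ℂ) : Submodule ℂ L2Y :=
  Module.End.eigenspace (A : L2Y →ₗ[ℂ] L2Y) β

/-- The space of generalized eigenvectors of `A` for `β`; its dimension is the algebraic
multiplicity of `β`. -/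
def rootSpace (A : L2Y →L[ℂ] L2Y) (β : ℂ) : Submodule ℂ L2Y :=
  Module.End.maxGenEigenspace (A : L2Y →ₗ[ℂ] L2Y) β

/-- Spectral projection `P = (2πi)⁻¹ ∮_γ (ζ - A)⁻¹ dζ`. -/
def spectralProj (A : L2Y →L[ℂ] L2Y) (γ : ℝ → ℂ) : L2Y →L[ℂ] L2Y :=
  (2 * Real.pi * Complex.I)⁻¹ • ∫ t in (0 : ℝ)..1, deriv γ t • resolvent A (γ t)

/-- For the eigenvalue group `β₁, …, β_m` of `A` inside `γ`, repeated according to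
algebraic multiplicity, the number `f(β₁) + ⋯ + f(β_m)`. -/
def groupSum (A : L2Y →L[ℂ] L2Y) (γ : ℝ → ℂ) (f : ℂ → ℂ) : ℂ :=
  ∑ᶠ β ∈ spectrumInside A γ, (Module.finrank ℂ (rootSpace A β) : ℂ) * f β

end

end PhotonicCrystal

open PhotonicCrystal

/-! Everything is governed by one self-adjoint operator, the host energy X = `energyOp α D.host`.
Since H and D partition the cell, the energy operator of D is 1 - X (`energyOp_add_energyOp`). Hence
T_k = kX + (1 - X) and T = X - 1/2, the spaces W₁ and W₂ are the eigenspaces of X for 1 and 0, and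
W₃ is invariant. On the three orthogonal blocks T_k acts as k, 1 and k(1/2 + T) + (1/2 - T). The
last is an affine function of a self-adjoint operator, so it is invertible unless its symbol
vanishes at a resonance; together with k = 0 this is the set Z (`notMem_excludedSet_iff`). Inverting
block by block gives T_k⁻¹ = `solutionOp` at 1/k, hence B(k) = A(1/k), and holomorphy follows from
analyticity of inversion.

Compactness comes from Fourier series: for a divergence-free field the curl multiplies the size of
the n-th coefficient by |2πn + α|, so the embedding of J_# into L² is a norm limit of finite-rank
operators (`isCompactOperator_emb`). The weak Bloch equation reads T_k h = ξ(-Δ_α)⁻¹h, that is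
A(1/k)h = ξ⁻¹h, and the spectral statements are Riesz theory for the compact operator A(1/k).

For the perturbation part, A(0) involves only P₂ and is self-adjoint, so its resolvent is bounded by
1/d on Γ (`norm_resolvent_le`). A quadratic-form bound for the pencil (`le_norm_pencilOf`) and two
uses of the Poincaré inequality, with constant c, give ‖A(z) - A(0)‖ ≤ |z| / ((1/2 - μ⁻)(|z*| -
|z|)c), and r* is the radius at which the right side equals d. A Neumann series then keeps Γ in the
resolvent set for |z| < r*.

Γ is controlled only through its winding numbers. The Riesz integral (`IsContour.rieszProjection`)
is therefore computed by hand: finitely many large eigenvalues contribute terminating resolvent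
expansions, and the rest of the spectrum lies in a disc about 0 off which the resolvent is a Laurent
series. Finally A(z) on the range of P(z) is transported to a fixed finite-dimensional space, where
the power sums, negative ones included, are traces of powers of an analytic family
(`analyticAt_sum_zpow`). The sum with exponent 0 is locally constant, hence equal to m on the whole
disc (`groupSum_one`). -/

namespace PhotonicCrystal
noncomputable section
open MeasureTheory Set Filter Topology
open scoped ContDiff

/-! ### Contour integrals over piecewise C¹ closed curves. -/

section Contour

variable {E : Type*} [NormedAddCommGroup E] [NormedSpace ℂ E]

/-- The contour integral `(2πi)⁻¹ ∮_γ f dζ`, for `f` given as a function of the parameter. -/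
def contourIntegral (γ : ℝ → ℂ) (f : ℝ → E) : E :=
  (2 * Real.pi * Complex.I : ℂ)⁻¹ • ∫ t in (0 : ℝ)..1, deriv γ t • f t

theorem windingNumber_eq_contourIntegral (γ : ℝ → ℂ) (b : ℂ) :
    windingNumber γ b = contourIntegral γ fun t => (γ t - b)⁻¹ := by
  simp only [windingNumber, contourIntegral, div_eq_mul_inv, smul_eq_mul]

theorem spectralProj_eq_contourIntegral (A : L2Y →L[ℂ] L2Y) (γ : ℝ → ℂ) :
    spectralProj A γ = contourIntegral γ fun t => resolvent A (γ t) := rfl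

variable {γ : ℝ → ℂ}

/-- The break points and the endpoint 1 form a null set, so no integral sees the values of `deriv γ`
there. -/
theorem IsContour.ae_norm_deriv_le (hγ : IsContour γ) :
    ∃ C, ∀ᵐ t ∂volume.restrict (Ioc (0 : ℝ) 1), ‖deriv γ t‖ ≤ C := by
  obtain ⟨s, -, -, C, hC⟩ := hγ.piecewise
  refine ⟨C, ?_⟩
  have h1 : ∀ᵐ t : ℝ, t ∉ (insert 1 s : Finset ℝ) :=
    (Finset.countable_toSet _).ae_notMem _
  filter_upwards [ae_restrict_of_ae h1, ae_restrict_mem measurableSet_Ioc] with t ht ht'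
  simp only [Finset.mem_insert, not_or] at ht
  exact hC t ⟨⟨ht'.1, lt_of_le_of_ne ht'.2 ht.1⟩, ht.2⟩

theorem IsContour.intervalIntegrable_deriv_smul (hγ : IsContour γ) {f : ℝ → E}
    (hf : ContinuousOn f (Icc 0 1)) :
    IntervalIntegrable (fun t => deriv γ t • f t) volume 0 1 := by
  rw [intervalIntegrable_iff_integrableOn_Ioc_of_le zero_le_one]
  obtain ⟨C, hC⟩ := hγ.ae_norm_deriv_le
  have h2 : IntegrableOn f (Ioc 0 1) := hf.integrableOn_Icc.mono_set Ioc_subset_Icc_self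
  exact Integrable.bdd_smul h2 C (measurable_deriv γ).aestronglyMeasurable hC

theorem contourIntegral_congr {f g : ℝ → E} (h : ∀ t ∈ Icc (0 : ℝ) 1, f t = g t) :
    contourIntegral γ f = contourIntegral γ g := by
  unfold contourIntegral
  congr 1
  refine intervalIntegral.integral_congr fun t ht => ?_
  rw [uIcc_of_le zero_le_one] at ht
  simp only [h t ht]

theorem IsContour.contourIntegral_add (hγ : IsContour γ) {f g : ℝ → E}
    (hf : ContinuousOn f (Icc 0 1)) (hg : ContinuousOn g (Icc 0 1)) :
    contourIntegral γ (fun t => f t + g t) = contourIntegral γ f + contourIntegral γ g := by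
  simp only [contourIntegral, smul_add]
  rw [intervalIntegral.integral_add (hγ.intervalIntegrable_deriv_smul hf)
    (hγ.intervalIntegrable_deriv_smul hg), smul_add]

theorem IsContour.contourIntegral_sum (hγ : IsContour γ) {ι : Type*} (s : Finset ι)
    {f : ι → ℝ → E} (hf : ∀ i ∈ s, ContinuousOn (f i) (Icc 0 1)) :
    contourIntegral γ (fun t => ∑ i ∈ s, f i t) = ∑ i ∈ s, contourIntegral γ (f i) := by
  simp only [contourIntegral, Finset.smul_sum]
  rw [intervalIntegral.integral_finsetSum fun i hi => hγ.intervalIntegrable_deriv_smul (hf i hi),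
    Finset.smul_sum]

theorem contourIntegral_smul_const [CompleteSpace E] (g : ℝ → ℂ) (x : E) :
    contourIntegral γ (fun t => g t • x) = contourIntegral γ g • x := by
  simp only [contourIntegral, smul_assoc, ← smul_eq_mul]
  rw [← intervalIntegral.integral_smul_const]
  simp only [smul_assoc]

theorem IsContour.contourIntegral_comp [CompleteSpace E] {F : Type*} [NormedAddCommGroup F]
    [NormedSpace ℂ F] [CompleteSpace F] (hγ : IsContour γ) (L : E →L[ℂ] F) {f : ℝ → E}
    (hf : ContinuousOn f (Icc 0 1)) :
    contourIntegral γ (fun t => L (f t)) = L (contourIntegral γ f) := by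
  simp only [contourIntegral, map_smul]
  rw [← L.intervalIntegral_comp_comm (hγ.intervalIntegrable_deriv_smul hf)]
  simp only [map_smul]

theorem IsContour.isCompact_image (hγ : IsContour γ) : IsCompact (γ '' Icc 0 1) :=
  isCompact_Icc.image_of_continuousOn hγ.continuousOn

/-- Integer powers other than `-1` have a single-valued primitive. -/
theorem IsContour.contourIntegral_zpow (hγ : IsContour γ) {b : ℂ} (hb : b ∉ γ '' Icc 0 1)
    {m : ℤ} (hm : m ≠ -1) : contourIntegral γ (fun t => (γ t - b) ^ m) = 0 := by
  have hne : ∀ t ∈ Icc (0 : ℝ) 1, γ t - b ≠ 0 := fun t ht h =>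
    hb ⟨t, ht, sub_eq_zero.1 h⟩
  have hc : ∀ n : ℤ, ContinuousOn (fun t => (γ t - b) ^ n) (Icc 0 1) := fun n =>
    (hγ.continuousOn.sub continuousOn_const).zpow₀ n fun t ht => Or.inl (hne t ht)
  have hm' : ((m + 1 : ℤ) : ℂ) ≠ 0 := by
    rw [Int.cast_ne_zero]; omega
  obtain ⟨s, hs, -, -⟩ := hγ.piecewise
  -- The primitive (γ - b)^(m+1)/(m+1) is continuous on [0, 1] and differentiable off the break
  -- points, which is enough for the fundamental theorem; its end values agree because γ is closed.
  have key := MeasureTheory.integral_eq_of_hasDerivAt_off_countable_of_le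
    (fun t => ((m + 1 : ℤ) : ℂ)⁻¹ * (γ t - b) ^ (m + 1)) (fun t => deriv γ t • (γ t - b) ^ m)
    zero_le_one (Finset.countable_toSet s) (continuousOn_const.mul (hc (m + 1)))
    (fun t ht => by
      have h1 := ((hs t ht).hasDerivAt.sub_const b)
      have h2 := (hasDerivAt_zpow (m + 1) (γ t - b) (Or.inl (hne t (Ioo_subset_Icc_self ht.1))))
      have h3 := (h2.comp t h1).const_mul (((m + 1 : ℤ) : ℂ)⁻¹)
      refine h3.congr_deriv ?_
      rw [add_sub_cancel_right, smul_eq_mul]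
      field_simp)
    (hγ.intervalIntegrable_deriv_smul (hc m))
  rw [contourIntegral, key, hγ.closed, sub_self, smul_zero]

/-- The contour integral as a continuous linear functional of the continuous integrand. -/
theorem IsContour.exists_clm [CompleteSpace E] (hγ : IsContour γ) :
    ∃ L : C(Icc (0 : ℝ) 1, E) →L[ℂ] E, ∀ f : C(Icc (0 : ℝ) 1, E),
      L f = contourIntegral γ (fun t => f (projIcc 0 1 zero_le_one t)) := by
  have hc : ∀ f : C(Icc (0 : ℝ) 1, E),
      ContinuousOn (fun t => f (projIcc 0 1 zero_le_one t)) (Icc 0 1) := fun f =>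
    (f.continuous.comp continuous_projIcc).continuousOn
  let L : C(Icc (0 : ℝ) 1, E) →ₗ[ℂ] E :=
    { toFun := fun f => contourIntegral γ (fun t => f (projIcc 0 1 zero_le_one t))
      map_add' := fun f g => hγ.contourIntegral_add (hc f) (hc g)
      map_smul' := fun c f =>
        hγ.contourIntegral_comp (c • ContinuousLinearMap.id ℂ E) (hc f) }
  obtain ⟨C, hC⟩ := hγ.ae_norm_deriv_le
  refine ⟨L.mkContinuous (‖(2 * Real.pi * Complex.I : ℂ)⁻¹‖ * C) fun f => ?_, fun f => rfl⟩
  change ‖contourIntegral γ (fun t => f (projIcc 0 1 zero_le_one t))‖ ≤ _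
  rw [contourIntegral, norm_smul, mul_assoc _ C]
  refine mul_le_mul_of_nonneg_left ?_ (norm_nonneg _)
  have := intervalIntegral.norm_integral_le_of_norm_le_const_ae (a := 0) (b := 1)
    (f := fun t => deriv γ t • f (projIcc 0 1 zero_le_one t)) (C := C * ‖f‖) (by
      rw [uIoc_of_le zero_le_one]
      filter_upwards [(ae_restrict_iff' measurableSet_Ioc).1 hC] with t ht ht'
      rw [norm_smul]
      exact mul_le_mul (ht ht') (f.norm_coe_le_norm _) (norm_nonneg _)
        ((norm_nonneg _).trans (ht ht')))
  simpa using this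

end Contour

/-! ### Integrals of the resolvent in a Banach algebra. -/

section Resolvent

variable {B : Type*} [NormedRing B] [NormedAlgebra ℂ B] [CompleteSpace B] {γ : ℝ → ℂ}

theorem continuousOn_resolvent_comp (hγ : ContinuousOn γ (Icc 0 1)) {a : B}
    (h : γ '' Icc 0 1 ⊆ resolventSet ℂ a) :
    ContinuousOn (fun t => resolvent a (γ t)) (Icc 0 1) := fun t ht =>
  ((spectrum.hasDerivAt_resolvent_const_left
    (h ⟨t, ht, rfl⟩)).continuousAt.comp_continuousWithinAt (hγ t ht))

/-- The integral of the resolvent depends analytically on the operator. -/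
theorem IsContour.analyticAt_contourIntegral_resolvent (hγ : IsContour γ) {A : ℂ → B} {z : ℂ}
    (hA : AnalyticAt ℂ A z) (h : γ '' Icc 0 1 ⊆ resolventSet ℂ (A z)) :
    AnalyticAt ℂ (fun z => contourIntegral γ fun t => resolvent (A z) (γ t)) z := by
  obtain ⟨L, hL⟩ := hγ.exists_clm (E := B)
  let g : C(Icc (0 : ℝ) 1, B) :=
    ⟨fun t => algebraMap ℂ B (γ t), (algebraMapCLM ℂ B).continuous.comp hγ.continuousOn.domRestrict⟩
  let c : B →L[ℂ] C(Icc (0 : ℝ) 1, B) := ContinuousLinearMap.const ℂ (Icc (0 : ℝ) 1)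
  -- Inverting γ(t) - A(z) for all t at once is inversion in the Banach algebra C([0, 1], B), where
  -- units are detected pointwise and inversion is analytic.
  have hu : IsUnit (g - c (A z)) := by
    rw [ContinuousMap.isUnit_iff_forall_isUnit]
    exact fun t => h ⟨t, t.2, rfl⟩
  have h1 : AnalyticAt ℂ (fun z => g - c (A z)) z :=
    analyticAt_const.sub ((c.analyticAt _).comp hA)
  have h2 : AnalyticAt ℂ (fun z => Ring.inverse (g - c (A z))) z := by
    obtain ⟨u, hu⟩ := hu
    exact AnalyticAt.fun_comp (by rw [← hu]; exact analyticAt_inverse u) h1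
  refine ((L.analyticAt _).comp h2).congr ?_
  have h3 : ∀ᶠ w in 𝓝 z, IsUnit (g - c (A w)) :=
    h1.continuousAt.eventually (Units.isOpen.mem_nhds hu)
  filter_upwards [h3] with w hw
  rw [Function.comp_apply, hL]
  refine contourIntegral_congr fun t ht => ?_
  have h4 := congrArg (fun f : C(Icc (0 : ℝ) 1, B) => f ⟨t, ht⟩) (Ring.mul_inverse_cancel _ hw)
  have h5 := congrArg (fun f : C(Icc (0 : ℝ) 1, B) => f ⟨t, ht⟩) (Ring.inverse_mul_cancel _ hw)
  rw [projIcc_of_mem zero_le_one ht]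
  change (algebraMap ℂ B (γ t) - A w) * _ = 1 at h4
  change _ * (algebraMap ℂ B (γ t) - A w) = 1 at h5
  rw [resolvent]
  generalize (Ring.inverse (g - c (A w))) ⟨t, ht⟩ = y at *
  exact (Ring.inverse_unit ⟨_, y, h4, h5⟩).symm

/-- If the contour stays outside the disc containing the spectrum of `a`, the integral of the
resolvent is the winding number about `0`. -/
theorem IsContour.contourIntegral_resolvent_eq (hγ : IsContour γ) [Nontrivial B] {a : B} {δ : ℝ}
    (hδ : ∀ t ∈ Icc (0 : ℝ) 1, δ ≤ ‖γ t‖) (ha : ∀ b ∈ spectrum ℂ a, ‖b‖ < δ) :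
    contourIntegral γ (fun t => resolvent a (γ t)) = windingNumber γ 0 • (1 : B) := by
  have hδ0 : 0 < δ := by
    obtain ⟨b, hb⟩ := spectrum.nonempty a
    exact (norm_nonneg b).trans_lt (ha b hb)
  have h1 : spectralRadius ℂ a < (δ.toNNReal : ENNReal) :=
    spectrum.spectralRadius_lt_of_forall_lt a fun b hb =>
      NNReal.coe_lt_coe.1 (by rw [Real.coe_toNNReal _ hδ0.le]; exact ha b hb)
  obtain ⟨ρ, hρ1, hρ2⟩ := ENNReal.lt_iff_exists_nnreal_btwn.1 h1
  have hρδ : (ρ : ℝ) < δ := by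
    have := ENNReal.coe_lt_coe.1 hρ2
    rwa [← NNReal.coe_lt_coe, Real.coe_toNNReal _ hδ0.le] at this
  -- Gelfand's formula. The gap between ρ and δ makes the Laurent series converge uniformly along
  -- the contour, though ‖a‖ itself may exceed δ.
  have h2 : ∀ᶠ n : ℕ in atTop, ‖a ^ n‖ ≤ (ρ : ℝ) ^ n := by
    have := (spectrum.pow_nnnorm_pow_one_div_tendsto_nhds_spectralRadius a).eventually_lt_const hρ1
    filter_upwards [this, eventually_gt_atTop 0] with n hn hn0
    have hn' : (0 : ℝ) < n := by exact_mod_cast hn0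
    rw [one_div, ENNReal.rpow_inv_lt_iff hn', ENNReal.rpow_natCast] at hn
    exact_mod_cast hn.le
  have h0 : ∀ t ∈ Icc (0 : ℝ) 1, γ t ≠ 0 := fun t ht h => by
    have := hδ t ht
    rw [h, norm_zero] at this
    linarith
  have h0' : (0 : ℂ) ∉ γ '' Icc 0 1 := fun ⟨t, ht, h⟩ => h0 t ht h
  have hsum : Summable fun n : ℕ => δ⁻¹ ^ (n + 1) * ‖a ^ n‖ := by
    have hg : Summable fun n : ℕ => δ⁻¹ * (δ⁻¹ * ρ) ^ n :=
      (summable_geometric_of_lt_one (by positivity) (by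
        rw [inv_mul_lt_iff₀ hδ0]; simpa using hρδ)).mul_left _
    refine summable_of_isBigO_nat hg (Asymptotics.IsBigO.of_bound 1 ?_)
    filter_upwards [h2] with n hn
    rw [one_mul, Real.norm_of_nonneg (by positivity), Real.norm_of_nonneg (by positivity),
      mul_pow, pow_succ']
    rw [mul_assoc]
    gcongr
  have hnorm : ∀ t ∈ Icc (0 : ℝ) 1, ∀ n : ℕ,
      ‖(γ t ^ (-(n + 1 : ℤ))) • a ^ n‖ ≤ δ⁻¹ ^ (n + 1) * ‖a ^ n‖ := fun t ht n => by
    rw [norm_smul, zpow_neg, norm_inv, norm_zpow, inv_pow]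
    have := hδ t ht
    have e : ‖γ t‖ ^ ((n : ℤ) + 1) = ‖γ t‖ ^ (n + 1) := by
      exact_mod_cast zpow_natCast ‖γ t‖ (n + 1)
    rw [e]
    gcongr
  -- The expansion of the resolvent at infinity, ∑ aⁿ/ζⁿ⁺¹; multiplied by ζ - a it telescopes to 1.
  have hres : ∀ t ∈ Icc (0 : ℝ) 1,
      HasSum (fun n : ℕ => (γ t ^ (-(n + 1 : ℤ))) • a ^ n) (resolvent a (γ t)) := fun t ht => by
    have hs : Summable (fun n : ℕ => (γ t ^ (-(n + 1 : ℤ))) • a ^ n) :=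
      Summable.of_norm_bounded hsum (hnorm t ht)
    have hmul : (algebraMap ℂ B (γ t) - a) * ∑' n : ℕ, (γ t ^ (-(n + 1 : ℤ))) • a ^ n = 1 := by
      have e := hs.hasSum.mul_left (algebraMap ℂ B (γ t) - a)
      have e' : HasSum (fun n : ℕ => (γ t ^ (-(n : ℤ))) • a ^ n -
          (γ t ^ (-((n + 1 : ℕ) : ℤ))) • a ^ (n + 1)) 1 := by
        have hs' : Summable (fun n : ℕ => (γ t ^ (-(n : ℤ))) • a ^ n) := by
          refine (hs.const_smul (γ t)).congr fun n => ?_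
          rw [smul_smul, ← zpow_one_add₀ (h0 t ht)]
          congr 2; ring
        have := hs'.hasSum.sub ((summable_nat_add_iff 1).2 hs').hasSum
        rw [hs'.tsum_eq_zero_add, add_sub_cancel_right] at this
        have e0 : γ t ^ (-((0 : ℕ) : ℤ)) • a ^ 0 = 1 := by simp
        rwa [e0] at this
      refine e.unique (e'.congr_fun fun n => ?_)
      rw [sub_mul, ← Algebra.smul_def, smul_smul, ← zpow_one_add₀ (h0 t ht), mul_smul_comm,
        ← pow_succ']
      push_cast
      congr 3; ring
    have hcomm : (∑' n : ℕ, (γ t ^ (-(n + 1 : ℤ))) • a ^ n) * (algebraMap ℂ B (γ t) - a) = 1 := by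
      rw [← hmul]
      refine (Commute.sub_right (Algebra.commutes _ _).symm ?_)
      exact Commute.tsum_left _ fun n => (Commute.pow_self a n).smul_left _
    have : resolvent a (γ t) = ∑' n : ℕ, (γ t ^ (-(n + 1 : ℤ))) • a ^ n :=
      Ring.inverse_unit ⟨_, _, hmul, hcomm⟩
    rw [this]
    exact hs.hasSum
  obtain ⟨C, hC⟩ := hγ.ae_norm_deriv_le
  have hcn : ∀ n : ℕ, ContinuousOn (fun t => (γ t ^ (-(n + 1 : ℤ))) • a ^ n) (Icc 0 1) :=
    fun n => (hγ.continuousOn.zpow₀ _ fun t ht => Or.inl (h0 t ht)).smul continuousOn_const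
  have key := intervalIntegral.hasSum_integral_of_dominated_convergence (a := (0 : ℝ)) (b := 1)
    (μ := volume) (F := fun (n : ℕ) t => deriv γ t • (γ t ^ (-(n + 1 : ℤ))) • a ^ n)
    (f := fun t => deriv γ t • resolvent a (γ t))
    (fun n _ => C * (δ⁻¹ ^ (n + 1) * ‖a ^ n‖))
    (fun n => by
      have := (hγ.intervalIntegrable_deriv_smul (hcn n)).1.aestronglyMeasurable
      rwa [uIoc_of_le zero_le_one])
    (fun n => by
      rw [uIoc_of_le zero_le_one]
      filter_upwards [(ae_restrict_iff' measurableSet_Ioc).1 hC] with t ht ht'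
      rw [norm_smul]
      exact mul_le_mul (ht ht') (hnorm t (Ioc_subset_Icc_self ht') n) (norm_nonneg _)
        ((norm_nonneg _).trans (ht ht')))
    (Eventually.of_forall fun t _ => hsum.mul_left C)
    (by simp)
    (Eventually.of_forall fun t ht => by
      rw [uIoc_of_le zero_le_one] at ht
      exact (hres t (Ioc_subset_Icc_self ht)).const_smul _)
  have key2 := key.const_smul ((2 * Real.pi * Complex.I : ℂ)⁻¹)
  refine key2.unique ?_
  -- Powers of γ below -1 have a primitive, so termwise integration leaves only n = 0.
  have hterm : ∀ n : ℕ, contourIntegral γ (fun t => (γ t ^ (-(n + 1 : ℤ))) • a ^ n) =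
      if n = 0 then windingNumber γ 0 • (1 : B) else 0 := fun n => by
    rw [contourIntegral_smul_const]
    split_ifs with hn
    · subst hn
      rw [windingNumber_eq_contourIntegral]
      simp
    · have := hγ.contourIntegral_zpow h0' (m := -(n + 1 : ℤ)) (by omega)
      simp only [sub_zero] at this
      rw [this, zero_smul]
  refine (hasSum_ite_eq 0 (windingNumber γ 0 • (1 : B))).congr_fun fun n => ?_
  exact hterm n

/-- The winding number is constant on discs not meeting the contour. -/
theorem IsContour.windingNumber_eq_of_norm_lt (hγ : IsContour γ) {δ : ℝ}
    (hδ : ∀ t ∈ Icc (0 : ℝ) 1, δ ≤ ‖γ t‖) {b : ℂ} (hb : ‖b‖ < δ) :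
    windingNumber γ b = windingNumber γ 0 := by
  -- The same integral in the algebra ℂ, where the resolvent of b at ζ is 1/(ζ - b).
  have := hγ.contourIntegral_resolvent_eq hδ (a := b) (by
    intro c hc
    have h2 := spectrum.norm_le_norm_of_mem hc
    exact h2.trans_lt hb)
  rw [smul_eq_mul, mul_one] at this
  rw [← this, windingNumber_eq_contourIntegral]
  simp [resolvent, Ring.inverse_eq_inv']

end Resolvent

end

end PhotonicCrystal

namespace PhotonicCrystal
noncomputable section
open MeasureTheory Set Filter Topology
open scoped ContDiff

/-! ### Riesz theory of compact operators on a Hilbert space. -/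

section Riesz

variable {H : Type*} [NormedAddCommGroup H] [InnerProductSpace ℂ H] [CompleteSpace H]
  {A : H →L[ℂ] H}

/-- Along a strictly increasing chain of closed subspaces, a compact operator cannot act modulo the
preceding subspace as scalars bounded away from `0`. -/
theorem _root_.IsCompactOperator.not_strictMono_chain (hA : IsCompactOperator A) (V : ℕ → Submodule ℂ H)
    (hV : ∀ n, IsClosed (V n : Set H)) (hlt : ∀ n, V n < V (n + 1)) (c : ℕ → ℂ) {ε : ℝ}
    (hε : 0 < ε) (hc : ∀ n, ε ≤ ‖c n‖) (h : ∀ n, ∀ x ∈ V (n + 1), A x - c n • x ∈ V n) : False := by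
  have hmono : Monotone V := monotone_nat_of_le_succ fun n => (hlt n).le
  -- In a Hilbert space Riesz's lemma is exact: the new direction can be taken orthogonal to the old
  -- space.
  have hy : ∀ n, ∃ y ∈ V (n + 1), y ∈ (V n)ᗮ ∧ ‖y‖ = 1 := fun n => by
    have : CompleteSpace (V n) := (hV n).completeSpace_coe
    obtain ⟨x, hx, hxn⟩ := SetLike.exists_of_lt (hlt n)
    set y := x - (V n).starProjection x
    have hy1 : y ∈ V (n + 1) :=
      sub_mem hx ((hlt n).le (Submodule.starProjection_apply_mem _ _))
    have hy2 : y ∈ (V n)ᗮ := Submodule.sub_starProjection_mem_orthogonal x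
    have hy0 : y ≠ 0 := fun h0 => hxn (by
      rw [sub_eq_zero.1 h0]; exact Submodule.starProjection_apply_mem _ _)
    refine ⟨(‖y‖⁻¹ : ℂ) • y, Submodule.smul_mem _ _ hy1, Submodule.smul_mem _ _ hy2, ?_⟩
    simpa using norm_smul_inv_norm (𝕜 := ℂ) hy0
  choose y hy1 hy2 hy3 using hy
  have hsep : ∀ m n, m < n → ε ≤ ‖A (y n) - A (y m)‖ := fun m n hmn => by
    have hAm : A (y m) ∈ V n := by
      have h1 := h m _ (hy1 m)
      have h2 : A (y m) ∈ V (m + 1) := by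
        have := add_mem ((hlt m).le h1) (Submodule.smul_mem _ (c m) (hy1 m))
        rwa [sub_add_cancel] at this
      exact hmono hmn h2
    -- Pairing with `y n` discards everything in `V n` and leaves the scalar; so the images are
    -- ε-separated and have no convergent subsequence.
    have h3 : inner ℂ (y n) (A (y n) - A (y m)) = c n := by
      have e : A (y n) - A (y m) = c n • y n + ((A (y n) - c n • y n) - A (y m)) := by abel
      rw [e, inner_add_right, Submodule.inner_left_of_mem_orthogonal
        (sub_mem (h n _ (hy1 n)) hAm) (hy2 n), inner_smul_right, inner_self_eq_norm_sq_to_K, hy3]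
      simp
    calc ε ≤ ‖c n‖ := hc n
      _ ≤ ‖y n‖ * ‖A (y n) - A (y m)‖ := by rw [← h3]; exact norm_inner_le_norm _ _
      _ = _ := by rw [hy3, one_mul]
  obtain ⟨K, hK, hK'⟩ := hA.image_closedBall_subset_compact 1
  obtain ⟨w, -, ψ, hψ, hw⟩ := hK.tendsto_subseq fun n => hK' ⟨y n, by simp [hy3], rfl⟩
  obtain ⟨N, hN⟩ := Metric.cauchySeq_iff'.1 hw.cauchySeq ε hε
  have h1 := hN (N + 1) (Nat.le_succ N)
  rw [dist_eq_norm] at h1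
  exact absurd (hsep _ _ (hψ (Nat.lt_succ_self N))) (not_le.2 h1)

theorem _root_.IsCompactOperator.hasEigenvalue_of_mem_spectrum (hA : IsCompactOperator A) {b : ℂ}
    (hb : b ≠ 0) (h : b ∈ spectrum ℂ A) : Module.End.HasEigenvalue (A : H →ₗ[ℂ] H) b :=
  (IsCompactOperator.hasEigenvalue_iff_mem_spectrum hA hb).2 h

/-- The spectrum of a compact operator is finite away from `0`. -/
theorem _root_.IsCompactOperator.finite_spectrum (hA : IsCompactOperator A) {ε : ℝ} (hε : 0 < ε) :
    {b ∈ spectrum ℂ A | ε ≤ ‖b‖}.Finite := by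
  by_contra hinf
  let c := Set.Infinite.natEmbedding _ hinf
  have hev : ∀ n, Module.End.HasEigenvalue (A : H →ₗ[ℂ] H) (c n : ℂ) := fun n =>
    hA.hasEigenvalue_of_mem_spectrum
      (fun h0 => by have := (c n).2.2; rw [h0, norm_zero] at this; linarith) (c n).2.1
  choose x hx using fun n => (hev n).exists_hasEigenvector
  have hinj : Function.Injective fun n => (c n : ℂ) :=
    Subtype.val_injective.comp c.injective
  have hli : LinearIndependent ℂ x :=
    Module.End.eigenvectors_linearIndependent' _ _ hinj x hx
  -- Infinitely many eigenvalues of modulus at least ε would give a forbidden chain: the spans of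
  -- the first n eigenvectors.
  let V : ℕ → Submodule ℂ H := fun n => Submodule.span ℂ (x '' Iio n)
  have hVmono : Monotone V := fun m n hmn =>
    Submodule.span_mono (image_mono (Iio_subset_Iio hmn))
  have hmem : ∀ i n, i < n → x i ∈ V n := fun i n hi => Submodule.subset_span ⟨i, hi, rfl⟩
  refine hA.not_strictMono_chain V (fun n => ?_) (fun n => ?_) (fun n => c n) hε
    (fun n => (c n).2.2) fun n => ?_
  · have : FiniteDimensional ℂ (V n) :=
      FiniteDimensional.span_of_finite ℂ ((Set.finite_Iio n).image x)
    exact (V n).closed_of_finiteDimensional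
  · refine lt_of_le_of_ne (hVmono n.le_succ) fun he => ?_
    have h1 : x n ∈ V n := by rw [he]; exact hmem n _ n.lt_succ_self
    exact hli.notMem_span_image (s := Iio n) (x := n) (by simp) h1
  · intro y hy
    have : V (n + 1) ≤ (V n).comap ((A : H →ₗ[ℂ] H) - (c n : ℂ) • 1) := by
      refine Submodule.span_le.2 ?_
      rintro _ ⟨i, hi, rfl⟩
      have hAi : A (x i) = (c i : ℂ) • x i := (hx i).apply_eq_smul
      change A (x i) - (c n : ℂ) • x i ∈ V n
      rw [hAi, ← sub_smul]
      rcases Nat.lt_succ_iff_lt_or_eq.1 hi with h | rfl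
      · exact Submodule.smul_mem _ _ (hmem i n h)
      · rw [sub_self, zero_smul]; exact zero_mem _
    exact this hy

omit [CompleteSpace H] in
-- Compact operators form an ideal, so the powers of A - b are again compact perturbations of
-- scalars and the Fredholm alternative applies to them.
theorem _root_.IsCompactOperator.exists_pow_eq (hA : IsCompactOperator A) (b : ℂ) (n : ℕ) :
    ∃ K : H →L[ℂ] H, IsCompactOperator K ∧ (A - b • 1) ^ n = (-b) ^ n • 1 + K := by
  induction n with
  | zero => exact ⟨0, isCompactOperator_zero, by simp⟩
  | succ n ih =>
    obtain ⟨K, hK, h⟩ := ih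
    refine ⟨(-b) ^ n • A + A * K - b • K, ((hA.smul _).add (hK.clm_comp A)).sub (hK.smul b), ?_⟩
    rw [pow_succ', h, pow_succ', sub_mul, mul_add, mul_smul_comm, mul_one, smul_mul_assoc, one_mul,
      smul_add, smul_smul, neg_mul, neg_smul]
    abel

omit [CompleteSpace H] in
theorem coe_sub_smul_pow_apply (A : H →L[ℂ] H) (b : ℂ) (n : ℕ) (x : H) :
    (((A : H →ₗ[ℂ] H) - b • 1) ^ n) x = ((A - b • 1 : H →L[ℂ] H) ^ n) x := by
  induction n generalizing x with
  | zero => rfl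
  | succ n ih =>
    rw [pow_succ, pow_succ]
    exact ih _

/-- On each quotient ker (A - b)ⁿ⁺¹ / ker (A - b)ⁿ the operator A acts as the scalar b ≠ 0, so these
kernels cannot increase strictly forever; once two agree, all later ones do. -/
theorem _root_.IsCompactOperator.exists_ker_pow_eq (hA : IsCompactOperator A) {b : ℂ} (hb : b ≠ 0) :
    ∃ n : ℕ, Module.End.maxGenEigenspace (A : H →ₗ[ℂ] H) b =
      LinearMap.ker (((A - b • 1) ^ n : H →L[ℂ] H) : H →ₗ[ℂ] H) := by
  let T : H →L[ℂ] H := A - b • 1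
  have hmul : ∀ (S S' : H →L[ℂ] H) x, (S * S') x = S (S' x) := fun _ _ _ => rfl
  have hker : ∀ n x, x ∈ LinearMap.ker ((T ^ n : H →L[ℂ] H) : H →ₗ[ℂ] H) ↔ (T ^ n) x = 0 :=
    fun n x => Iff.rfl
  have hcoe := coe_sub_smul_pow_apply A b
  have hsucc : ∀ n x, (T ^ n) x = 0 → (T ^ (n + 1)) x = 0 := fun n x hx => by
    rw [pow_succ', hmul, hx, map_zero]
  have hstable : ∃ n, ∀ x, (T ^ (n + 1)) x = 0 → (T ^ n) x = 0 := by
    by_contra! hcon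
    refine hA.not_strictMono_chain (fun n => LinearMap.ker ((T ^ n : H →L[ℂ] H) : H →ₗ[ℂ] H))
      (fun n => (T ^ n).isClosed_ker) (fun n => ?_) (fun _ => b) (norm_pos_iff.2 hb)
      (fun _ => le_rfl) fun n x hx => ?_
    · refine lt_of_le_of_ne (fun x hx => hsucc n x hx) fun he => ?_
      obtain ⟨x, hx1, hx2⟩ := hcon n
      exact hx2 ((hker n x).1 (by rw [he]; exact hx1))
    · have : (T ^ (n + 1)) x = 0 := hx
      rwa [pow_succ] at this
  obtain ⟨n, hn⟩ := hstable
  refine ⟨n, le_antisymm (fun x hx => ?_) fun x hx => ?_⟩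
  · obtain ⟨k, hk⟩ := (Module.End.mem_maxGenEigenspace _ _ _).1 hx
    rw [hcoe] at hk
    have hdown : ∀ j x, (T ^ (n + j)) x = 0 → (T ^ n) x = 0 := fun j => by
      induction j with
      | zero => exact fun x h => h
      | succ j ih =>
        intro x h
        refine ih x ?_
        rw [pow_add, hmul]
        refine hn _ ?_
        rwa [← hmul, ← pow_add, add_right_comm]
    refine hdown k x ?_
    rw [pow_add, hmul, hk, map_zero]
  · exact (Module.End.mem_maxGenEigenspace _ _ _).2 ⟨n, by rw [hcoe]; exact hx⟩

/-- Compressed to N, with the adjoint of the inclusion as projection, K becomes c times the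
identity, so the identity of N is compact. -/
theorem finiteDimensional_of_forall_eq_smul {K : H →L[ℂ] H} (hK : IsCompactOperator K)
    {N : Submodule ℂ H} (hN : IsClosed (N : Set H)) {c : ℂ} (hc : c ≠ 0)
    (h : ∀ x ∈ N, K x = c • x) : FiniteDimensional ℂ N := by
  have : CompleteSpace N := hN.completeSpace_coe
  have h1 : IsCompactOperator ((N.subtypeL.adjoint ∘L K) ∘L N.subtypeL) :=
    (hK.clm_comp N.subtypeL.adjoint).comp_clm N.subtypeL
  have h3 : (c⁻¹ • ((N.subtypeL.adjoint ∘L K) ∘L N.subtypeL : N →L[ℂ] N) : N → N) = id := by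
    funext x
    change c⁻¹ • N.subtypeL.adjoint (K x) = x
    have h4 : K x = N.subtypeL (c • x) := by rw [h x x.2]; simp
    rw [h4, Submodule.adjoint_subtypeL]
    simp [hc]
  exact FiniteDimensional.of_isCompactOperator_id (𝕜 := ℂ) (h3 ▸ h1.smul _)

/-- For a finite-dimensional `N = ker T` with `N ∩ range T = 0`, where `T` is a compact
perturbation of a nonzero scalar, `T` plus the orthogonal projection onto `N` is invertible. -/
theorem isUnit_add_starProjection {T K : H →L[ℂ] H} (hK : IsCompactOperator K) {c : ℂ}
    (hc : c ≠ 0) (hT : T = c • 1 + K) (N : Submodule ℂ H) [FiniteDimensional ℂ N]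
    (hmem : ∀ x, x ∈ N ↔ T x = 0) (hTT : ∀ x, T (T x) = 0 → T x = 0) :
    IsUnit (T + N.starProjection) := by
  set P : H →L[ℂ] H := N.starProjection with hP
  have hPN : ∀ x ∈ N, P x = x := fun x hx => Submodule.starProjection_eq_self_iff.2 hx
  have hPm : ∀ x, P x ∈ N := fun x => Submodule.starProjection_apply_mem _ _
  have hPc : IsCompactOperator P :=
    (isCompactOperator_of_locallyCompactSpace_dom N.orthogonalProjectionOnto).clm_comp N.subtypeL
  -- By the Fredholm alternative injectivity of T + P suffices: if T x = -P x then T x ∈ N, so T (T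
  -- x) = 0, hence T x = 0, x ∈ N and x = P x = 0.
  have h1 : (-c) ∈ resolventSet ℂ (K + P) := by
    refine (hK.add hPc).hasEigenvalue_or_mem_resolventSet (T := K + P)
      (neg_ne_zero.2 hc) |>.resolve_left fun h => ?_
    obtain ⟨x, hx⟩ := h.exists_hasEigenvector
    have h2 : K x + P x = (-c) • x := hx.apply_eq_smul
    have h3 : T x + P x = 0 := by
      rw [hT]
      change (c • x + K x) + P x = 0
      rw [add_assoc, h2, neg_smul, add_neg_cancel]
    have h4 : T x = -P x := eq_neg_of_add_eq_zero_left h3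
    have h5 : T x = 0 := hTT x (by rw [h4, ← hmem]; exact neg_mem (hPm x))
    have h6 : x = 0 := by rw [← hPN x ((hmem x).2 h5), ← neg_eq_zero, ← h4, h5]
    exact hx.2 h6
  rw [spectrum.mem_resolventSet_iff] at h1
  have : T + P = -(algebraMap ℂ (H →L[ℂ] H) (-c) - (K + P)) := by
    rw [hT, Algebra.algebraMap_eq_smul_one, neg_smul]; abel
  rw [this]
  exact h1.neg

/-- The projection onto `N = ker T` along `range T`. -/
theorem exists_projection_ker {T K A : H →L[ℂ] H} (hK : IsCompactOperator K) {c : ℂ}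
    (hc : c ≠ 0) (hT : T = c • 1 + K) (N : Submodule ℂ H) [FiniteDimensional ℂ N]
    (hmem : ∀ x, x ∈ N ↔ T x = 0) (hTT : ∀ x, T (T x) = 0 → T x = 0) (hTA : Commute T A) :
    ∃ Q : H →L[ℂ] H, Commute A Q ∧ T * Q = 0 ∧ (∀ x, Q x ∈ N) ∧ ∀ x ∈ N, Q x = x := by
  have hmul : ∀ (S S' : H →L[ℂ] H) x, (S * S') x = S (S' x) := fun _ _ _ => rfl
  have hNA : ∀ x ∈ N, A x ∈ N := fun x hx => by
    rw [hmem, ← hmul, hTA.eq, hmul, (hmem x).1 hx, map_zero]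
  have hSu := isUnit_add_starProjection hK hc hT N hmem hTT
  have hPN : ∀ x ∈ N, N.starProjection x = x := fun x hx =>
    Submodule.starProjection_eq_self_iff.2 hx
  have hPm : ∀ x, N.starProjection x ∈ N := fun x => Submodule.starProjection_apply_mem _ _
  generalize N.starProjection = P at *
  obtain ⟨S, hS⟩ := hSu
  have hS1 : ∀ x, (↑S⁻¹ : H →L[ℂ] H) (T x + P x) = x := fun x => by
    have : (↑S⁻¹ * (T + P) : H →L[ℂ] H) x = x := by rw [← hS, S.inv_mul]; rfl
    exact this
  have hS2 : ∀ y, T ((↑S⁻¹ : H →L[ℂ] H) y) + P ((↑S⁻¹ : H →L[ℂ] H) y) = y := fun y => by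
    have : ((T + P) * ↑S⁻¹ : H →L[ℂ] H) y = y := by rw [← hS, S.mul_inv]; rfl
    exact this
  have hQN : ∀ x ∈ N, (P * ↑S⁻¹ : H →L[ℂ] H) x = x := fun x hx => by
    have : (↑S⁻¹ : H →L[ℂ] H) x = x := by
      conv_lhs => rw [← hPN x hx, ← zero_add (P x), ← (hmem x).1 hx]
      exact hS1 x
    rw [hmul, this, hPN x hx]
  have hQT : ∀ x, (P * ↑S⁻¹ : H →L[ℂ] H) (T x) = 0 := fun x => by
    have h1 : P (x - P x) = 0 := by rw [map_sub, hPN _ (hPm x), sub_self]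
    have h2 : T x = T (x - P x) + P (x - P x) := by
      rw [h1, map_sub, (hmem _).1 (hPm x), sub_zero, add_zero]
    rw [hmul, h2, hS1, h1]
  have hQm : ∀ x, (P * ↑S⁻¹ : H →L[ℂ] H) x ∈ N := fun x => hPm _
  -- Here S = T + P. As S fixes N pointwise and T x = S (x - P x), the operator P S⁻¹ is the
  -- identity on N and kills the range of T.
  refine ⟨P * ↑S⁻¹, ?_, ?_, hQm, hQN⟩
  · ext y
    obtain ⟨w, hw⟩ : ∃ w, y = (P * ↑S⁻¹ : H →L[ℂ] H) y + T w :=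
      ⟨(↑S⁻¹ : H →L[ℂ] H) y, by rw [hmul, add_comm, hS2]⟩
    change A ((P * ↑S⁻¹ : H →L[ℂ] H) y) = (P * ↑S⁻¹ : H →L[ℂ] H) (A y)
    generalize (P * ↑S⁻¹ : H →L[ℂ] H) = Q at *
    have hTAw : A (T w) = T (A w) := DFunLike.congr_fun hTA.eq.symm w
    have h1 : A y = A (Q y) + T (A w) := by
      conv_lhs => rw [hw]
      rw [map_add, hTAw]
    rw [h1, map_add, hQT, add_zero, hQN _ (hNA _ (hQm y))]
  · ext y
    exact (hmem _).1 (hQm y)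

/-- The Riesz projection onto the generalized eigenspace of a compact operator. -/
theorem _root_.IsCompactOperator.exists_rieszProjection (hA : IsCompactOperator A) {b : ℂ}
    (hb : b ≠ 0) :
    FiniteDimensional ℂ (Module.End.maxGenEigenspace (A : H →ₗ[ℂ] H) b) ∧
    ∃ (Q : H →L[ℂ] H) (n : ℕ), Commute A Q ∧ (A - b • 1) ^ n * Q = 0 ∧
      (∀ x, Q x ∈ Module.End.maxGenEigenspace (A : H →ₗ[ℂ] H) b) ∧
      ∀ x ∈ Module.End.maxGenEigenspace (A : H →ₗ[ℂ] H) b, Q x = x := by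
  obtain ⟨n, hn⟩ := hA.exists_ker_pow_eq hb
  obtain ⟨K, hK, hpow⟩ := hA.exists_pow_eq b n
  have hTA : Commute ((A - b • 1) ^ n) A :=
    ((Commute.refl A).sub_left ((Commute.one_left A).smul_left b)).pow_left n
  have hc : (-b) ^ n ≠ 0 := pow_ne_zero _ (neg_ne_zero.2 hb)
  have hmem : ∀ x, x ∈ Module.End.maxGenEigenspace (A : H →ₗ[ℂ] H) b ↔
      ((A - b • 1) ^ n) x = 0 := fun x => by rw [hn]; rfl
  -- The kernel of the n-th power is already the whole generalized eigenspace, so doubling the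
  -- exponent adds nothing.
  have hTT : ∀ x, ((A - b • 1) ^ n) (((A - b • 1) ^ n) x) = 0 → ((A - b • 1) ^ n) x = 0 :=
    fun x hx => by
      rw [← hmem]
      refine (Module.End.mem_maxGenEigenspace _ _ _).2 ⟨n + n, ?_⟩
      rw [coe_sub_smul_pow_apply, pow_add]
      exact hx
  generalize hN : Module.End.maxGenEigenspace (A : H →ₗ[ℂ] H) b = N at *
  have hNcl : IsClosed (N : Set H) := by
    have : (N : Set H) = {x | ((A - b • 1) ^ n) x = 0} := by ext x; exact hmem x
    rw [this]
    exact isClosed_eq (ContinuousLinearMap.continuous _) continuous_const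
  have hfin : FiniteDimensional ℂ N :=
    finiteDimensional_of_forall_eq_smul hK hNcl (neg_ne_zero.2 hc) fun x hx => by
      have := (hmem x).1 hx
      rw [hpow] at this
      rw [neg_smul]
      exact eq_neg_of_add_eq_zero_right this
  obtain ⟨Q, h1, h2, h3, h4⟩ := exists_projection_ker hK hc hpow N hmem hTT hTA
  exact ⟨hfin, Q, n, h1, h2, h3, h4⟩

end Riesz

end

end PhotonicCrystal

namespace PhotonicCrystal
noncomputable section
open MeasureTheory Set Filter Topology
open scoped ContDiff

/-! ### The Riesz integral as a sum of projections. -/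

section RieszIntegral

section Algebra

variable {B : Type*} [NormedRing B] [NormedAlgebra ℂ B]

/-- Multiplied by Q, a - b becomes nilpotent, so the geometric series for the resolvent about b
terminates. The range has n + 1 terms so that the term j = 0 is present even for n = 0. -/
theorem mul_resolvent_eq_sum {a Q : B} {b ζ : ℂ} {n : ℕ} (hQ : Commute a Q)
    (hn : (a - b • 1) ^ n * Q = 0) (hζ : ζ ∈ resolventSet ℂ a) (hb : ζ ≠ b) :
    Q * resolvent a ζ =
      ∑ j ∈ Finset.range (n + 1), (ζ - b) ^ (-(j + 1 : ℤ)) • ((a - b • 1) ^ j * Q) := by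
  have hc : ζ - b ≠ 0 := sub_ne_zero.2 hb
  have hN : Commute (a - b • 1) Q := hQ.sub_left ((Commute.one_left Q).smul_left b)
  have hza : algebraMap ℂ B ζ - a = (ζ - b) • 1 - (a - b • 1) := by
    rw [Algebra.algebraMap_eq_smul_one, sub_smul]; abel
  have hu : (algebraMap ℂ B ζ - a) * resolvent a ζ = 1 := Ring.mul_inverse_cancel _ hζ
  have key : (∑ j ∈ Finset.range (n + 1), (ζ - b) ^ (-(j + 1 : ℤ)) • ((a - b • 1) ^ j * Q)) *
      (algebraMap ℂ B ζ - a) = Q := by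
    have h1 : ∀ j ∈ Finset.range (n + 1),
        ((ζ - b) ^ (-(j + 1 : ℤ)) • ((a - b • 1) ^ j * Q)) * (algebraMap ℂ B ζ - a) =
          (ζ - b) ^ (-(j : ℤ)) • ((a - b • 1) ^ j * Q) -
            (ζ - b) ^ (-((j + 1 : ℕ) : ℤ)) • ((a - b • 1) ^ (j + 1) * Q) := fun j _ => by
      rw [hza, mul_sub, mul_smul_comm, mul_one, smul_smul, ← zpow_one_add₀ hc, smul_mul_assoc,
        mul_assoc, ← hN.eq, ← mul_assoc, ← pow_succ]
      push_cast
      congr 3; ring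
    rw [Finset.sum_mul, Finset.sum_congr rfl h1,
      Finset.sum_range_sub' fun j : ℕ => (ζ - b) ^ (-(j : ℤ)) • ((a - b • 1) ^ j * Q)]
    rw [pow_succ', mul_assoc, hn, mul_zero, smul_zero, sub_zero]
    simp
  calc Q * resolvent a ζ = (∑ j ∈ Finset.range (n + 1),
        (ζ - b) ^ (-(j + 1 : ℤ)) • ((a - b • 1) ^ j * Q)) *
      (algebraMap ℂ B ζ - a) * resolvent a ζ := by rw [key]
    _ = _ := by rw [mul_assoc, hu, mul_one]

/-- Only the simple pole of the terminating expansion survives integration; the higher poles have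
primitives. -/
theorem IsContour.contourIntegral_mul_resolvent [CompleteSpace B] {γ : ℝ → ℂ} (hγ : IsContour γ)
    {a Q : B} {b : ℂ} {n : ℕ} (hQ : Commute a Q) (hn : (a - b • 1) ^ n * Q = 0)
    (hres : γ '' Icc 0 1 ⊆ resolventSet ℂ a) (hb : b ∉ γ '' Icc 0 1) :
    contourIntegral γ (fun t => Q * resolvent a (γ t)) = windingNumber γ b • Q := by
  have hne : ∀ t ∈ Icc (0 : ℝ) 1, γ t ≠ b := fun t ht h => hb ⟨t, ht, h⟩
  rw [contourIntegral_congr fun t ht => mul_resolvent_eq_sum hQ hn (hres ⟨t, ht, rfl⟩) (hne t ht),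
    hγ.contourIntegral_sum _ fun j _ => ?_]
  · rw [Finset.sum_range_succ', Finset.sum_eq_zero fun j _ => ?_, zero_add,
      contourIntegral_smul_const, windingNumber_eq_contourIntegral]
    · simp
    · rw [contourIntegral_smul_const, hγ.contourIntegral_zpow hb (by push_cast; omega), zero_smul]
  · exact ((hγ.continuousOn.sub continuousOn_const).zpow₀ _ fun t ht =>
      Or.inl (sub_ne_zero.2 (hne t ht))).smul continuousOn_const

end Algebra

variable {H : Type*} [NormedAddCommGroup H] [InnerProductSpace ℂ H] [CompleteSpace H]
  {A : H →L[ℂ] H} {γ : ℝ → ℂ}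

/-- The Riesz projection of a compact operator for a contour with winding number `0` about `0` is
the sum of the projections onto the enclosed generalized eigenspaces. -/
theorem IsContour.rieszProjection [Nontrivial H] (hγ : IsContour γ) (hA : IsCompactOperator A)
    (hres : γ '' Icc 0 1 ⊆ resolventSet ℂ A) (h0 : (0 : ℂ) ∉ γ '' Icc 0 1)
    (hw0 : windingNumber γ 0 = 0) :
    ∃ s : Finset ℂ, (∀ b, b ∈ s ↔ b ∈ spectrum ℂ A ∧ windingNumber γ b = 1) ∧ (0 : ℂ) ∉ s ∧
      (∀ b ∈ s, FiniteDimensional ℂ (Module.End.maxGenEigenspace (A : H →ₗ[ℂ] H) b)) ∧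
      IsIdempotentElem (contourIntegral γ fun t => resolvent A (γ t)) ∧
      Commute A (contourIntegral γ fun t => resolvent A (γ t)) ∧
      LinearMap.range ((contourIntegral γ fun t => resolvent A (γ t) : H →L[ℂ] H) : H →ₗ[ℂ] H) =
        ⨆ b ∈ s, Module.End.maxGenEigenspace (A : H →ₗ[ℂ] H) b := by
  classical
  have hmul : ∀ (S S' : H →L[ℂ] H) x, (S * S') x = S (S' x) := fun _ _ _ => rfl
  obtain ⟨δ, hδ0, hδ⟩ : ∃ δ : ℝ, 0 < δ ∧ ∀ t ∈ Icc (0 : ℝ) 1, δ ≤ ‖γ t‖ := by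
    obtain ⟨t0, ht0, hmin⟩ := (isCompact_Icc (a := (0 : ℝ)) (b := 1)).exists_isMinOn
      ⟨0, by simp⟩ hγ.continuousOn.norm
    exact ⟨‖γ t0‖, norm_pos_iff.2 fun h => h0 ⟨t0, ht0, h⟩, fun t ht => hmin ht⟩
  have hspec : ∀ b ∈ spectrum ℂ A, b ∉ γ '' Icc 0 1 := fun b hb hb' => hb (hres hb')
  choose! hfd Q n hcomm hpow hrange hid using
    fun (b : ℂ) (hb : b ≠ 0) => hA.exists_rieszProjection hb
  -- Only the finitely many spectral points of modulus at least δ are treated one by one; those near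
  -- 0, possibly infinitely many, form a single block.
  let s0 : Finset ℂ := (hA.finite_spectrum hδ0).toFinset
  have hs0 : ∀ b, b ∈ s0 ↔ b ∈ spectrum ℂ A ∧ δ ≤ ‖b‖ := fun b => by
    simp [s0]
  have hs0ne : ∀ b ∈ s0, b ≠ 0 := fun b hb h => by
    have := ((hs0 b).1 hb).2
    rw [h, norm_zero] at this
    linarith
  -- `Q b` commutes with A and so preserves the generalized eigenspace for c, which meets that for b
  -- only in 0.
  have hQQ : ∀ b ≠ 0, ∀ c ≠ 0, b ≠ c → Q b * Q c = 0 := fun b hb c hc hbc => by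
    ext x
    have h1 : Q b (Q c x) ∈ Module.End.maxGenEigenspace (A : H →ₗ[ℂ] H) c := by
      refine Module.End.mapsTo_maxGenEigenspace_of_comm (f := (A : H →ₗ[ℂ] H))
        (g := (Q b : H →ₗ[ℂ] H)) ?_ c (hrange c hc x)
      exact LinearMap.ext fun y => DFunLike.congr_fun (hcomm b hb).eq y
    have h2 := (Module.End.independent_maxGenEigenspace (A : H →ₗ[ℂ] H)).pairwiseDisjoint hbc
    exact Submodule.disjoint_def.1 h2 _ (hrange b hb _) h1
  have hQid : ∀ b ≠ 0, Q b * Q b = Q b := fun b hb => by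
    ext x
    exact hid b hb _ (hrange b hb x)
  have hQsum : ∀ s : Finset ℂ, (∀ b ∈ s, b ≠ 0) → ∀ b ≠ 0,
      (∑ c ∈ s, Q c) * Q b = if b ∈ s then Q b else 0 := fun s hs b hb => by
    rw [Finset.sum_mul]
    split_ifs with h
    · rw [Finset.sum_eq_single b (fun c hc hcb => hQQ c (hs c hc) b hb hcb)
        (fun hn => absurd h hn), hQid b hb]
    · exact Finset.sum_eq_zero fun c hc => hQQ c (hs c hc) b hb fun e => h (e ▸ hc)
  have hidem : ∀ s : Finset ℂ, (∀ b ∈ s, b ≠ 0) → (∑ c ∈ s, Q c) * (∑ c ∈ s, Q c) =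
      ∑ c ∈ s, Q c := fun s hs => by
    conv_lhs => rw [Finset.mul_sum]
    exact Finset.sum_congr rfl fun b hb => by rw [hQsum s hs b (hs b hb), if_pos hb]
  have hcommsum : ∀ s : Finset ℂ, (∀ b ∈ s, b ≠ 0) → Commute A (∑ c ∈ s, Q c) := fun s hs =>
    Commute.sum_right _ _ _ fun b hb => hcomm b (hs b hb)
  set E := ∑ c ∈ s0, Q c with hE
  have hEE : E * E = E := hidem s0 hs0ne
  have hAE : Commute A E := hcommsum s0 hs0ne
  set A' := A * (1 - E) with hA'
  have hA'c : IsCompactOperator A' := hA.comp_clm (1 - E)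
  -- An eigenvector of A' for b ≠ 0 is killed by E, hence is an eigenvector of A for b; if ‖b‖ ≥ δ
  -- then E also fixes it, so it is 0.
  have hA'spec : ∀ b ∈ spectrum ℂ A', ‖b‖ < δ := fun b hb => by
    by_contra! hbδ
    have hb0 : b ≠ 0 := fun h => by rw [h, norm_zero] at hbδ; linarith
    obtain ⟨x, hx⟩ := (hA'c.hasEigenvalue_of_mem_spectrum hb0 hb).exists_hasEigenvector
    have h1 : A' x = b • x := hx.apply_eq_smul
    have h2 : E * A' = 0 := by
      rw [hA', ← mul_assoc, ← hAE.eq, mul_assoc, mul_sub, mul_one, hEE, sub_self, mul_zero]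
    have h3 : E x = 0 := by
      have : b • E x = 0 := by
        rw [← map_smul, ← h1, ← hmul, h2]; rfl
      exact (smul_eq_zero.1 this).resolve_left hb0
    have h4 : A x = b • x := by
      rw [← h1, hA', hmul]
      congr 1
      change x = x - E x
      rw [h3, sub_zero]
    have hev : Module.End.HasEigenvalue (A : H →ₗ[ℂ] H) b :=
      Module.End.hasEigenvalue_of_hasEigenvector
        (x := x) ⟨Module.End.mem_eigenspace_iff.2 h4, hx.2⟩
    have hbs : b ∈ s0 := (hs0 b).2 ⟨(hA.hasEigenvalue_iff_mem_spectrum hb0).1 hev, hbδ⟩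
    have h5 : Q b x = x := hid b hb0 x
      (Module.End.eigenspace_le_maxGenEigenspace (Module.End.mem_eigenspace_iff.2 h4))
    have h6 : E x = x := by
      have := DFunLike.congr_fun (hQsum s0 hs0ne b hb0) x
      rw [if_pos hbs, hmul, h5] at this
      exact this
    exact hx.2 (by rw [← h6, h3])
  have hres' : γ '' Icc 0 1 ⊆ resolventSet ℂ A' := by
    rintro _ ⟨t, ht, rfl⟩
    by_contra h
    exact absurd (hδ t ht) (not_le.2 (hA'spec _ h))
  have hsplit : ∀ t ∈ Icc (0 : ℝ) 1, resolvent A (γ t) =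
      ∑ b ∈ s0, Q b * resolvent A (γ t) + resolvent A' (γ t) * (1 - E) := fun t ht => by
    have hu : (algebraMap ℂ (H →L[ℂ] H) (γ t) - A) * resolvent A (γ t) = 1 :=
      Ring.mul_inverse_cancel _ (hres ⟨t, ht, rfl⟩)
    have hu' : resolvent A' (γ t) * (algebraMap ℂ (H →L[ℂ] H) (γ t) - A') = 1 :=
      Ring.inverse_mul_cancel _ (hres' ⟨t, ht, rfl⟩)
    have h1 : (algebraMap ℂ (H →L[ℂ] H) (γ t) - A') * (1 - E) =
        (1 - E) * (algebraMap ℂ (H →L[ℂ] H) (γ t) - A) := by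
      have hE1 : (1 - E) * (1 - E) = 1 - E := by
        rw [mul_sub, mul_one, sub_mul, one_mul, hEE, sub_self, sub_zero]
      rw [sub_mul, hA', mul_assoc, hE1, mul_sub (1 - E), ← Algebra.commutes (γ t) (1 - E),
        ((Commute.one_right A).sub_right hAE).eq]
    have h2 : resolvent A' (γ t) * (1 - E) = (1 - E) * resolvent A (γ t) := by
      calc resolvent A' (γ t) * (1 - E) = resolvent A' (γ t) * ((1 - E) *
            (algebraMap ℂ (H →L[ℂ] H) (γ t) - A)) * resolvent A (γ t) := by
              rw [mul_assoc, mul_assoc (1 - E), hu, mul_one]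
        _ = _ := by rw [← h1, ← mul_assoc, hu', one_mul]
    rw [h2, ← Finset.sum_mul, ← hE, sub_mul, one_mul, add_sub_cancel]
  have hsmall : ∀ b, ‖b‖ < δ → windingNumber γ b = 0 := fun b hb => by
    rw [hγ.windingNumber_eq_of_norm_lt hδ hb, hw0]
  let s : Finset ℂ := s0.filter fun b => windingNumber γ b = 1
  have hs : ∀ b, b ∈ s ↔ b ∈ spectrum ℂ A ∧ windingNumber γ b = 1 := fun b => by
    rw [Finset.mem_filter, hs0]
    refine ⟨fun h => ⟨h.1.1, h.2⟩, fun h => ⟨⟨h.1, ?_⟩, h.2⟩⟩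
    by_contra! hlt
    rw [hsmall b hlt] at h
    exact zero_ne_one h.2
  have hsne : ∀ b ∈ s, b ≠ 0 := fun b hb => hs0ne b (Finset.mem_filter.1 hb).1
  have hint : (contourIntegral γ fun t => resolvent A (γ t)) = ∑ b ∈ s, Q b := by
    have hcR := continuousOn_resolvent_comp hγ.continuousOn hres
    have hcR' := continuousOn_resolvent_comp hγ.continuousOn hres'
    have hcQ : ∀ b ∈ s0, ContinuousOn (fun t => Q b * resolvent A (γ t)) (Icc 0 1) := fun b _ =>
      continuousOn_const.mul hcR
    have hcE : ContinuousOn (fun t => resolvent A' (γ t) * (1 - E)) (Icc 0 1) :=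
      hcR'.mul continuousOn_const
    rw [contourIntegral_congr hsplit, hγ.contourIntegral_add
      (continuousOn_finsetSum _ hcQ) hcE, hγ.contourIntegral_sum _ hcQ]
    -- The block near 0 contributes the winding number about 0 times 1 - E, which vanishes.
    have h1 := hγ.contourIntegral_comp
      ((ContinuousLinearMap.mul ℂ (H →L[ℂ] H)).flip (1 - E)) hcR'
    simp only [ContinuousLinearMap.flip_apply, ContinuousLinearMap.mul_apply'] at h1
    rw [h1, hγ.contourIntegral_resolvent_eq hδ hA'spec, hw0, zero_smul, zero_mul, add_zero,
      Finset.sum_filter]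
    refine Finset.sum_congr rfl fun b hb => ?_
    have hbs := ((hs0 b).1 hb).1
    have hb0 := hs0ne b hb
    rw [hγ.contourIntegral_mul_resolvent (hcomm b hb0) (hpow b hb0) hres (hspec b hbs)]
    rcases hγ.simple b (hspec b hbs) with h | h
    · rw [h, zero_smul, if_neg zero_ne_one]
    · rw [h, one_smul, if_pos rfl]
  rw [hint]
  refine ⟨s, hs, fun h => hsne 0 h rfl, fun b hb => hfd b (hsne b hb), hidem s hsne,
    hcommsum s hsne, le_antisymm ?_ ?_⟩
  · rintro _ ⟨x, rfl⟩
    have : (∑ c ∈ s, Q c) x = ∑ c ∈ s, Q c x := by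
      rw [sum_apply]
    change (∑ c ∈ s, Q c) x ∈ _
    rw [this]
    exact Submodule.sum_mem _ fun b hb =>
      Submodule.mem_iSup_of_mem b (Submodule.mem_iSup_of_mem hb (hrange b (hsne b hb) x))
  · refine iSup₂_le fun b hb x hx => ⟨x, ?_⟩
    change (∑ c ∈ s, Q c) x = x
    have h1 := DFunLike.congr_fun (hQsum s hsne b (hsne b hb)) x
    rw [if_pos hb, hmul, hid b (hsne b hb) x hx] at h1
    exact h1

end RieszIntegral

end

end PhotonicCrystal

namespace PhotonicCrystal
noncomputable section
open MeasureTheory Set Filter Topology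
open scoped ContDiff

/-! ### Traces as weighted sums over generalized eigenspaces. -/

section Trace

theorem isNilpotent_pow_sub_smul_one {R : Type*} [Ring R] [Algebra ℂ R] {x : R} {b : ℂ}
    (h : IsNilpotent (x - b • 1)) (k : ℕ) : IsNilpotent (x ^ k - b ^ k • 1) := by
  have hc : Commute x (b • 1) := (Commute.one_right x).smul_right b
  have h1 := hc.mul_geom_sum₂ k
  rw [smul_pow, one_pow] at h1
  rw [← h1]
  refine Commute.isNilpotent_mul_right ?_ h
  refine Commute.sum_right _ _ _ fun i _ => ?_
  exact (((Commute.refl x).sub_left hc.symm).pow_right i).mul_right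
    ((hc.sub_left (Commute.refl _)).pow_right _)

theorem isNilpotent_sub_inv_smul_one {R : Type*} [Ring R] [Algebra ℂ R] {x y : R} {b : ℂ}
    (hb : b ≠ 0) (hxy : x * y = 1) (hyx : y * x = 1)
    (h : IsNilpotent (x - b • 1)) : IsNilpotent (y - b⁻¹ • 1) := by
  have h1 : y - b⁻¹ • 1 = (x - b • 1) * (-b⁻¹ • y) := by
    rw [sub_mul, mul_smul_comm, hxy, smul_mul_assoc, one_mul, smul_smul, mul_neg,
      mul_inv_cancel₀ hb, neg_smul, neg_smul, one_smul]
    abel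
  rw [h1]
  refine Commute.isNilpotent_mul_right ?_ h
  have hc : Commute x y := hxy.trans hyx.symm
  exact (hc.sub_left ((Commute.one_left y).smul_left b)).smul_right _

variable {V : Type*} [AddCommGroup V] [Module ℂ V] [FiniteDimensional ℂ V]

open Module.End in
-- The trace is additive over the generalized eigenspaces of f, and on each of them g differs from a
-- scalar by a nilpotent operator, of trace 0. A second operator g is allowed so that powers of f
-- and of its inverse are both covered.
theorem trace_eq_sum_of_isNilpotent {f g : Module.End ℂ V} {s : Finset ℂ}
    (htop : ⨆ b ∈ s, maxGenEigenspace f b = ⊤) (hcomm : Commute f g) (e : ℂ → ℂ)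
    (h : ∀ b ∈ s, IsNilpotent
      (g.restrict (mapsTo_maxGenEigenspace_of_comm hcomm b) - e b • 1)) :
    LinearMap.trace ℂ V g = ∑ b ∈ s, (Module.finrank ℂ (maxGenEigenspace f b) : ℂ) * e b := by
  classical
  have hint : DirectSum.IsInternal fun b : s => maxGenEigenspace f (b : ℂ) := by
    rw [DirectSum.isInternal_submodule_iff_iSupIndep_and_iSup_eq_top]
    refine ⟨(independent_maxGenEigenspace f).comp Subtype.val_injective, ?_⟩
    rw [← htop, iSup_subtype]
  rw [LinearMap.trace_eq_sum_trace_restrict hint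
    fun b : s => mapsTo_maxGenEigenspace_of_comm hcomm (b : ℂ), ← Finset.sum_coe_sort s]
  refine Finset.sum_congr rfl fun b _ => ?_
  have h1 := (LinearMap.isNilpotent_trace_of_isNilpotent (h b b.2)).eq_zero
  rw [map_sub, sub_eq_zero] at h1
  rw [h1, map_smul, LinearMap.trace_one, smul_eq_mul, mul_comm]

open Module.End in
theorem isNilpotent_restrict_sub_smul_one (f : Module.End ℂ V) (b : ℂ) :
    IsNilpotent (f.restrict (mapsTo_maxGenEigenspace_of_comm (Commute.refl f) b) - b • 1) := by
  have hm : MapsTo (f - algebraMap ℂ (Module.End ℂ V) b) (maxGenEigenspace f b)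
      (maxGenEigenspace f b) :=
    mapsTo_maxGenEigenspace_of_comm (Algebra.mul_sub_algebraMap_commutes f b) b
  exact isNilpotent_restrict_maxGenEigenspace_sub_algebraMap f b hm

open Module.End in
theorem trace_pow_eq_sum {f : Module.End ℂ V} {s : Finset ℂ}
    (htop : ⨆ b ∈ s, maxGenEigenspace f b = ⊤) (k : ℕ) :
    LinearMap.trace ℂ V (f ^ k) =
      ∑ b ∈ s, (Module.finrank ℂ (maxGenEigenspace f b) : ℂ) * b ^ k := by
  refine trace_eq_sum_of_isNilpotent htop ((Commute.refl f).pow_right k) _ fun b _ => ?_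
  have := isNilpotent_pow_sub_smul_one (isNilpotent_restrict_sub_smul_one f b) k
  rwa [← Module.End.pow_restrict k (mapsTo_maxGenEigenspace_of_comm (Commute.refl f) b)]

open Module.End in
theorem trace_inv_pow_eq_sum {f g : Module.End ℂ V} {s : Finset ℂ} (h0 : (0 : ℂ) ∉ s)
    (htop : ⨆ b ∈ s, maxGenEigenspace f b = ⊤) (hfg : f * g = 1) (hgf : g * f = 1) (k : ℕ) :
    LinearMap.trace ℂ V (g ^ k) =
      ∑ b ∈ s, (Module.finrank ℂ (maxGenEigenspace f b) : ℂ) * b⁻¹ ^ k := by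
  have hc : Commute f g := hfg.trans hgf.symm
  refine trace_eq_sum_of_isNilpotent htop (hc.pow_right k) (fun b => b⁻¹ ^ k) fun b hb => ?_
  have hb0 : b ≠ 0 := fun h => h0 (h ▸ hb)
  have := isNilpotent_pow_sub_smul_one (isNilpotent_sub_inv_smul_one hb0
    (x := f.restrict (mapsTo_maxGenEigenspace_of_comm (Commute.refl f) b)) (y := g.restrict (mapsTo_maxGenEigenspace_of_comm hc b))
    (LinearMap.ext fun x => Subtype.ext (LinearMap.congr_fun hfg (x : V)))
    (LinearMap.ext fun x => Subtype.ext (LinearMap.congr_fun hgf (x : V)))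
    (isNilpotent_restrict_sub_smul_one f b)) k
  rwa [← Module.End.pow_restrict k (mapsTo_maxGenEigenspace_of_comm hc b)]

open Module.End in
-- The kernel lies in the generalized eigenspace for 0, which is independent of the others, and the
-- others already span.
theorem isUnit_of_iSup_maxGenEigenspace {f : Module.End ℂ V} {s : Finset ℂ} (h0 : (0 : ℂ) ∉ s)
    (htop : ⨆ b ∈ s, maxGenEigenspace f b = ⊤) : IsUnit f := by
  rw [LinearMap.isUnit_iff_ker_eq_bot, eq_bot_iff]
  intro x hx
  have h1 : x ∈ maxGenEigenspace f 0 :=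
    (mem_maxGenEigenspace _ _ _).2 ⟨1, by simpa using hx⟩
  have h2 : x ∈ ⨆ (b : ℂ) (_ : b ≠ 0), maxGenEigenspace f b := by
    have : (⊤ : Submodule ℂ V) ≤ ⨆ (b : ℂ) (_ : b ≠ 0), maxGenEigenspace f b := by
      rw [← htop]
      exact iSup₂_mono' fun b hb => ⟨b, fun h => h0 (h ▸ hb), le_rfl⟩
    exact this trivial
  exact Submodule.disjoint_def.1 (independent_maxGenEigenspace f 0) x h1 h2

end Trace

/-! ### Generalized eigenspaces of a restriction. -/

section Restrict

open Module.End

variable {M : Type*} [AddCommGroup M] [Module ℂ M]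

theorem iSup_maxGenEigenspace_restrict (f : Module.End ℂ M) (s : Finset ℂ) (W : Submodule ℂ M)
    (hW : W = ⨆ b ∈ s, maxGenEigenspace f b) (hf : ∀ x ∈ W, f x ∈ W) :
    ⨆ b ∈ s, maxGenEigenspace (f.restrict hf) b = ⊤ := by
  have hle : ∀ b ∈ s, maxGenEigenspace f b ≤ W := fun b hb => by
    rw [hW]; exact le_iSup₂_of_le b hb le_rfl
  refine Submodule.map_injective_of_injective W.injective_subtype ?_
  simp only [Submodule.map_iSup, Submodule.map_top, Submodule.range_subtype]
  conv_rhs => rw [hW]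
  refine biSup_congr fun b hb => ?_
  rw [maxGenEigenspace, genEigenspace_restrict, Submodule.map_comap_subtype]
  exact inf_eq_right.2 (hle b hb)

theorem finrank_maxGenEigenspace_restrict (f : Module.End ℂ M) (W : Submodule ℂ M)
    (hf : ∀ x ∈ W, f x ∈ W) {b : ℂ} (hle : maxGenEigenspace f b ≤ W) :
    Module.finrank ℂ (maxGenEigenspace (f.restrict hf) b) =
      Module.finrank ℂ (maxGenEigenspace f b) := by
  rw [maxGenEigenspace, genEigenspace_restrict]
  exact (Submodule.comapSubtypeEquivOfLe hle).finrank_eq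

end Restrict

end

end PhotonicCrystal

namespace PhotonicCrystal
noncomputable section
open MeasureTheory Set Filter Topology
open scoped ContDiff

/-! ### Analyticity of power sums of an eigenvalue group. -/

section Group

open Module.End

variable {H : Type*} [NormedAddCommGroup H] [InnerProductSpace ℂ H] [CompleteSpace H]

variable {V : Type*} [NormedAddCommGroup V] [NormedSpace ℂ V]

/-- The compression `X ↦ R X ι` of operators on `H` to `V`. -/
def compression (R : H →L[ℂ] V) (ι : V →L[ℂ] H) : (H →L[ℂ] H) →L[ℂ] (V →L[ℂ] V) :=
  (ContinuousLinearMap.compL ℂ V H V R) ∘L (ContinuousLinearMap.compL ℂ V H H).flip ι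

/-- If `P` is a projection close to the projection `ι R` onto a copy of `V`, the restriction of `A`
to the range of `P` is conjugate to an operator on `V`. -/
theorem trace_compression {A P : H →L[ℂ] H} (hP : IsIdempotentElem P) (hAP : Commute A P)
    {R : H →L[ℂ] V} {ι : V →L[ℂ] H} (hn : ‖P - ι ∘L R‖ < 1) [FiniteDimensional ℂ V]
    (hU : IsUnit (compression R ι P)) {s : Finset ℂ} (h0 : (0 : ℂ) ∉ s)
    (hrange : LinearMap.range (P : H →ₗ[ℂ] H) = ⨆ b ∈ s, maxGenEigenspace (A : H →ₗ[ℂ] H) b)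
    {C : V →L[ℂ] V} (hC : C = compression R ι (A * P) * Ring.inverse (compression R ι P)) :
    IsUnit C ∧
    (∀ k : ℕ, LinearMap.trace ℂ V ((C ^ k : V →L[ℂ] V) : V →ₗ[ℂ] V) =
      ∑ b ∈ s, (Module.finrank ℂ (maxGenEigenspace (A : H →ₗ[ℂ] H) b) : ℂ) * b ^ k) ∧
    ∀ k : ℕ, LinearMap.trace ℂ V ((Ring.inverse C ^ k : V →L[ℂ] V) : V →ₗ[ℂ] V) =
      ∑ b ∈ s, (Module.finrank ℂ (maxGenEigenspace (A : H →ₗ[ℂ] H) b) : ℂ) * b⁻¹ ^ k := by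
  have hPP : ∀ x, P (P x) = P x := fun x => DFunLike.congr_fun hP x
  have hAPx : ∀ x, A (P x) = P (A x) := fun x => DFunLike.congr_fun hAP x
  have hfix : ∀ x ∈ LinearMap.range (P : H →ₗ[ℂ] H), P x = x := by
    rintro _ ⟨x, rfl⟩; exact hPP x
  have hAW : ∀ x ∈ LinearMap.range (P : H →ₗ[ℂ] H), (A : H →ₗ[ℂ] H) x ∈
      LinearMap.range (P : H →ₗ[ℂ] H) := by
    rintro _ ⟨x, rfl⟩; exact ⟨A x, (hAPx x).symm⟩
  set U := compression R ι P with hUdef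
  have hUU : ∀ v, U (Ring.inverse U v) = v := fun v =>
    DFunLike.congr_fun (Ring.mul_inverse_cancel _ hU) v
  let R' : LinearMap.range (P : H →ₗ[ℂ] H) →ₗ[ℂ] V :=
    (R : H →ₗ[ℂ] V) ∘ₗ Submodule.subtype _
  -- A vector fixed by P and killed by R is fixed by P - ιR, which has norm less than 1.
  have hRinj : Function.Injective R' := by
    rw [injective_iff_map_eq_zero]
    intro x hx
    have h1 : R x = 0 := hx
    have h2 : (P - ι ∘L R) x = x := by
      change P x - ι (R x) = x
      rw [h1, map_zero, sub_zero, hfix x x.2]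
    have h3 : ‖(x : H)‖ ≤ ‖P - ι ∘L R‖ * ‖(x : H)‖ := by
      conv_lhs => rw [← h2]
      exact (P - ι ∘L R).le_opNorm _
    have h4 : ‖(x : H)‖ = 0 := by nlinarith [norm_nonneg (x : H)]
    exact Subtype.ext (norm_eq_zero.1 h4)
  -- With U = RPι invertible, PιU⁻¹ is an explicit right inverse, so R identifies the range of P
  -- with V.
  have hlift : ∀ v, R' ⟨P (ι (Ring.inverse U v)), ⟨_, rfl⟩⟩ = v := hUU
  let e : LinearMap.range (P : H →ₗ[ℂ] H) ≃ₗ[ℂ] V :=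
    LinearEquiv.ofBijective R' ⟨hRinj, fun v => ⟨_, hlift v⟩⟩
  have hfin : FiniteDimensional ℂ (LinearMap.range (P : H →ₗ[ℂ] H)) :=
    Module.Finite.of_injective R' hRinj
  set f := (A : H →ₗ[ℂ] H).restrict hAW with hf
  have htop := iSup_maxGenEigenspace_restrict (A : H →ₗ[ℂ] H) s _ hrange hAW
  have hrank : ∀ b ∈ s, Module.finrank ℂ (maxGenEigenspace f b) =
      Module.finrank ℂ (maxGenEigenspace (A : H →ₗ[ℂ] H) b) := fun b hb =>
    finrank_maxGenEigenspace_restrict _ _ hAW (by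
      rw [hrange]; exact le_iSup₂_of_le b hb le_rfl)
  have hconj : e.conj f = (C : _ →ₗ[ℂ] _) := by
    ext v
    have h1 : e.symm v = ⟨P (ι (Ring.inverse U v)), ⟨_, rfl⟩⟩ :=
      e.symm_apply_eq.2 (hlift v).symm
    rw [LinearEquiv.conj_apply_apply, h1, hC]
    rfl
  have hconj' : e.conjRingEquiv f = ContinuousLinearMap.toLinearMapRingHom C := hconj
  have hfu : IsUnit f := isUnit_of_iSup_maxGenEigenspace h0 htop
  have hCu : IsUnit C := by
    have h1 : IsUnit (ContinuousLinearMap.toLinearMapRingHom C) := by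
      rw [← hconj']; exact hfu.map e.conjRingEquiv
    exact ContinuousLinearMap.isUnit_iff_bijective.2 ((Module.End.isUnit_iff _).1 h1)
  have htr : ∀ X, LinearMap.trace ℂ _ X = LinearMap.trace ℂ _ (e.conjRingEquiv.symm X) := fun X => by
    conv_lhs => rw [← e.conjRingEquiv.apply_symm_apply X]
    exact LinearMap.trace_conj' _ e
  refine ⟨hCu, fun k => ?_, fun k => ?_⟩
  · change LinearMap.trace ℂ _ (ContinuousLinearMap.toLinearMapRingHom (C ^ k)) = _
    rw [map_pow, ← hconj', ← map_pow, htr, RingEquiv.symm_apply_apply, trace_pow_eq_sum htop]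
    exact Finset.sum_congr rfl fun b hb => by rw [hrank b hb]
  · change LinearMap.trace ℂ _ (ContinuousLinearMap.toLinearMapRingHom (Ring.inverse C ^ k)) = _
    rw [map_pow, htr, map_pow]
    rw [trace_inv_pow_eq_sum h0 htop (f := f)]
    · exact Finset.sum_congr rfl fun b hb => by rw [hrank b hb]
    · apply e.conjRingEquiv.injective
      rw [map_mul, RingEquiv.apply_symm_apply, hconj', ← map_mul, Ring.mul_inverse_cancel _ hCu,
        map_one, map_one]
    · apply e.conjRingEquiv.injective
      rw [map_mul, RingEquiv.apply_symm_apply, hconj', ← map_mul, Ring.inverse_mul_cancel _ hCu,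
        map_one, map_one]

/-- The range of P(z) moves with z, but near z₀ it is identified with the fixed space V, where A(z)
becomes C(z) = (R A P ι)(R P ι)⁻¹. This family is analytic and invertible, and the power sums are
traces of its integer powers. -/
theorem analyticAt_sum_zpow_of_retract [FiniteDimensional ℂ V] {A P : ℂ → H →L[ℂ] H}
    {s : ℂ → Finset ℂ} {z₀ : ℂ} (hA : AnalyticAt ℂ A z₀) (hP : AnalyticAt ℂ P z₀)
    {R : H →L[ℂ] V} {ι : V →L[ℂ] H} (hι : ∀ v, R (ι v) = v) (hR : ι ∘L R = P z₀)
    (h : ∀ᶠ z in 𝓝 z₀, IsIdempotentElem (P z) ∧ Commute (A z) (P z) ∧ (0 : ℂ) ∉ s z ∧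
      LinearMap.range (P z : H →ₗ[ℂ] H) = ⨆ b ∈ s z, maxGenEigenspace (A z : H →ₗ[ℂ] H) b) :
    (∀ p : ℤ, AnalyticAt ℂ (fun z => ∑ b ∈ s z,
      (Module.finrank ℂ (maxGenEigenspace (A z : H →ₗ[ℂ] H) b) : ℂ) * b ^ p) z₀) ∧
    ∀ᶠ z in 𝓝 z₀, ∑ b ∈ s z, (Module.finrank ℂ (maxGenEigenspace (A z : H →ₗ[ℂ] H) b) : ℂ) =
      ∑ b ∈ s z₀, (Module.finrank ℂ (maxGenEigenspace (A z₀ : H →ₗ[ℂ] H) b) : ℂ) := by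
  let J := compression R ι
  have hU : AnalyticAt ℂ (fun z => J (P z)) z₀ := (J.analyticAt _).comp hP
  have hU0 : J (P z₀) = 1 := by
    ext v
    change R (P z₀ (ι v)) = v
    rw [← hR]
    exact (congrArg R (congrArg ι (hι v))).trans (hι v)
  have hUinv : AnalyticAt ℂ (fun z => Ring.inverse (J (P z))) z₀ :=
    AnalyticAt.fun_comp (by
      rw [hU0, ← Units.val_one]; exact analyticAt_inverse 1) hU
  have hUev : ∀ᶠ z in 𝓝 z₀, IsUnit (J (P z)) :=
    hU.continuousAt.eventually (Units.isOpen.mem_nhds (by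
      change IsUnit (J (P z₀)); rw [hU0]; exact isUnit_one))
  have hnev : ∀ᶠ z in 𝓝 z₀, ‖P z - ι ∘L R‖ < 1 := by
    rw [hR]
    filter_upwards [hP.continuousAt (Metric.ball_mem_nhds (P z₀) one_pos)] with z hz
    rwa [mem_preimage, Metric.mem_ball, dist_eq_norm] at hz
  let C := fun z => J (A z * P z) * Ring.inverse (J (P z))
  have hC : AnalyticAt ℂ C z₀ := ((J.analyticAt _).comp (hA.mul hP)).mul hUinv
  have key := (h.and (hUev.and hnev)).mono fun z hz =>
    trace_compression hz.1.1 hz.1.2.1 hz.2.2 hz.2.1 hz.1.2.2.1 hz.1.2.2.2 (C := C z) rfl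
  have hCu : IsUnit (C z₀) := key.self_of_nhds.1
  have hCinv : AnalyticAt ℂ (fun z => Ring.inverse (C z)) z₀ := by
    obtain ⟨u, hu⟩ := hCu
    exact AnalyticAt.fun_comp (by rw [← hu]; exact analyticAt_inverse u) hC
  let tr : (V →L[ℂ] V) →L[ℂ] ℂ :=
    LinearMap.toContinuousLinearMap (LinearMap.trace ℂ _ ∘ₗ ContinuousLinearMap.coeLM ℂ)
  refine ⟨fun p => ?_, ?_⟩
  · obtain ⟨k, rfl | rfl⟩ := p.eq_nat_or_neg
    · refine ((tr.analyticAt _).comp (hC.pow k)).congr ?_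
      filter_upwards [key] with z hz
      exact (hz.2.1 k).trans (by simp)
    · refine ((tr.analyticAt _).comp (hCinv.pow k)).congr ?_
      filter_upwards [key] with z hz
      exact (hz.2.2 k).trans (by simp)
  -- The trace of `C z ^ 0` is dim V, whatever z is.
  · have h0 := key.self_of_nhds.2.1 0
    filter_upwards [key] with z hz
    have h1 := hz.2.1 0
    simp only [pow_zero, mul_one] at h0 h1
    rw [← h0, ← h1]

/-- Power sums of the eigenvalues in the range of an analytic family of spectral projections are
analytic, and the number of these eigenvalues is locally constant. -/
theorem analyticAt_sum_zpow {A P : ℂ → H →L[ℂ] H} {s : ℂ → Finset ℂ} {z₀ : ℂ}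
    (hA : AnalyticAt ℂ A z₀) (hP : AnalyticAt ℂ P z₀)
    (hfd : ∀ b ∈ s z₀, FiniteDimensional ℂ (maxGenEigenspace (A z₀ : H →ₗ[ℂ] H) b))
    (h : ∀ᶠ z in 𝓝 z₀, IsIdempotentElem (P z) ∧ Commute (A z) (P z) ∧ (0 : ℂ) ∉ s z ∧
      LinearMap.range (P z : H →ₗ[ℂ] H) = ⨆ b ∈ s z, maxGenEigenspace (A z : H →ₗ[ℂ] H) b) :
    (∀ p : ℤ, AnalyticAt ℂ (fun z => ∑ b ∈ s z,
      (Module.finrank ℂ (maxGenEigenspace (A z : H →ₗ[ℂ] H) b) : ℂ) * b ^ p) z₀) ∧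
    ∀ᶠ z in 𝓝 z₀, ∑ b ∈ s z, (Module.finrank ℂ (maxGenEigenspace (A z : H →ₗ[ℂ] H) b) : ℂ) =
      ∑ b ∈ s z₀, (Module.finrank ℂ (maxGenEigenspace (A z₀ : H →ₗ[ℂ] H) b) : ℂ) := by
  obtain ⟨hid, -, -, hr⟩ := h.self_of_nhds
  obtain ⟨V, hVr⟩ : ∃ V : Submodule ℂ H, V = LinearMap.range (P z₀ : H →ₗ[ℂ] H) := ⟨_, rfl⟩
  have hV : FiniteDimensional ℂ V := by
    rw [hVr, hr, iSup_subtype']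
    have : ∀ b : s z₀, FiniteDimensional ℂ (maxGenEigenspace (A z₀ : H →ₗ[ℂ] H) (b : ℂ)) :=
      fun b => hfd b b.2
    exact Submodule.finiteDimensional_iSup _
  -- The model space is the range of `P z₀`, with `P z₀` itself as the retraction onto it.
  refine analyticAt_sum_zpow_of_retract hA hP
    (R := (P z₀).codRestrict V fun x => by rw [hVr]; exact ⟨x, rfl⟩) (ι := V.subtypeL)
    (fun v => Subtype.ext ?_) rfl h
  obtain ⟨x, hx⟩ : (v : H) ∈ LinearMap.range (P z₀ : H →ₗ[ℂ] H) := hVr ▸ v.2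
  change P z₀ v = v
  rw [← hx]
  exact DFunLike.congr_fun hid x

end Group

end

end PhotonicCrystal

namespace PhotonicCrystal
noncomputable section
open MeasureTheory Set Filter Topology
open scoped ComplexConjugate ContDiff

/-! ### Rellich compactness from Fourier series. -/

section Compactness

/-- An operator that is small on subspaces of finite codimension is compact. -/
theorem isCompactOperator_of_forall_exists {J F : Type*} [NormedAddCommGroup J]
    [InnerProductSpace ℂ J] [CompleteSpace J] [NormedAddCommGroup F] [NormedSpace ℂ F]
    [CompleteSpace F] (T : J →L[ℂ] F) {ι : Type*} {G : ι → Type*}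
    [∀ i, NormedAddCommGroup (G i)] [∀ i, NormedSpace ℂ (G i)] [∀ i, FiniteDimensional ℂ (G i)]
    (C : ∀ i, J →L[ℂ] G i) (h : ∀ ε > 0, ∃ i, ∀ u, C i u = 0 → ‖T u‖ ≤ ε * ‖u‖) :
    IsCompactOperator T := by
  have hcl := isClosed_setOfPred_isCompactOperator (σ₁₂ := RingHom.id ℂ) (M₁ := J) (M₂ := F)
  refine hcl.closure_subset (Metric.mem_closure_iff.2 fun ε hε => ?_)
  obtain ⟨i, hC⟩ := h (ε / 2) (half_pos hε)
  let M : Submodule ℂ J := LinearMap.ker (C i : J →ₗ[ℂ] G i)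
  have hM : CompleteSpace M := ContinuousLinearMap.completeSpace_ker (C i)
  have hfin : FiniteDimensional ℂ Mᗮ := by
    refine Module.Finite.of_injective ((C i : J →ₗ[ℂ] G i) ∘ₗ Mᗮ.subtype) ?_
    rw [injective_iff_map_eq_zero]
    intro x hx
    have h1 : (x : J) ∈ M := hx
    exact Subtype.ext (Submodule.disjoint_def.1 M.orthogonal_disjoint _ h1 x.2)
  -- A finite-rank approximation: `C i` is injective on the orthogonal complement of its kernel M,
  -- and the error is T composed with the projection onto M, where T is small.
  refine ⟨T ∘L (Mᗮ).starProjection, ?_, ?_⟩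
  · have h1 : IsCompactOperator (Mᗮ).orthogonalProjectionOnto :=
      isCompactOperator_of_locallyCompactSpace_dom _
    exact h1.clm_comp (T ∘L (Mᗮ).subtypeL)
  · refine lt_of_le_of_lt ?_ (half_lt_self hε)
    rw [dist_eq_norm]
    refine ContinuousLinearMap.opNorm_le_bound _ (half_pos hε).le fun u => ?_
    have h1 : (T - T ∘L (Mᗮ).starProjection) u = T (M.starProjection u) := by
      change T u - T ((Mᗮ).starProjection u) = _
      rw [← map_sub, Submodule.starProjection_orthogonal']
      simp
    rw [h1]
    refine (hC _ (Submodule.starProjection_apply_mem M u)).trans ?_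
    gcongr
    exact Submodule.norm_starProjection_apply_le _ _

/-- As |α i| ≤ π, one has |2πn_i + α_i| ≥ 2π(N + 1) - π ≥ N. -/
theorem sq_le_sum_freq_sq {α : R3} (hα : α ∈ brillouinZone) {n : Fin 3 → ℤ} {N : ℕ} {i : Fin 3}
    (h : (N : ℤ) < |n i|) : (N : ℝ) ^ 2 ≤ ∑ j, freq α n j ^ 2 := by
  refine le_trans ?_ (Finset.single_le_sum (f := fun j => freq α n j ^ 2)
    (fun j _ => sq_nonneg _) (Finset.mem_univ i))
  obtain ⟨h1, h2⟩ := hα i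
  have h3 : (N : ℝ) + 1 ≤ |(n i : ℝ)| := by
    have : (N : ℤ) + 1 ≤ |n i| := h
    exact_mod_cast this
  have hπ := Real.pi_gt_three
  rw [← sq_abs (freq α n i)]
  refine pow_le_pow_left₀ (Nat.cast_nonneg N) ?_ 2
  have h4 : |α i| ≤ Real.pi := abs_le.2 ⟨h1.le, h2⟩
  have h5 : |2 * Real.pi * n i| ≤ |freq α n i| + |α i| := by
    have : 2 * Real.pi * n i = freq α n i - α i := by simp [freq]
    rw [this]
    exact abs_sub _ _
  rw [abs_mul, abs_of_pos (by positivity : 0 < 2 * Real.pi)] at h5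
  nlinarith [Nat.cast_nonneg (α := ℝ) N]

/-- The Fourier modes `n` of elements of `J_#`. -/
def modes (α : brillouinZone) (s : Finset (Fin 3 → ℤ)) : JSpace α →L[ℂ] (s → C3) :=
  ContinuousLinearMap.pi fun n => pairing _ (continuous_conj_planeWave α.1 n) ∘L emb α

/-- By Parseval the norm of u is that of the coefficients weighted by |2πn + α|, and every surviving
mode has weight at least N. -/
theorem norm_emb_le_of_modes_eq_zero (α : brillouinZone) {N : ℕ} {u : JSpace α}
    (hu : modes α (Fintype.piFinset fun _ => Finset.Icc (-N : ℤ) N) u = 0) :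
    N * ‖emb α u‖ ≤ ‖u‖ := by
  refine (abs_le_of_sq_le_sq' ?_ (norm_nonneg _)).2
  rw [mul_pow]
  have h1 : ‖u‖ = ‖curlOf u.1.2‖ := rfl
  have h2 : emb α u = u.1.1 := rfl
  rw [h1, h2]
  refine hasSum_le (fun n => ?_) ((parseval α.1 u.1.1).mul_left _) (parseval α.1 (curlOf u.1.2))
  rw [norm_coeff_curl u.2]
  by_cases hn : n ∈ Fintype.piFinset fun _ : Fin 3 => Finset.Icc (-N : ℤ) N
  · have : coeff α.1 u.1.1 n = 0 := congrFun hu ⟨n, hn⟩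
    simp [this]
  · rw [Fintype.mem_piFinset] at hn
    push Not at hn
    obtain ⟨i, hi⟩ := hn
    rw [Finset.mem_Icc, ← abs_le, not_le] at hi
    exact mul_le_mul_of_nonneg_right (sq_le_sum_freq_sq α.2 hi) (sq_nonneg _)

/-- Rellich's theorem for `J_#`. -/
theorem isCompactOperator_emb (α : brillouinZone) : IsCompactOperator (emb α) := by
  refine isCompactOperator_of_forall_exists (emb α)
    (fun N : ℕ => modes α (Fintype.piFinset fun _ => Finset.Icc (-N : ℤ) N)) fun ε hε => ?_
  obtain ⟨N, hN⟩ := exists_nat_gt ε⁻¹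
  have hN0 : (0 : ℝ) < N := (inv_pos.2 hε).trans hN
  refine ⟨N, fun u hu => ?_⟩
  have h1 := norm_emb_le_of_modes_eq_zero α hu
  calc ‖emb α u‖ = ε * (ε⁻¹ * ‖emb α u‖) := by rw [mul_inv_cancel_left₀ hε.ne']
    _ ≤ ε * (N * ‖emb α u‖) := by gcongr
    _ ≤ ε * ‖u‖ := by gcongr

end Compactness

/-! ### The embedding of J_# into L² is not onto. -/

section NotSurjective

theorem continuous_planeWave (α : R3) (n : Fin 3 → ℤ) : Continuous (planeWave α n) :=
  (contDiff_planeWave α n).continuous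

theorem sum_freq_mul_coeff_emb (α : brillouinZone) (u : JSpace α) (n : Fin 3 → ℤ) :
    ∑ j, (freq α.1 n j : ℂ) * coeff α.1 (emb α u) n j = 0 := by
  obtain ⟨h1, h2, -⟩ := u.2
  have hg := fun j => coeff_partial (h1 j) n
  have h3 := congrArg (pairing _ (continuous_conj_planeWave α.1 n)) h2
  simp only [divOf, map_sum, pairing_compLpL, map_zero, ← coeff_eq_pairing, hg] at h3
  have : Complex.I * ∑ j, (freq α.1 n j : ℂ) * coeff α.1 (emb α u) n j = 0 := by
    rw [Finset.mul_sum, ← h3]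
    exact Finset.sum_congr rfl fun j _ => by simp [mul_assoc]; left; rfl
  simpa using this

/-- A plane wave polarized along the first axis with first frequency component 2π + α₀ > π is not
divergence-free. This is what puts 0 in the spectrum of every A(z). -/
theorem not_surjective_emb (α : brillouinZone) : ¬ Function.Surjective (emb α) := by
  intro hs
  let n : Fin 3 → ℤ := Pi.single 0 1
  let e : C3 := EuclideanSpace.single 0 1
  have hm : MemLp (fun x => planeWave α.1 n x • e) 2 (volume.restrict unitCell) :=
    MemLp.of_bound ((continuous_planeWave _ _).smul continuous_const).aestronglyMeasurable ‖e‖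
      (Eventually.of_forall fun x => by rw [norm_smul, norm_planeWave, one_mul])
  obtain ⟨u, hu⟩ := hs hm.toLp
  have hc : coeff α.1 (emb α u) n = e := by
    rw [hu, coeff]
    have : ∫ x in unitCell, conj (planeWave α.1 n x) • hm.toLp _ x = ∫ x in unitCell, e := by
      refine integral_congr_ae ?_
      filter_upwards [hm.coeFn_toLp] with x hx
      rw [hx, smul_smul, mul_comm, Complex.mul_conj, Complex.normSq_eq_norm_sq, norm_planeWave]
      simp
    rw [this]
    simp
  have h := sum_freq_mul_coeff_emb α u n
  rw [hc, Fin.sum_univ_three] at h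
  have h1 : -Real.pi < α.1 0 := (α.2 0).1
  have h2 : freq α.1 n 0 = 0 := by simpa [e] using h
  simp only [freq, n, Pi.single_eq_same, Int.cast_one, mul_one] at h2
  linarith [Real.pi_pos]

end NotSurjective

/-! ### Reduction to the host energy operator. -/

section Energy

variable (α : brillouinZone) (D : Inclusion)

/-- Host and inclusion partition the cell, and the full energy is the inner product of J_#; hence
T_k and T are polynomials in the host energy alone. -/
theorem energyOp_add_energyOp : energyOp α D.host + energyOp α D.carrier = 1 := by
  ext1 u
  refine ext_inner_left ℂ fun w => ?_
  have hH : MeasurableSet D.host := measurableSet_unitCell.diff D.measurable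
  change inner ℂ w (energyOp α D.host u + energyOp α D.carrier u) = inner ℂ w u
  have hi : IntegrableOn (fun x => inner ℂ (curl α w x) (curl α u x)) unitCell volume :=
    L2.integrable_inner (𝕜 := ℂ) (curl α w) (curl α u)
  rw [inner_add_right, inner_energyOp α hH sdiff_subset, inner_energyOp α D.measurable D.subset,
    inner_JSpace, Inclusion.host, ← setIntegral_union disjoint_sdiff_left D.measurable
      (hi.mono_set sdiff_subset) (hi.mono_set D.subset), sdiff_union_of_subset D.subset]

theorem isSelfAdjoint_energyOp (S : Set R3) : IsSelfAdjoint (energyOp α S) := by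
  rw [energyOp, ContinuousLinearMap.isSelfAdjoint_iff']
  simp [ContinuousLinearMap.adjoint_comp]

theorem energyOp_eq_zero_iff {S : Set R3} {u : JSpace α} :
    energyOp α S u = 0 ↔ curlOn α S u = 0 := by
  refine ⟨fun h => ?_, fun h => by rw [energyOp, ContinuousLinearMap.comp_apply, h, map_zero]⟩
  have h1 : inner ℂ u (energyOp α S u) = 0 := by rw [h, inner_zero_right]
  rw [energyOp, ContinuousLinearMap.comp_apply, ContinuousLinearMap.adjoint_inner_right] at h1
  exact inner_self_eq_zero.1 h1

theorem energyOp_carrier : energyOp α D.carrier = 1 - energyOp α D.host :=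
  eq_sub_of_add_eq' (energyOp_add_energyOp α D)

theorem mem_W1 {u : JSpace α} : u ∈ W1 α D ↔ energyOp α D.host u = u := by
  have h1 : u ∈ W1 α D ↔ energyOp α D.carrier u = 0 := (energyOp_eq_zero_iff α).symm
  rw [h1, energyOp_carrier]
  change u - energyOp α D.host u = 0 ↔ _
  rw [sub_eq_zero, eq_comm]

theorem mem_W2 {u : JSpace α} : u ∈ W2 α D ↔ energyOp α D.host u = 0 :=
  (energyOp_eq_zero_iff α).symm

theorem opTk_apply (k : ℂ) (u : JSpace α) :
    opTk α D k u = k • energyOp α D.host u + (u - energyOp α D.host u) := by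
  rw [opTk, energyOp_carrier]; rfl

theorem opT_apply (u : JSpace α) : opT α D u = energyOp α D.host u - (1 / 2 : ℂ) • u := by
  rw [opT, energyOp_carrier]
  change (1 / 2 : ℂ) • energyOp α D.host u - (1 / 2 : ℂ) • (u - energyOp α D.host u) = _
  rw [smul_sub]
  have : energyOp α D.host u = (1 / 2 : ℂ) • energyOp α D.host u +
      (1 / 2 : ℂ) • energyOp α D.host u := by rw [← add_smul]; norm_num
  conv_rhs => rw [this]
  abel

end Energy

end

end PhotonicCrystal

namespace PhotonicCrystal
noncomputable section
open MeasureTheory Set Filter Topology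
open scoped ComplexConjugate ContDiff

/-! ### Affine pencils of a self-adjoint operator. -/

section Pencil

theorem isUnit_smul_iff_of_ne_zero {B : Type*} [Ring B] [Algebra ℂ B] {c : ℂ} (hc : c ≠ 0) {x : B} :
    IsUnit (c • x) ↔ IsUnit x := by
  have h : ∀ {c : ℂ} {x : B}, c ≠ 0 → IsUnit x → IsUnit (c • x) := fun hc hx => by
    rw [Algebra.smul_def]
    exact ((IsUnit.mk0 _ hc).map (algebraMap ℂ B)).mul hx
  refine ⟨fun hx => ?_, h hc⟩
  have := h (inv_ne_zero hc) hx
  rwa [smul_smul, inv_mul_cancel₀ hc, one_smul] at this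

variable {V : Type*} [NormedAddCommGroup V] [InnerProductSpace ℂ V]

/-- The operator `a (1/2 + S) + b (1/2 - S)`. -/
def pencilOf (S : V →L[ℂ] V) (a b : ℂ) : V →L[ℂ] V :=
  a • ((1 / 2 : ℂ) • 1 + S) + b • ((1 / 2 : ℂ) • 1 - S)

theorem pencilOf_one_left (S : V →L[ℂ] V) (z : ℂ) :
    pencilOf S 1 z = ((1 / 2 : ℂ) • 1 + S) + z • ((1 / 2 : ℂ) • 1 - S) := by
  rw [pencilOf, one_smul]

theorem pencilOf_inv (S : V →L[ℂ] V) {k : ℂ} (hk : k ≠ 0) :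
    pencilOf S 1 k⁻¹ = k⁻¹ • pencilOf S k 1 := by
  rw [pencilOf, pencilOf, smul_add k⁻¹, smul_smul k⁻¹ k, smul_smul k⁻¹ 1, inv_mul_cancel₀ hk,
    mul_one]

theorem pencilOf_eq (S : V →L[ℂ] V) (a b : ℂ) : pencilOf S a b =
    algebraMap ℂ (V →L[ℂ] V) ((a + b) / 2) + (a - b) • S := by
  rw [pencilOf, Algebra.algebraMap_eq_smul_one, smul_add, smul_sub, smul_smul, smul_smul, sub_smul,
    add_div, add_smul, mul_one_div, mul_one_div]
  abel

theorem pencilOf_eq_of_ne (S : V →L[ℂ] V) {a b : ℂ} (h : a ≠ b) : pencilOf S a b =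
    (b - a) • (algebraMap ℂ (V →L[ℂ] V) ((a + b) / (2 * (b - a))) - S) := by
  have h1 : b - a ≠ 0 := sub_ne_zero.2 h.symm
  rw [pencilOf_eq, smul_sub, Algebra.algebraMap_eq_smul_one, Algebra.algebraMap_eq_smul_one,
    smul_smul, ← neg_sub b a, neg_smul, ← sub_eq_add_neg]
  congr 2
  field_simp

/-- For a ≠ b the pencil is a multiple of λ - S for one λ, and self-adjointness leaves only real λ
to exclude. The case a = b is a scalar; it has its own hypothesis because on the zero space the
spectrum is empty. -/
theorem isUnit_pencilOf [CompleteSpace V] {S : V →L[ℂ] V} (hS : IsSelfAdjoint S) {a b : ℂ}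
    (hab : a = b → a ≠ 0)
    (h : ∀ μ : ℝ, (μ : ℂ) ∈ spectrum ℂ S → a * (1 / 2 + μ) + b * (1 / 2 - μ) ≠ 0) :
    IsUnit (pencilOf S a b) := by
  by_cases he : a = b
  · subst he
    rw [pencilOf_eq, sub_self, zero_smul, add_zero, add_self_div_two]
    exact (IsUnit.mk0 a (hab rfl)).map (algebraMap ℂ (V →L[ℂ] V))
  · have h1 : b - a ≠ 0 := sub_ne_zero.2 (Ne.symm he)
    rw [pencilOf_eq_of_ne S he, isUnit_smul_iff_of_ne_zero h1]
    by_contra hn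
    have hs : (a + b) / (2 * (b - a)) ∈ spectrum ℂ S := hn
    have hre := hS.mem_spectrum_eq_re hs
    refine h ((a + b) / (2 * (b - a))).re (by rwa [← hre]) ?_
    rw [← hre]
    field_simp
    ring

theorem ne_zero_of_isUnit_pencilOf {S : V →L[ℂ] V} {a b : ℂ} (hab : a ≠ b)
    (h : IsUnit (pencilOf S a b)) {μ : ℝ} (hμ : (μ : ℂ) ∈ spectrum ℂ S) :
    a * (1 / 2 + μ) + b * (1 / 2 - μ) ≠ 0 := by
  intro h0
  have h1 : b - a ≠ 0 := sub_ne_zero.2 (Ne.symm hab)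
  rw [pencilOf_eq_of_ne S hab, isUnit_smul_iff_of_ne_zero h1] at h
  have h3 : (a + b) / (2 * (b - a)) = μ := by
    field_simp
    linear_combination 2 * h0
  rw [h3] at h
  exact hμ h

theorem continuous_pencilOf_left (S : V →L[ℂ] V) (b : ℂ) : Continuous fun a => pencilOf S a b := by
  unfold pencilOf
  fun_prop

theorem isOpen_setOf_isUnit_pencilOf [CompleteSpace V] (S : V →L[ℂ] V) (b : ℂ) :
    IsOpen {a | IsUnit (pencilOf S a b)} :=
  Units.isOpen.preimage (continuous_pencilOf_left S b)

theorem analyticAt_pencilOf_right (S : V →L[ℂ] V) (a b : ℂ) :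
    AnalyticAt ℂ (fun b => pencilOf S a b) b :=
  analyticAt_const.add (analyticAt_id.smul analyticAt_const)

end Pencil

/-! ### Block decomposition of T_k and its inverse. -/

section Decomposition

variable (α : brillouinZone) (D : Inclusion)

theorem inner_energyOp_left (S : Set R3) (u v : JSpace α) :
    inner ℂ (energyOp α S u) v = inner ℂ u (energyOp α S v) :=
  (ContinuousLinearMap.isSelfAdjoint_iff_isSymmetric.1 (isSelfAdjoint_energyOp α S)) u v

theorem inner_W1_W2 {u v : JSpace α} (hu : u ∈ W1 α D) (hv : v ∈ W2 α D) : inner ℂ u v = 0 := by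
  rw [← (mem_W1 α D).1 hu, inner_energyOp_left, (mem_W2 α D).1 hv, inner_zero_right]

theorem mem_W3 {u : JSpace α} :
    u ∈ W3 α D ↔ (∀ v ∈ W1 α D, inner ℂ v u = 0) ∧ ∀ v ∈ W2 α D, inner ℂ v u = 0 := by
  rw [W3, ← Submodule.inf_orthogonal, Submodule.mem_inf, Submodule.mem_orthogonal,
    Submodule.mem_orthogonal]

theorem energyOp_mem_W3 {u : JSpace α} (hu : u ∈ W3 α D) : energyOp α D.host u ∈ W3 α D := by
  rw [mem_W3] at hu ⊢
  refine ⟨fun v hv => ?_, fun v hv => ?_⟩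
  · rw [← inner_energyOp_left, (mem_W1 α D).1 hv, hu.1 v hv]
  · rw [← inner_energyOp_left, (mem_W2 α D).1 hv, inner_zero_left]

/-- W₁ and W₂ are eigenspaces of a self-adjoint operator for 1 and 0, hence orthogonal, so removing
both projections leaves an element of W₃. -/
theorem exists_decomposition (x : JSpace α) :
    ∃ a ∈ W1 α D, ∃ b ∈ W2 α D, ∃ c : W3 α D, x = a + b + c := by
  refine ⟨(W1 α D).starProjection x, Submodule.starProjection_apply_mem _ _,
    (W2 α D).starProjection x, Submodule.starProjection_apply_mem _ _,
    ⟨x - (W1 α D).starProjection x - (W2 α D).starProjection x, ?_⟩, by simp⟩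
  have h1 : x - (W1 α D).starProjection x ∈ (W1 α D)ᗮ :=
    Submodule.sub_starProjection_mem_orthogonal x
  have h2 : x - (W2 α D).starProjection x ∈ (W2 α D)ᗮ :=
    Submodule.sub_starProjection_mem_orthogonal x
  rw [mem_W3]
  refine ⟨fun v hv => ?_, fun v hv => ?_⟩
  · rw [inner_sub_right, (Submodule.mem_orthogonal _ _).1 h1 v hv,
      inner_W1_W2 α D hv (Submodule.starProjection_apply_mem _ _), sub_zero]
  · rw [sub_right_comm, inner_sub_right, (Submodule.mem_orthogonal _ _).1 h2 v hv,
      ← inner_conj_symm, inner_W1_W2 α D (Submodule.starProjection_apply_mem _ _) hv, map_zero,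
      sub_zero]

variable {α D} in
theorem starProjection_W1 {a b : JSpace α} (ha : a ∈ W1 α D) (hb : b ∈ W2 α D) (c : W3 α D) :
    (W1 α D).starProjection (a + b + c) = a := by
  refine (Submodule.eq_starProjection_of_mem_orthogonal ha ?_)
  rw [Submodule.mem_orthogonal]
  intro v hv
  rw [add_assoc, add_sub_cancel_left, inner_add_right, inner_W1_W2 α D hv hb,
    ((mem_W3 α D).1 c.2).1 v hv, add_zero]

variable {α D} in
theorem starProjection_W2 {a b : JSpace α} (ha : a ∈ W1 α D) (hb : b ∈ W2 α D) (c : W3 α D) :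
    (W2 α D).starProjection (a + b + c) = b := by
  refine (Submodule.eq_starProjection_of_mem_orthogonal hb ?_)
  rw [Submodule.mem_orthogonal]
  intro v hv
  rw [add_comm a, add_assoc, add_sub_cancel_left, inner_add_right, ← inner_conj_symm,
    inner_W1_W2 α D ha hv, ((mem_W3 α D).1 c.2).2 v hv, map_zero, add_zero]

variable {α D} in
theorem orthogonalProjectionOnto_W3 {a b : JSpace α} (ha : a ∈ W1 α D) (hb : b ∈ W2 α D)
    (c : W3 α D) : (W3 α D).orthogonalProjectionOnto (a + b + c) = c := by
  refine Subtype.ext ?_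
  change (W3 α D).starProjection (a + b + c) = c
  refine (Submodule.eq_starProjection_of_mem_orthogonal c.2 ?_)
  rw [Submodule.mem_orthogonal]
  intro v hv
  rw [add_sub_cancel_right, inner_add_right, ← inner_conj_symm, ← inner_conj_symm v b,
    ((mem_W3 α D).1 hv).1 a ha, ((mem_W3 α D).1 hv).2 b hb, map_zero, add_zero]

/-- W₃ is invariant under T, so the outer projection in `opT3` does nothing. -/
theorem coe_opT3_apply (c : W3 α D) :
    (opT3 α D c : JSpace α) = energyOp α D.host c - (1 / 2 : ℂ) • (c : JSpace α) := by
  have h1 : opT α D c ∈ W3 α D := by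
    rw [opT_apply]
    exact sub_mem (energyOp_mem_W3 α D c.2) (Submodule.smul_mem _ _ c.2)
  change (W3 α D).starProjection (opT α D c) = _
  rw [Submodule.starProjection_eq_self_iff.2 h1, opT_apply]

theorem isSelfAdjoint_opT3 : IsSelfAdjoint (opT3 α D) := by
  rw [ContinuousLinearMap.isSelfAdjoint_iff_isSymmetric]
  intro u v
  change inner ℂ (opT3 α D u : JSpace α) (v : JSpace α) =
    inner ℂ (u : JSpace α) (opT3 α D v : JSpace α)
  rw [coe_opT3_apply, coe_opT3_apply, inner_sub_left, inner_sub_right, inner_energyOp_left,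
    inner_smul_left, inner_smul_right]
  congr 2
  norm_num [Complex.ext_iff]

/-- The operator `a (1/2 + T) + b (1/2 - T)` on `W₃`. -/
def pencil (a b : ℂ) : W3 α D →L[ℂ] W3 α D := pencilOf (opT3 α D) a b

theorem coe_pencil_apply (a b : ℂ) (c : W3 α D) :
    (pencil α D a b c : JSpace α) =
      a • energyOp α D.host c + b • ((c : JSpace α) - energyOp α D.host c) := by
  change a • ((1 / 2 : ℂ) • (c : JSpace α) + (opT3 α D c : JSpace α)) +
    b • ((1 / 2 : ℂ) • (c : JSpace α) - (opT3 α D c : JSpace α)) = _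
  rw [coe_opT3_apply, add_sub_cancel, sub_sub_eq_add_sub, ← add_smul]
  norm_num

variable {α D} in
theorem isUnit_pencil {a b : ℂ} (hab : a = b → a ≠ 0)
    (h : ∀ μ ∈ resonances α D, a * (1 / 2 + μ) + b * (1 / 2 - μ) ≠ 0) :
    IsUnit (pencil α D a b) :=
  isUnit_pencilOf (isSelfAdjoint_opT3 α D) hab h

variable {α D} in
theorem ne_zero_of_isUnit_pencil {a b : ℂ} (hab : a ≠ b) (h : IsUnit (pencil α D a b)) {μ : ℝ}
    (hμ : μ ∈ resonances α D) : a * (1 / 2 + μ) + b * (1 / 2 - μ) ≠ 0 :=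
  ne_zero_of_isUnit_pencilOf hab h hμ

/-- The symbol k(1/2 + μ) + (1/2 - μ) vanishes exactly at k = (μ - 1/2)/(μ + 1/2); for μ = -1/2 it
equals 1 and excludes nothing. -/
theorem notMem_excludedSet_iff {k : ℂ} :
    k ∉ excludedSet α D ↔ k ≠ 0 ∧ IsUnit (pencil α D k 1) := by
  constructor
  · intro h
    have hk : k ≠ 0 := fun h0 => h (Or.inl h0)
    refine ⟨hk, isUnit_pencil (fun _ => hk) fun μ hμ h0 => ?_⟩
    have hμ' : μ ≠ -1 / 2 := by
      rintro rfl
      push_cast at h0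
      norm_num at h0
    refine h (Or.inr ⟨μ, hμ, hμ', ?_⟩)
    have : (μ : ℂ) + 1 / 2 ≠ 0 := by
      intro h1
      apply hμ'
      have : (μ : ℂ) = ((-1 / 2 : ℝ) : ℂ) := by push_cast; linear_combination h1
      exact_mod_cast this
    push_cast
    rw [eq_div_iff this]
    linear_combination h0
  · rintro ⟨hk, hu⟩ (h0 | ⟨μ, hμ, hμ', h0⟩)
    · exact hk h0
    · have : (μ : ℂ) + 1 / 2 ≠ 0 := by
        intro h1
        apply hμ'
        have : (μ : ℂ) = ((-1 / 2 : ℝ) : ℂ) := by push_cast; linear_combination h1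
        exact_mod_cast this
      push_cast at h0
      rw [eq_div_iff this] at h0
      refine ne_zero_of_isUnit_pencil (fun h1 => ?_) hu hμ (by linear_combination h0)
      rw [h1] at h0
      have : (1 : ℂ) = 0 := by linear_combination h0
      exact one_ne_zero this

/-- The operator `z P₁ + P₂ + z [(1/2 + T) + z (1/2 - T)]⁻¹ P₃`, which is `T_k⁻¹` for `z = 1/k`. -/
def solutionOp (z : ℂ) : JSpace α →L[ℂ] JSpace α :=
  z • (W1 α D).starProjection + (W2 α D).starProjection +
    z • ((W3 α D).subtypeL ∘L Ring.inverse (pencil α D 1 z) ∘L (W3 α D).orthogonalProjectionOnto)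

theorem opA_eq (z : ℂ) : opA α D z = emb α ∘L solutionOp α D z ∘L invLaplacian α := by
  have := pencilOf_one_left (opT3 α D) z
  rw [opA, solutionOp, pencil, this]

variable {α D} in
theorem solutionOp_apply (z : ℂ) {a b : JSpace α} (ha : a ∈ W1 α D) (hb : b ∈ W2 α D)
    (c : W3 α D) : solutionOp α D z (a + b + c) =
      z • a + b + ((z • Ring.inverse (pencil α D 1 z) c : W3 α D) : JSpace α) := by
  change z • (W1 α D).starProjection (a + b + c) + (W2 α D).starProjection (a + b + c) +
    z • ((Ring.inverse (pencil α D 1 z) ((W3 α D).orthogonalProjectionOnto (a + b + c)) :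
      W3 α D) : JSpace α) = _
  rw [starProjection_W1 ha hb, starProjection_W2 ha hb, orthogonalProjectionOnto_W3 ha hb]
  rfl

variable {α D} in
theorem opTk_apply_add (k : ℂ) {a b : JSpace α} (ha : a ∈ W1 α D) (hb : b ∈ W2 α D)
    (c : W3 α D) : opTk α D k (a + b + c) = k • a + b + (pencil α D k 1 c : JSpace α) := by
  rw [opTk_apply, coe_pencil_apply, map_add, map_add, (mem_W1 α D).1 ha, (mem_W2 α D).1 hb,
    one_smul, add_zero, smul_add]
  abel

variable {α D} in
theorem pencil_inv {k : ℂ} (hk : k ≠ 0) : pencil α D 1 k⁻¹ = k⁻¹ • pencil α D k 1 :=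
  pencilOf_inv (opT3 α D) hk

variable {α D} in
theorem isUnit_pencil_inv {k : ℂ} (hk : k ∉ excludedSet α D) : IsUnit (pencil α D 1 k⁻¹) := by
  obtain ⟨h0, hu⟩ := (notMem_excludedSet_iff α D).1 hk
  rw [pencil_inv h0]
  exact (isUnit_smul_iff_of_ne_zero (inv_ne_zero h0)).2 hu

variable {α D} in
-- The blocks k, 1, `pencil k 1` meet 1/k, 1 and k⁻¹ times the inverse of `pencil 1 k⁻¹`, and
-- `pencil 1 k⁻¹` is k⁻¹ times `pencil k 1`.
theorem opTk_mul_solutionOp {k : ℂ} (hk : k ∉ excludedSet α D) :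
    opTk α D k * solutionOp α D k⁻¹ = 1 ∧ solutionOp α D k⁻¹ * opTk α D k = 1 := by
  obtain ⟨h0, hu⟩ := (notMem_excludedSet_iff α D).1 hk
  have hu' := isUnit_pencil_inv hk
  have e1 : ∀ c, pencil α D k 1 (k⁻¹ • Ring.inverse (pencil α D 1 k⁻¹) c) = c := fun c => by
    rw [map_smul]
    have := DFunLike.congr_fun (Ring.mul_inverse_cancel _ hu') c
    conv at this => enter [1, 1, 1]; rw [pencil_inv h0]
    exact this
  have e2 : ∀ c, k⁻¹ • Ring.inverse (pencil α D 1 k⁻¹) (pencil α D k 1 c) = c := fun c => by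
    rw [← map_smul]
    have := DFunLike.congr_fun (Ring.inverse_mul_cancel _ hu') c
    conv at this => enter [1, 1, 2]; rw [pencil_inv h0]
    exact this
  constructor
  · ext1 x
    obtain ⟨a, ha, b, hb, c, rfl⟩ := exists_decomposition α D x
    change opTk α D k (solutionOp α D k⁻¹ (a + b + c)) = a + b + c
    rw [solutionOp_apply _ ha hb, opTk_apply_add _ (Submodule.smul_mem _ _ ha) hb, smul_smul,
      mul_inv_cancel₀ h0, one_smul, e1]
  · ext1 x
    obtain ⟨a, ha, b, hb, c, rfl⟩ := exists_decomposition α D x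
    change solutionOp α D k⁻¹ (opTk α D k (a + b + c)) = a + b + c
    rw [opTk_apply_add _ ha hb, solutionOp_apply _ (Submodule.smul_mem _ _ ha) hb, smul_smul,
      inv_mul_cancel₀ h0, one_smul, e2]

variable {α D} in
theorem isUnit_opTk {k : ℂ} (hk : k ∉ excludedSet α D) : IsUnit (opTk α D k) :=
  ⟨⟨_, _, (opTk_mul_solutionOp hk).1, (opTk_mul_solutionOp hk).2⟩, rfl⟩

variable {α D} in
theorem inverse_opTk {k : ℂ} (hk : k ∉ excludedSet α D) :
    Ring.inverse (opTk α D k) = solutionOp α D k⁻¹ :=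
  Ring.inverse_unit ⟨_, _, (opTk_mul_solutionOp hk).1, (opTk_mul_solutionOp hk).2⟩

end Decomposition

/-! ### Holomorphy in k off the excluded set. -/

section Holomorphy

theorem analyticAt_inverse_comp {B : Type*} [NormedRing B] [NormedAlgebra ℂ B] [CompleteSpace B]
    {f : ℂ → B} {z : ℂ} (hf : AnalyticAt ℂ f z) (h : IsUnit (f z)) :
    AnalyticAt ℂ (fun z => Ring.inverse (f z)) z := by
  obtain ⟨u, hu⟩ := h
  exact AnalyticAt.fun_comp (by rw [← hu]; exact analyticAt_inverse u) hf

theorem analyticAt_comp_comp {E F G K : Type*} [NormedAddCommGroup E] [NormedSpace ℂ E]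
    [NormedAddCommGroup F] [NormedSpace ℂ F] [NormedAddCommGroup G] [NormedSpace ℂ G]
    [NormedAddCommGroup K] [NormedSpace ℂ K] {f : ℂ → F →L[ℂ] G} {z : ℂ}
    (hf : AnalyticAt ℂ f z) (L : G →L[ℂ] K) (R : E →L[ℂ] F) :
    AnalyticAt ℂ (fun z => L ∘L f z ∘L R) z :=
  (((ContinuousLinearMap.compL ℂ E G K L) ∘L
    (ContinuousLinearMap.compL ℂ E F G).flip R).analyticAt _).comp hf

theorem analyticAt_smul_add {E : Type*} [NormedAddCommGroup E] [NormedSpace ℂ E] (x y : E) (z : ℂ) :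
    AnalyticAt ℂ (fun z : ℂ => z • x + y) z :=
  (analyticAt_id.smul analyticAt_const).add analyticAt_const

variable (α : brillouinZone) (D : Inclusion)

theorem analyticAt_opTk (k : ℂ) : AnalyticAt ℂ (fun k => opTk α D k) k :=
  analyticAt_smul_add (energyOp α D.host) (energyOp α D.carrier) k

theorem isOpen_compl_excludedSet : IsOpen (excludedSet α D)ᶜ := by
  have : (excludedSet α D)ᶜ = {k | k ≠ 0} ∩ {k | IsUnit (pencil α D k 1)} := by
    ext k
    exact notMem_excludedSet_iff α D
  rw [this]
  exact isOpen_ne.inter (isOpen_setOf_isUnit_pencilOf (opT3 α D) 1)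

variable {α D} in
theorem analyticAt_inverse_opTk {k : ℂ} (hk : k ∉ excludedSet α D) :
    AnalyticAt ℂ (fun k => Ring.inverse (opTk α D k)) k :=
  analyticAt_inverse_comp (analyticAt_opTk α D k) (isUnit_opTk hk)

variable {α D} in
theorem analyticAt_opB {k : ℂ} (hk : k ∉ excludedSet α D) :
    AnalyticAt ℂ (fun k => opB α D k) k :=
  analyticAt_comp_comp (analyticAt_inverse_opTk hk) (emb α) (invLaplacian α)

end Holomorphy

/-! ### Bloch eigenvalues and the spectrum of A(1/k). -/

section BlochSpectrum

variable {α : brillouinZone} {D : Inclusion} {k : ℂ}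

theorem opA_inv (hk : k ∉ excludedSet α D) : opA α D k⁻¹ = opB α D k := by
  rw [opA_eq, opB, inverse_opTk hk]

theorem isCompactOperator_emb_comp (X : L2Y →L[ℂ] JSpace α) :
    IsCompactOperator (emb α ∘L X) :=
  (isCompactOperator_emb α).comp_clm X

theorem isCompactOperator_opA (z : ℂ) : IsCompactOperator (opA α D z) := by
  rw [opA_eq]; exact isCompactOperator_emb_comp _

/-- Both sides of the weak equation are represented by operators in the inner product of J_#. -/
theorem mem_blochEigenspace {ξ : ℂ} {h : JSpace α} :
    h ∈ blochEigenspace α D k ξ ↔ opTk α D k h = ξ • invLaplacian α (emb α h) := by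
  have h1 : h ∈ blochEigenspace α D k ξ ↔ ∀ w : JSpace α,
      blochForm α D k h w = ξ * ∫ x in unitCell, inner ℂ (emb α w x) (emb α h x) := Iff.rfl
  rw [h1]
  refine ⟨fun h2 => ext_inner_left ℂ fun w => ?_, fun h2 w => ?_⟩
  · rw [inner_opTk, h2, inner_smul_right, inner_invLaplacian]
  · rw [← inner_opTk, h2, inner_smul_right, inner_invLaplacian]

theorem mem_blochEigenspace_iff_eq (hk : k ∉ excludedSet α D) {ξ : ℂ} {h : JSpace α} :
    h ∈ blochEigenspace α D k ξ ↔
      h = ξ • Ring.inverse (opTk α D k) (invLaplacian α (emb α h)) := by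
  have hu := isUnit_opTk hk
  have e1 : ∀ x, Ring.inverse (opTk α D k) (opTk α D k x) = x := fun x =>
    DFunLike.congr_fun (Ring.inverse_mul_cancel _ hu) x
  have e2 : ∀ x, opTk α D k (Ring.inverse (opTk α D k) x) = x := fun x =>
    DFunLike.congr_fun (Ring.mul_inverse_cancel _ hu) x
  rw [mem_blochEigenspace]
  constructor
  · intro h1
    rw [← map_smul, ← h1, e1]
  · intro h1
    conv_lhs => rw [h1]
    rw [map_smul, e2]

theorem map_blochEigenspace (hk : k ∉ excludedSet α D) {ξ : ℂ} (hξ : ξ ≠ 0) :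
    (blochEigenspace α D k ξ).map (emb α : JSpace α →ₗ[ℂ] L2Y) =
      eigSpace (opA α D k⁻¹) ξ⁻¹ := by
  rw [opA_inv hk]
  ext u
  rw [eigSpace, Module.End.mem_eigenspace_iff]
  change _ ↔ emb α (Ring.inverse (opTk α D k) (invLaplacian α u)) = ξ⁻¹ • u
  constructor
  · rintro ⟨h, hh, rfl⟩
    have h1 := (mem_blochEigenspace_iff_eq hk).1 hh
    change emb α (Ring.inverse (opTk α D k) (invLaplacian α (emb α h))) = ξ⁻¹ • emb α h
    conv_rhs => rw [h1]
    rw [map_smul, smul_smul, inv_mul_cancel₀ hξ, one_smul]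
  · intro hu
    have h1 : emb α (ξ • Ring.inverse (opTk α D k) (invLaplacian α u)) = u := by
      rw [map_smul, hu, smul_smul, mul_inv_cancel₀ hξ, one_smul]
    -- An eigenvector u ∈ L² for ξ⁻¹ lies in J_# because u = ξ A(1/k)u and the range of A(1/k) does;
    -- this is its preimage.
    refine ⟨ξ • Ring.inverse (opTk α D k) (invLaplacian α u),
      (mem_blochEigenspace_iff_eq hk).2 ?_, h1⟩
    rw [h1]

theorem emb_eq_zero_of_mem_blochEigenspace (hk : k ∉ excludedSet α D) {ξ : ℂ} {h : JSpace α}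
    (hh : h ∈ blochEigenspace α D k ξ) (h0 : emb α h = 0) : h = 0 := by
  rw [(mem_blochEigenspace_iff_eq hk).1 hh, h0, map_zero, map_zero, smul_zero]

/-- Invertibility of T_k excludes ξ = 0; otherwise compactness turns a nonzero spectral value into
an eigenvalue, and the embedding loses no Bloch solution. -/
theorem isBlochEigenvalue_iff (hk : k ∉ excludedSet α D) (ξ : ℂ) :
    IsBlochEigenvalue α D k ξ ↔ ξ ≠ 0 ∧ ξ⁻¹ ∈ spectrum ℂ (opA α D k⁻¹) := by
  by_cases hξ : ξ = 0
  · subst hξ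
    refine iff_of_false (fun h => h ?_) fun h => h.1 rfl
    rw [eq_bot_iff]
    intro h hh
    rw [(mem_blochEigenspace_iff_eq hk).1 hh, zero_smul]
    exact zero_mem _
  · rw [← (isCompactOperator_opA k⁻¹).hasEigenvalue_iff_mem_spectrum (inv_ne_zero hξ)]
    change _ ↔ _ ∧ eigSpace (opA α D k⁻¹) ξ⁻¹ ≠ ⊥
    rw [← map_blochEigenspace hk hξ, IsBlochEigenvalue]
    refine ⟨fun h => ⟨hξ, fun h1 => h ?_⟩, fun h h1 => h.2 (by rw [h1, Submodule.map_bot])⟩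
    rw [eq_bot_iff]
    intro x hx
    refine emb_eq_zero_of_mem_blochEigenspace hk hx ?_
    have : emb α x ∈ (blochEigenspace α D k ξ).map (emb α : JSpace α →ₗ[ℂ] L2Y) := ⟨x, hx, rfl⟩
    rwa [h1] at this

theorem finite_blochEigenvalues (hk : k ∉ excludedSet α D) (R : ℝ) :
    {ξ : ℂ | IsBlochEigenvalue α D k ξ ∧ ‖ξ‖ ≤ R}.Finite := by
  -- The value |R| + 1 keeps the threshold positive for every real R; the reciprocals of the
  -- eigenvalues in question stay above it.
  have hε : 0 < (|R| + 1)⁻¹ := by positivity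
  refine (((isCompactOperator_opA (α := α) (D := D) k⁻¹).finite_spectrum hε).image fun b => b⁻¹).subset ?_
  rintro ξ ⟨h1, h2⟩
  obtain ⟨h3, h4⟩ := (isBlochEigenvalue_iff hk ξ).1 h1
  refine ⟨ξ⁻¹, ⟨h4, ?_⟩, inv_inv ξ⟩
  rw [norm_inv]
  exact inv_anti₀ (norm_pos_iff.2 h3) (by linarith [le_abs_self R])

theorem finiteDimensional_rootSpace_opA (z : ℂ) {b : ℂ} (hb : b ≠ 0) :
    FiniteDimensional ℂ (rootSpace (opA α D z) b) :=
  ((isCompactOperator_opA z).exists_rieszProjection hb).1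

theorem eigSpace_le_rootSpace (A : L2Y →L[ℂ] L2Y) (b : ℂ) : eigSpace A b ≤ rootSpace A b :=
  Module.End.eigenspace_le_maxGenEigenspace

theorem finiteDimensional_blochEigenspace (hk : k ∉ excludedSet α D) {ξ : ℂ} (hξ : ξ ≠ 0) :
    FiniteDimensional ℂ (blochEigenspace α D k ξ) := by
  have h1 := finiteDimensional_rootSpace_opA (α := α) (D := D) k⁻¹ (inv_ne_zero hξ)
  have h2 : ∀ x : blochEigenspace α D k ξ, emb α x ∈ rootSpace (opA α D k⁻¹) ξ⁻¹ := fun x => by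
    apply eigSpace_le_rootSpace
    rw [← map_blochEigenspace hk hξ]
    exact ⟨x, x.2, rfl⟩
  refine Module.Finite.of_injective
    (((emb α : JSpace α →ₗ[ℂ] L2Y) ∘ₗ (blochEigenspace α D k ξ).subtype).codRestrict _ h2) ?_
  rw [injective_iff_map_eq_zero]
  intro x hx
  exact Subtype.ext (emb_eq_zero_of_mem_blochEigenspace hk x.2 (congrArg Subtype.val hx))

end BlochSpectrum

end

end PhotonicCrystal

namespace PhotonicCrystal
noncomputable section
open MeasureTheory Set Filter Topology
open scoped ComplexConjugate ContDiff

/-! ### Scalar inequalities behind z* and r*. -/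

section Numbers

variable {m c d : ℝ} {z : ℂ}

/-- For m ≤ μ ≤ 1/2 the ratio (1/2 + μ)/(1/2 - μ) is smallest at m. For μ > 1/2 it is enough that
‖z‖ < 1, which is where m < 0 enters. -/
theorem pencil_symbol_ne_zero (hm : -1 / 2 < m) (hm0 : m < 0)
    (hz : ‖z‖ < (1 / 2 + m) / (1 / 2 - m)) {μ : ℝ} (hμ : m ≤ μ) :
    1 * (1 / 2 + (μ : ℂ)) + z * (1 / 2 - μ) ≠ 0 := by
  intro h
  have h1 : 0 < 1 / 2 - m := by linarith
  rw [lt_div_iff₀ h1] at hz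
  have h2 : ((1 / 2 + μ : ℝ) : ℂ) = -(z * ((1 / 2 - μ : ℝ) : ℂ)) := by
    push_cast; linear_combination h
  have h3 := congrArg norm h2
  rw [norm_neg, norm_mul, Complex.norm_real, Complex.norm_real, Real.norm_eq_abs,
    Real.norm_eq_abs, abs_of_pos (by linarith)] at h3
  have h0 := norm_nonneg z
  rcases abs_cases (1 / 2 - μ) with ⟨h4, -⟩ | ⟨h4, -⟩ <;> rw [h4] at h3 <;> nlinarith

/-- If `r = c d Z / (1/h + c d)` then `|z| < r` gives `|z| / (h (Z - |z|) c) < d`. -/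
theorem radius_bound {h Z t : ℝ} (hh : 0 < h) (hc : 0 < c) (hd : 0 < d) (hZ : 0 < Z)
    (ht : t < c * d * Z / (1 / h + c * d)) :
    t < Z ∧ t < h * (Z - t) * c * d := by
  have h1 : 0 < 1 / h + c * d := by positivity
  rw [lt_div_iff₀ h1] at ht
  have h2 : t < h * (Z - t) * c * d := by
    have : h * (t * (1 / h + c * d)) < h * (c * d * Z) := mul_lt_mul_of_pos_left ht hh
    have e : h * (t * (1 / h + c * d)) = t + h * t * c * d := by field_simp
    nlinarith
  refine ⟨?_, h2⟩
  by_contra hn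
  push Not at hn
  have : h * (Z - t) * c * d ≤ 0 := by
    have : 0 ≤ h * (t - Z) * c * d := by
      have := sub_nonneg.2 hn
      positivity
    nlinarith
  linarith

end Numbers

/-! ### Analyticity of the inverse pencil. -/

section PencilInverse

variable {V : Type*} [NormedAddCommGroup V] [InnerProductSpace ℂ V] [CompleteSpace V]

theorem analyticAt_inverse_pencilOf {S : V →L[ℂ] V} {z : ℂ} (h : IsUnit (pencilOf S 1 z)) :
    AnalyticAt ℂ (fun z => Ring.inverse (pencilOf S 1 z)) z :=
  analyticAt_inverse_comp (analyticAt_pencilOf_right S 1 z) h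

theorem analyticAt_smul_add_add_smul {E : Type*} [NormedAddCommGroup E] [NormedSpace ℂ E]
    (x y : E) {f : ℂ → E} {z : ℂ} (hf : AnalyticAt ℂ f z) :
    AnalyticAt ℂ (fun z => z • x + y + z • f z) z :=
  (analyticAt_smul_add x y z).add (analyticAt_id.smul hf)

theorem bddBelow_setOf_mem_spectrum (S : V →L[ℂ] V) :
    BddBelow {μ : ℝ | (μ : ℂ) ∈ spectrum ℂ S} := by
  -- The factor ‖1‖ is kept because the space may be trivial.
  refine ⟨-(‖S‖ * ‖(1 : V →L[ℂ] V)‖), fun μ hμ => ?_⟩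
  have h1 : ‖(μ : ℂ)‖ ≤ ‖S‖ * ‖(1 : V →L[ℂ] V)‖ := spectrum.norm_le_norm_mul_of_mem hμ
  rw [Complex.norm_real] at h1
  exact (abs_le.1 h1).1

end PencilInverse

/-! ### Quantitative bounds for self-adjoint operators. -/

section SelfAdjoint

variable {V : Type*} [NormedAddCommGroup V] [InnerProductSpace ℂ V] [CompleteSpace V]
  {S : V →L[ℂ] V}

/-- In the C*-algebra of operators a lower bound for the spectrum is an operator inequality, hence
one between quadratic forms. -/
theorem inner_apply_ge_of_spectrum (hS : IsSelfAdjoint S) {m : ℝ}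
    (h : ∀ μ : ℝ, (μ : ℂ) ∈ spectrum ℂ S → m ≤ μ) (v : V) :
    m * ‖v‖ ^ 2 ≤ RCLike.re (inner ℂ v (S v)) := by
  have h1 : algebraMap ℝ (V →L[ℂ] V) m ≤ S :=
    (algebraMap_le_iff_le_spectrum hS).2 fun μ hμ =>
      h μ ((spectrum.algebraMap_mem_iff ℂ (r := μ)).2 hμ)
  rw [ContinuousLinearMap.le_def] at h1
  have h2 := (RCLike.nonneg_iff.1 (h1.inner_nonneg_right v)).1
  have h3 : (S - algebraMap ℝ (V →L[ℂ] V) m) v = S v - ((m : ℝ) : ℂ) • v := by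
    change S v - (algebraMap ℝ (V →L[ℂ] V) m) v = _
    rw [Algebra.algebraMap_eq_smul_one]
    congr 1
  rw [h3, inner_sub_right, inner_smul_right, map_sub, inner_self_eq_norm_sq_to_K] at h2
  have h4 : RCLike.re (((m : ℝ) : ℂ) * ((‖v‖ : ℂ)) ^ 2) = m * ‖v‖ ^ 2 := by
    rw [← Complex.ofReal_pow, ← Complex.ofReal_mul]; exact Complex.ofReal_re _
  have h5 : RCLike.re (((m : ℝ) : ℂ) * (((‖v‖ : ℝ) : ℂ)) ^ 2) ≤ RCLike.re (inner ℂ v (S v)) :=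
    sub_nonneg.1 h2
  rwa [h4] at h5

/-- A lower bound for the pencil inside the disk of radius `(1/2 + m) / (1/2 - m)`. -/
theorem le_norm_pencilOf (hS : IsSelfAdjoint S) {m : ℝ}
    (h : ∀ μ : ℝ, (μ : ℂ) ∈ spectrum ℂ S → m ≤ μ)
    (h' : ∀ v, RCLike.re (inner ℂ v (S v)) ≤ 1 / 2 * ‖v‖ ^ 2) (z : ℂ) (v : V) :
    ((1 / 2 + m) - ‖z‖ * (1 / 2 - m)) * ‖v‖ ≤ ‖pencilOf S 1 z v‖ := by
  rcases eq_or_ne v 0 with rfl | hv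
  · simp
  have hv : 0 < ‖v‖ := norm_pos_iff.2 hv
  refine le_of_mul_le_mul_right ?_ hv
  have h1 := inner_apply_ge_of_spectrum hS h v
  have h2 := h' v
  set s : ℝ := RCLike.re (inner ℂ v (S v)) with hs
  have h3 : inner ℂ v (S v) = (s : ℂ) := by
    have := (hS.isSymmetric.coe_re_inner_self_apply v)
    exact this.symm
  -- Numerical range argument: with m‖v‖² ≤ s ≤ ‖v‖²/2 the first summand dominates, and
  -- Cauchy–Schwarz passes to the norm.
  have h4 : inner ℂ v (pencilOf S 1 z v) =
      ((1 / 2 * ‖v‖ ^ 2 + s : ℝ) : ℂ) + z * ((1 / 2 * ‖v‖ ^ 2 - s : ℝ) : ℂ) := by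
    have e : pencilOf S 1 z v = ((1 / 2 : ℂ) • v + S v) + z • ((1 / 2 : ℂ) • v - S v) := by
      rw [pencilOf_one_left]; rfl
    rw [e, inner_add_right, inner_smul_right, inner_add_right, inner_sub_right, inner_smul_right,
      h3, inner_self_eq_norm_sq_to_K]
    push_cast
    rfl
  have h5 : ‖inner ℂ v (pencilOf S 1 z v)‖ ≤ ‖v‖ * ‖pencilOf S 1 z v‖ := norm_inner_le_norm _ _
  rw [h4] at h5
  have h6 := norm_sub_le_norm_add ((1 / 2 * ‖v‖ ^ 2 + s : ℝ) : ℂ)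
    (z * ((1 / 2 * ‖v‖ ^ 2 - s : ℝ) : ℂ))
  rw [norm_mul, Complex.norm_real, Complex.norm_real, Real.norm_eq_abs, Real.norm_eq_abs,
    abs_of_nonneg (by linarith : 0 ≤ 1 / 2 * ‖v‖ ^ 2 - s)] at h6
  have h7 := le_abs_self (1 / 2 * ‖v‖ ^ 2 + s)
  have h8 : ‖z‖ * (1 / 2 * ‖v‖ ^ 2 - s) ≤ ‖z‖ * ((1 / 2 - m) * ‖v‖ ^ 2) :=
    mul_le_mul_of_nonneg_left (by linarith) (norm_nonneg z)
  nlinarith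

theorem norm_inverse_apply_le {E : Type*} [NormedAddCommGroup E] [NormedSpace ℂ E]
    {T : E →L[ℂ] E} (hT : IsUnit T) {κ : ℝ} (hκ : 0 < κ)
    (h : ∀ v, κ * ‖v‖ ≤ ‖T v‖) (v : E) : ‖Ring.inverse T v‖ ≤ κ⁻¹ * ‖v‖ := by
  have h1 : T (Ring.inverse T v) = v := DFunLike.congr_fun (Ring.mul_inverse_cancel T hT) v
  rw [le_inv_mul_iff₀ hκ]
  conv_rhs => rw [← h1]
  exact h _

/-- The resolvent is normal, so its norm is its spectral radius, and its spectrum consists of the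
numbers 1/(ζ - b) with b in the spectrum of S. -/
theorem norm_resolvent_le (hS : IsSelfAdjoint S) {ζ : ℂ} (hζ : ζ ∈ resolventSet ℂ S) {d : ℝ}
    (hd : 0 < d) (h : ∀ b ∈ spectrum ℂ S, d ≤ ‖ζ - b‖) : ‖resolvent S ζ‖ ≤ d⁻¹ := by
  have hu : IsUnit (algebraMap ℂ (V →L[ℂ] V) ζ - S) := hζ
  obtain ⟨u, hu⟩ := hu
  have hr : resolvent S ζ = ((u⁻¹ : (V →L[ℂ] V)ˣ) : V →L[ℂ] V) := by
    rw [resolvent, ← hu, Ring.inverse_unit]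
  have hn : IsStarNormal (u : V →L[ℂ] V) := by
    rw [hu]
    refine ⟨?_⟩
    have h1 : star (algebraMap ℂ (V →L[ℂ] V) ζ - S) = algebraMap ℂ (V →L[ℂ] V) (star ζ) - S := by
      rw [star_sub, hS.star_eq, algebraMap_star_comm]
    rw [h1]
    exact ((Algebra.commute_algebraMap_left _ _).sub_right
      (Algebra.commute_algebraMap_left _ _)).sub_left
        ((Algebra.commute_algebraMap_right _ _).sub_right (Commute.refl S))
  have hn' : IsStarNormal ((u⁻¹ : (V →L[ℂ] V)ˣ) : V →L[ℂ] V) := by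
    refine ⟨?_⟩
    have h1 : Commute (star u) u := Units.ext hn.star_comm_self
    have h2 : Commute (star u⁻¹) u⁻¹ := by
      rw [star_inv]
      exact h1.inv_inv
    exact congrArg Units.val h2
  rw [hr]
  have h1 := IsStarNormal.spectralRadius_eq_nnnorm ((u⁻¹ : (V →L[ℂ] V)ˣ) : V →L[ℂ] V)
  have h2 : spectralRadius ℂ ((u⁻¹ : (V →L[ℂ] V)ˣ) : V →L[ℂ] V) ≤ (d⁻¹.toNNReal : ENNReal) := by
    refine iSup₂_le fun b hb => ?_
    have hb0 : b ≠ 0 := by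
      rintro rfl
      exact spectrum.zero_mem_iff ℂ |>.1 hb u⁻¹.isUnit
    have h3 : b⁻¹ ∈ spectrum ℂ (u : V →L[ℂ] V) := by
      have := (spectrum.inv₀_mem_inv_iff (R := ℂ) (r := b⁻¹) (a := u)).1
      rw [inv_inv] at this
      exact this hb
    rw [hu] at h3
    have h4 : ζ - b⁻¹ ∈ spectrum ℂ S := by
      rw [spectrum.mem_iff] at h3 ⊢
      intro h5
      refine h3 ?_
      have e : algebraMap ℂ (V →L[ℂ] V) b⁻¹ - (algebraMap ℂ (V →L[ℂ] V) ζ - S) =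
          -(algebraMap ℂ (V →L[ℂ] V) (ζ - b⁻¹) - S) := by
        rw [map_sub]; abel
      rw [e]
      exact h5.neg
    have h5 := h _ h4
    rw [sub_sub_cancel, norm_inv] at h5
    have h6 : ‖b‖ ≤ d⁻¹ := by
      rw [← inv_inv ‖b‖]
      exact inv_anti₀ hd h5
    rw [ENNReal.coe_le_coe, ← NNReal.coe_le_coe, Real.coe_toNNReal _ (inv_pos.2 hd).le]
    exact h6
  rw [h1, ENNReal.coe_le_coe, ← NNReal.coe_le_coe, Real.coe_toNNReal _ (inv_pos.2 hd).le] at h2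
  exact h2

/-- Factor ζ - T = (ζ - S)(1 - (ζ - S)⁻¹(T - S)); the second factor is a Neumann series. T need not
be self-adjoint. -/
theorem mem_resolventSet_of_norm_sub_lt (hS : IsSelfAdjoint S) {T : V →L[ℂ] V} {ζ : ℂ}
    (hζ : ζ ∈ resolventSet ℂ S) {d : ℝ} (hd : 0 < d) (h : ∀ b ∈ spectrum ℂ S, d ≤ ‖ζ - b‖)
    (hT : ‖T - S‖ < d) : ζ ∈ resolventSet ℂ T := by
  have h1 := norm_resolvent_le hS hζ hd h
  have h2 : ‖resolvent S ζ * (T - S)‖ < 1 := by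
    refine (norm_mul_le _ _).trans_lt ?_
    calc _ ≤ d⁻¹ * ‖T - S‖ := by gcongr
      _ < d⁻¹ * d := by gcongr
      _ = 1 := inv_mul_cancel₀ hd.ne'
  have hu : IsUnit (algebraMap ℂ (V →L[ℂ] V) ζ - S) := hζ
  have h3 := hu.mul (isUnit_one_sub_of_norm_lt_one h2)
  rw [mul_sub, mul_one, resolvent, ← mul_assoc, Ring.mul_inverse_cancel _ hu, one_mul,
    sub_sub, add_sub_cancel] at h3
  exact h3

theorem maxGenEigenspace_eq_eigenspace (hS : IsSelfAdjoint S) (b : ℂ) :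
    Module.End.maxGenEigenspace (S : V →ₗ[ℂ] V) b = Module.End.eigenspace (S : V →ₗ[ℂ] V) b :=
  hS.isSymmetric.isFinitelySemisimple.maxGenEigenspace_eq_eigenspace b

end SelfAdjoint

/-! ### Distance from the contour to the spectrum. -/

section ContourDist

variable {γ : ℝ → ℂ} {K : Set ℂ}

theorem contourDist_le {ζ b : ℂ} (hζ : ζ ∈ γ '' Icc 0 1)
    (hb : b ∈ K) : contourDist γ K ≤ ‖ζ - b‖ := by
  have h1 : BddBelow ((fun ζ => Metric.infDist ζ K) '' (γ '' Icc 0 1)) := by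
    refine ⟨0, ?_⟩
    rintro _ ⟨x, -, rfl⟩
    exact Metric.infDist_nonneg
  refine (csInf_le h1 ⟨ζ, hζ, rfl⟩).trans ?_
  rw [← dist_eq_norm]
  exact Metric.infDist_le_dist_of_mem hb

theorem contourDist_pos (hγ : IsContour γ) (hK : IsClosed K) (hne : K.Nonempty)
    (h : Disjoint (γ '' Icc 0 1) K) : 0 < contourDist γ K := by
  have h1 : (γ '' Icc 0 1).Nonempty := ⟨γ 0, 0, by simp, rfl⟩
  obtain ⟨ζ, hζ, h2⟩ := hγ.isCompact_image.exists_isMinOn h1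
    (Metric.continuous_infDist_pt K).continuousOn
  refine lt_of_lt_of_le ((hK.notMem_iff_infDist_pos hne).1 (disjoint_left.1 h hζ))
    (le_csInf (h1.image _) ?_)
  rintro _ ⟨x, hx, rfl⟩
  exact h2 hx

end ContourDist

end

end PhotonicCrystal

namespace PhotonicCrystal
noncomputable section
open MeasureTheory Set Filter Topology
open scoped ComplexConjugate ContDiff

/-! ### The perturbation estimate and the radius r*. -/

section Radius

variable {α : brillouinZone} {D : Inclusion}

variable (α) in
/-- The constant `c` of the Poincaré inequality `c ‖u‖² ≤ ‖∇×u‖²` on `J_#`. -/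
def waveConst : ℝ := if α.1 = 0 then 4 * Real.pi ^ 2 else ∑ j, α.1 j ^ 2

variable (α) in
theorem norm_emb_le : ‖emb α‖ ≤ (Real.sqrt (waveConst α))⁻¹ :=
  LinearMap.mkContinuous_norm_le _ (inv_nonneg.2 (Real.sqrt_nonneg _)) _

variable (α) in
theorem norm_invLaplacian_le : ‖invLaplacian α‖ ≤ (Real.sqrt (waveConst α))⁻¹ := by
  have : ‖invLaplacian α‖ = ‖emb α‖ := LinearIsometryEquiv.norm_map _ _
  rw [this]
  exact norm_emb_le α

theorem rStar_eq (d : ℝ) : rStar α D d = waveConst α * d * |zStar α D| /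
    (1 / (1 / 2 - muMinus α D) + waveConst α * d) := by
  rw [rStar, waveConst]
  split_ifs <;> rfl

theorem abs_zStar (h : -1 / 2 < muMinus α D) (h0 : muMinus α D < 0) :
    |zStar α D| = (1 / 2 + muMinus α D) / (1 / 2 - muMinus α D) := by
  rw [zStar, abs_div, abs_of_pos (by linarith), abs_of_neg (by linarith), neg_sub, add_comm]

theorem half_sub_mul_abs_zStar (h : -1 / 2 < muMinus α D) (h0 : muMinus α D < 0) :
    (1 / 2 - muMinus α D) * |zStar α D| = 1 / 2 + muMinus α D := by
  rw [abs_zStar h h0]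
  exact mul_div_cancel₀ _ (by linarith)

theorem muMinus_le {μ : ℝ} (hμ : μ ∈ resonances α D) : muMinus α D ≤ μ :=
  csInf_le (bddBelow_setOf_mem_spectrum (opT3 α D)) hμ

/-- 1/2 - T is the energy in D, which is nonnegative. -/
theorem inner_opT3_le (c : W3 α D) :
    RCLike.re (inner ℂ c (opT3 α D c)) ≤ 1 / 2 * ‖c‖ ^ 2 := by
  have h1 : inner ℂ c (opT3 α D c) = inner ℂ (c : JSpace α) (opT3 α D c : JSpace α) := rfl
  have h2 : 0 ≤ RCLike.re (inner ℂ (c : JSpace α) (energyOp α D.carrier c)) := by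
    rw [energyOp, ContinuousLinearMap.comp_apply, ContinuousLinearMap.adjoint_inner_right]
    exact inner_self_nonneg
  have h3 : energyOp α D.carrier c = (c : JSpace α) - energyOp α D.host c := by
    rw [energyOp_carrier]; rfl
  have h4 : (1 / 2 : ℂ) = ((1 / 2 : ℝ) : ℂ) := by push_cast; rfl
  have h5 : RCLike.re (inner ℂ (c : JSpace α) (c : JSpace α)) = ‖c‖ ^ 2 :=
    (norm_sq_eq_re_inner (𝕜 := ℂ) (c : JSpace α)).symm
  rw [h1, coe_opT3_apply, inner_sub_right, inner_smul_right, map_sub, h4]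
  have h6 : RCLike.re (((1 / 2 : ℝ) : ℂ) * inner ℂ (c : JSpace α) (c : JSpace α)) =
      1 / 2 * ‖c‖ ^ 2 := by
    rw [← h5]; exact Complex.re_ofReal_mul _ _
  rw [h3, inner_sub_right, map_sub, h5] at h2
  rw [h6]
  linarith

theorem isUnit_pencil_one (h : -1 / 2 < muMinus α D) (h0 : muMinus α D < 0) {z : ℂ}
    (hz : ‖z‖ < |zStar α D|) : IsUnit (pencil α D 1 z) := by
  rw [abs_zStar h h0] at hz
  exact isUnit_pencil (fun _ => one_ne_zero) fun μ hμ =>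
    pencil_symbol_ne_zero h h0 hz (muMinus_le hμ)

theorem norm_inverse_pencil_apply_le (h : -1 / 2 < muMinus α D) (h0 : muMinus α D < 0) {z : ℂ}
    (hz : ‖z‖ < |zStar α D|) (c : W3 α D) : ‖Ring.inverse (pencil α D 1 z) c‖ ≤
      ((1 / 2 - muMinus α D) * (|zStar α D| - ‖z‖))⁻¹ * ‖c‖ := by
  have h1 : 0 < 1 / 2 - muMinus α D := by linarith
  refine norm_inverse_apply_le (isUnit_pencil_one h h0 hz)
    (mul_pos h1 (sub_pos.2 hz)) (fun v => ?_) c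
  have h2 := le_norm_pencilOf (isSelfAdjoint_opT3 α D) (m := muMinus α D)
    (fun μ hμ => muMinus_le hμ) inner_opT3_le z v
  have h3 : (1 / 2 - muMinus α D) * (|zStar α D| - ‖z‖) =
      (1 / 2 + muMinus α D) - ‖z‖ * (1 / 2 - muMinus α D) := by
    rw [mul_sub, half_sub_mul_abs_zStar h h0, mul_comm ‖z‖]
  rw [h3]
  exact h2

theorem norm_add_add_sq {a b : JSpace α} (ha : a ∈ W1 α D) (hb : b ∈ W2 α D) (c : W3 α D) :
    ‖a + b + c‖ ^ 2 = ‖a‖ ^ 2 + ‖b‖ ^ 2 + ‖c‖ ^ 2 := by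
  have h1 := norm_add_sq_eq_norm_sq_add_norm_sq_of_inner_eq_zero a b (inner_W1_W2 α D ha hb)
  have h2 := norm_add_sq_eq_norm_sq_add_norm_sq_of_inner_eq_zero (𝕜 := ℂ) (a + b) (c : JSpace α) (by
    rw [inner_add_left, ((mem_W3 α D).1 c.2).1 a ha, ((mem_W3 α D).1 c.2).2 b hb, add_zero])
  rw [pow_two, h2, h1, Submodule.coe_norm]
  ring

theorem norm_add_le_mul_norm_add {a b : JSpace α} (ha : a ∈ W1 α D) (hb : b ∈ W2 α D)
    {c c' : W3 α D} {q : ℝ} (hq : 1 ≤ q) (hc : ‖c'‖ ≤ q * ‖c‖) :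
    ‖a + 0 + c'‖ ≤ q * ‖a + b + c‖ := by
  refine (abs_le_of_sq_le_sq' ?_ (mul_nonneg (zero_le_one.trans hq) (norm_nonneg _))).2
  rw [mul_pow, norm_add_add_sq ha (zero_mem _), norm_add_add_sq ha hb, norm_zero]
  have h3 : ‖c'‖ ^ 2 ≤ q ^ 2 * ‖c‖ ^ 2 := by
    rw [← mul_pow]
    exact pow_le_pow_left₀ (norm_nonneg _) hc 2
  have h4 : ‖a‖ ^ 2 ≤ q ^ 2 * ‖a‖ ^ 2 := le_mul_of_one_le_left (sq_nonneg _) (one_le_pow₀ hq)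
  have h5 : 0 ≤ q ^ 2 * ‖b‖ ^ 2 := mul_nonneg (sq_nonneg _) (sq_nonneg _)
  linarith

/-- The P₂ terms cancel and the difference is z times P₁ plus the inverse pencil on W₃. The blocks
are orthogonal, so the larger of their two norms is the bound. -/
theorem norm_solutionOp_sub_le (h : -1 / 2 < muMinus α D) (h0 : muMinus α D < 0) {z : ℂ}
    (hz : ‖z‖ < |zStar α D|) : ‖solutionOp α D z - solutionOp α D 0‖ ≤
      ‖z‖ * ((1 / 2 - muMinus α D) * (|zStar α D| - ‖z‖))⁻¹ := by
  have h1 : 0 < 1 / 2 - muMinus α D := by linarith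
  have hκ : 0 < (1 / 2 - muMinus α D) * (|zStar α D| - ‖z‖) := mul_pos h1 (sub_pos.2 hz)
  have hR := norm_inverse_pencil_apply_le h h0 hz
  -- The bracket equals 1/2 + μ⁻ - (1/2 - μ⁻)‖z‖ < 1, so the W₃ bound absorbs the norm 1 of P₁.
  have hκ1 : 1 ≤ ((1 / 2 - muMinus α D) * (|zStar α D| - ‖z‖))⁻¹ := by
    refine (one_le_inv₀ hκ).2 ?_
    have : 0 ≤ (1 / 2 - muMinus α D) * ‖z‖ := by positivity
    rw [mul_sub, half_sub_mul_abs_zStar h h0]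
    linarith
  generalize ((1 / 2 - muMinus α D) * (|zStar α D| - ‖z‖))⁻¹ = q at *
  refine ContinuousLinearMap.opNorm_le_bound _
    (mul_nonneg (norm_nonneg z) (zero_le_one.trans hκ1)) fun x => ?_
  obtain ⟨a, ha, b, hb, c, rfl⟩ := exists_decomposition α D x
  have e : (solutionOp α D z - solutionOp α D 0) (a + b + c) =
      solutionOp α D z (a + b + c) - solutionOp α D 0 (a + b + c) := rfl
  have hc := hR c
  rw [e, solutionOp_apply z ha hb, solutionOp_apply 0 ha hb]
  clear e hR
  generalize Ring.inverse (pencil α D 1 z) c = c₁ at *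
  have e : z • a + b + ((z • c₁ : W3 α D) : JSpace α) -
      ((0 : ℂ) • a + b + (((0 : ℂ) • Ring.inverse (pencil α D 1 0) c : W3 α D) : JSpace α)) =
      z • (a + 0 + c₁) := by
    rw [zero_smul, zero_smul, smul_add, smul_add, smul_zero, Submodule.coe_smul,
      Submodule.coe_zero]
    abel
  rw [e, norm_smul, mul_assoc]
  refine mul_le_mul_of_nonneg_left ?_ (norm_nonneg z)
  exact norm_add_le_mul_norm_add ha hb hκ1 hc

/-- The embedding and its adjoint each contribute the Poincaré factor 1/√c. -/
theorem norm_opA_sub_le (h : -1 / 2 < muMinus α D) (h0 : muMinus α D < 0) {z : ℂ}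
    (hz : ‖z‖ < |zStar α D|) : ‖opA α D z - opA α D 0‖ ≤
      ‖z‖ / ((1 / 2 - muMinus α D) * (|zStar α D| - ‖z‖) * waveConst α) := by
  have hc : 0 < waveConst α := waveConst_pos
  have e : opA α D z - opA α D 0 =
      emb α ∘L (solutionOp α D z - solutionOp α D 0) ∘L invLaplacian α := by
    rw [opA_eq, opA_eq, ContinuousLinearMap.sub_comp, ContinuousLinearMap.comp_sub]
  rw [e]
  have h1 := norm_solutionOp_sub_le h h0 hz
  have h2 := norm_emb_le α
  have h3 := norm_invLaplacian_le α
  calc _ ≤ ‖emb α‖ * (‖solutionOp α D z - solutionOp α D 0‖ * ‖invLaplacian α‖) :=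
        (ContinuousLinearMap.opNorm_comp_le _ _).trans
          (mul_le_mul_of_nonneg_left (ContinuousLinearMap.opNorm_comp_le _ _) (norm_nonneg _))
    _ ≤ (Real.sqrt (waveConst α))⁻¹ *
        (‖z‖ * ((1 / 2 - muMinus α D) * (|zStar α D| - ‖z‖))⁻¹ * (Real.sqrt (waveConst α))⁻¹) := by
        have hq := (norm_nonneg _).trans h1
        gcongr
    _ = ‖z‖ * ((1 / 2 - muMinus α D) * (|zStar α D| - ‖z‖))⁻¹ *
        (Real.sqrt (waveConst α) * Real.sqrt (waveConst α))⁻¹ := by rw [mul_inv]; ring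
    _ = _ := by
        rw [Real.mul_self_sqrt hc.le, div_eq_mul_inv ‖z‖, mul_inv, mul_inv, mul_inv, mul_assoc]

theorem abs_zStar_pos (h : -1 / 2 < muMinus α D) (h0 : muMinus α D < 0) : 0 < |zStar α D| := by
  rw [abs_zStar h h0]
  exact div_pos (by linarith) (by linarith)

theorem rStar_pos (h : -1 / 2 < muMinus α D) (h0 : muMinus α D < 0) {d : ℝ} (hd : 0 < d) :
    0 < rStar α D d := by
  have hc : 0 < waveConst α := waveConst_pos
  have h1 : 0 < 1 / 2 - muMinus α D := by linarith
  have h2 := abs_zStar_pos h h0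
  rw [rStar_eq]
  positivity

theorem lt_abs_zStar (h : -1 / 2 < muMinus α D) (h0 : muMinus α D < 0) {d : ℝ} (hd : 0 < d)
    {z : ℂ} (hz : ‖z‖ < rStar α D d) : ‖z‖ < |zStar α D| := by
  rw [rStar_eq] at hz
  exact (radius_bound (by linarith) waveConst_pos hd (abs_zStar_pos h h0) hz).1

theorem norm_opA_sub_lt (h : -1 / 2 < muMinus α D) (h0 : muMinus α D < 0) {d : ℝ} (hd : 0 < d)
    {z : ℂ} (hz : ‖z‖ < rStar α D d) : ‖opA α D z - opA α D 0‖ < d := by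
  have hZ := lt_abs_zStar h h0 hd hz
  rw [rStar_eq] at hz
  have hc : 0 < waveConst α := waveConst_pos
  have h1 : 0 < 1 / 2 - muMinus α D := by linarith
  have h2 := (radius_bound h1 hc hd (abs_zStar_pos h h0) hz).2
  refine (norm_opA_sub_le h h0 hZ).trans_lt ?_
  rw [div_lt_iff₀ (mul_pos (mul_pos h1 (sub_pos.2 hZ)) hc)]
  linarith

variable (α D) in
-- At z = 0 only P₂ remains, conjugated by the embedding and its adjoint.
theorem isSelfAdjoint_opA_zero : IsSelfAdjoint (opA α D 0) := by
  have h1 : solutionOp α D 0 = (W2 α D).starProjection := by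
    rw [solutionOp, zero_smul, zero_smul, zero_add, add_zero]
  rw [opA_eq, h1]
  exact (isSelfAdjoint_starProjection (W2 α D)).conj_adjoint (emb α)

theorem analyticAt_solutionOp {z : ℂ} (hu : IsUnit (pencil α D 1 z)) :
    AnalyticAt ℂ (fun z => solutionOp α D z) z := by
  have h1 : AnalyticAt ℂ (fun z => Ring.inverse (pencil α D 1 z)) z :=
    analyticAt_inverse_pencilOf (S := opT3 α D) hu
  have h2 : AnalyticAt ℂ (fun z => (W3 α D).subtypeL ∘L Ring.inverse (pencil α D 1 z) ∘L
      (W3 α D).orthogonalProjectionOnto) z := analyticAt_comp_comp h1 _ _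
  exact analyticAt_smul_add_add_smul _ _ h2

theorem analyticAt_opA {z : ℂ} (hu : IsUnit (pencil α D 1 z)) :
    AnalyticAt ℂ (fun z => opA α D z) z := by
  simp only [opA_eq]
  exact analyticAt_comp_comp (analyticAt_solutionOp hu) _ _

variable (α D) in
-- The range of A(z) lies in that of the embedding, which is not all of L². Consequently an
-- isolating contour for β₀ ≠ 0 avoids 0 and has winding number 0 about it.
theorem zero_mem_spectrum_opA (z : ℂ) : (0 : ℂ) ∈ spectrum ℂ (opA α D z) := by
  rw [spectrum.zero_mem_iff]
  rintro ⟨u, hu⟩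
  refine not_surjective_emb α fun y => ⟨solutionOp α D z (invLaplacian α (u⁻¹.1 y)), ?_⟩
  have h1 : (u : L2Y →L[ℂ] L2Y) (u⁻¹.1 y) = y := DFunLike.congr_fun u.mul_inv y
  rw [hu, opA_eq] at h1
  exact h1

theorem setOf_inv_lt_norm_subset (h : -1 / 2 < muMinus α D) (h0 : muMinus α D < 0) {r : ℝ}
    (hr : 0 < r) (hZ : ∀ z : ℂ, ‖z‖ < r → ‖z‖ < |zStar α D|) :
    {k : ℂ | r⁻¹ < ‖k‖} ⊆ (excludedSet α D)ᶜ := by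
  intro k hk
  have hk' : r⁻¹ < ‖k‖ := hk
  have hk0 : 0 < ‖k‖ := (inv_pos.2 hr).trans hk'
  have h1 : ‖k⁻¹‖ < r := by
    rw [norm_inv]
    exact inv_lt_of_inv_lt₀ hr hk'
  have hne : k ≠ 0 := norm_pos_iff.1 hk0
  refine (notMem_excludedSet_iff α D).2 ⟨hne, ?_⟩
  have h2 := isUnit_pencil_one h h0 (hZ _ h1)
  rw [pencil_inv hne] at h2
  exact (isUnit_smul_iff_of_ne_zero (inv_ne_zero hne)).1 h2

end Radius

end

end PhotonicCrystal

namespace PhotonicCrystal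
noncomputable section
open MeasureTheory Set Filter Topology
open scoped ComplexConjugate ContDiff

/-! ### The eigenvalue group inside the contour. -/

section EigenvalueGroup

/-- A `finsum` with infinite support defaults to 0, so finiteness of the enclosed spectrum is what
gives it meaning. -/
theorem groupSum_eq_sum {A : L2Y →L[ℂ] L2Y} {γ : ℝ → ℂ} {s : Finset ℂ}
    (hs : ∀ b, b ∈ s ↔ b ∈ spectrum ℂ A ∧ windingNumber γ b = 1) (f : ℂ → ℂ) :
    groupSum A γ f = ∑ b ∈ s, (Module.finrank ℂ (rootSpace A b) : ℂ) * f b := by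
  have : spectrumInside A γ = ↑s := Set.ext fun b => (hs b).symm
  rw [groupSum, this, finsum_mem_coe_finset]

variable {α : brillouinZone} {D : Inclusion} {γ : ℝ → ℂ} {β₀ : ℂ}

/-- On a trivial space every operator is a unit, which would empty the spectrum. -/
theorem nontrivial_L2Y (α : brillouinZone) (D : Inclusion) : Nontrivial L2Y := by
  rw [← not_subsingleton_iff_nontrivial]
  intro hs
  exact zero_mem_spectrum_opA α D 0 (isUnit_of_subsingleton _)

theorem Isolates.zero_notMem_image (hi : Isolates γ (spectrum ℂ (opA α D 0)) β₀) :
    (0 : ℂ) ∉ γ '' Icc 0 1 :=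
  disjoint_right.1 hi.1 (zero_mem_spectrum_opA α D 0)

theorem contourDist_spectrum_pos (hγ : IsContour γ)
    (hi : Isolates γ (spectrum ℂ (opA α D 0)) β₀) :
    0 < contourDist γ (spectrum ℂ (opA α D 0)) :=
  contourDist_pos hγ (spectrum.isClosed _) ⟨0, zero_mem_spectrum_opA α D 0⟩ hi.1

theorem image_subset_resolventSet (h : -1 / 2 < muMinus α D) (h0 : muMinus α D < 0)
    (hγ : IsContour γ) (hi : Isolates γ (spectrum ℂ (opA α D 0)) β₀) {z : ℂ}
    (hz : ‖z‖ < rStar α D (contourDist γ (spectrum ℂ (opA α D 0)))) :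
    γ '' Icc 0 1 ⊆ resolventSet ℂ (opA α D z) := by
  intro ζ hζ
  have hd := contourDist_spectrum_pos hγ hi
  have h1 : ζ ∈ resolventSet ℂ (opA α D 0) := by
    by_contra hn
    exact disjoint_left.1 hi.1 hζ hn
  exact mem_resolventSet_of_norm_sub_lt (isSelfAdjoint_opA_zero α D) h1 hd
    (fun b hb => contourDist_le hζ hb) (norm_opA_sub_lt h h0 hd hz)

theorem finrank_eigSpace_pos (hβ : β₀ ∈ spectrum ℂ (opA α D 0)) (hβ0 : β₀ ≠ 0) :
    0 < Module.finrank ℂ (eigSpace (opA α D 0) β₀) := by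
  have h1 := finiteDimensional_rootSpace_opA (α := α) (D := D) 0 hβ0
  have h2 : eigSpace (opA α D 0) β₀ = rootSpace (opA α D 0) β₀ :=
    (maxGenEigenspace_eq_eigenspace (isSelfAdjoint_opA_zero α D) β₀).symm
  rw [← h2] at h1
  have h3 : eigSpace (opA α D 0) β₀ ≠ ⊥ :=
    ((isCompactOperator_opA 0).hasEigenvalue_iff_mem_spectrum hβ0).2 hβ
  have := Submodule.nontrivial_iff_ne_bot.2 h3
  exact Module.finrank_pos

/-- Only β₀ is enclosed, and a self-adjoint operator has no Jordan blocks, so algebraic and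
geometric multiplicity agree. -/
theorem groupSum_opA_zero (hβ : β₀ ∈ spectrum ℂ (opA α D 0))
    (hi : Isolates γ (spectrum ℂ (opA α D 0)) β₀) :
    groupSum (opA α D 0) γ (fun _ => 1) = Module.finrank ℂ (eigSpace (opA α D 0) β₀) := by
  have hs : ∀ b, b ∈ ({β₀} : Finset ℂ) ↔
      b ∈ spectrum ℂ (opA α D 0) ∧ windingNumber γ b = 1 := by
    intro b
    rw [Finset.mem_singleton]
    refine ⟨fun hb => hb ▸ ⟨hβ, hi.2.1⟩, fun hb => ?_⟩
    by_contra hne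
    have := hi.2.2 b hb.1 hne
    rw [hb.2] at this
    exact one_ne_zero this
  have h2 : eigSpace (opA α D 0) β₀ = rootSpace (opA α D 0) β₀ :=
    (maxGenEigenspace_eq_eigenspace (isSelfAdjoint_opA_zero α D) β₀).symm
  rw [groupSum_eq_sum hs, Finset.sum_singleton, mul_one, h2]

theorem exists_spectrumInside (h : -1 / 2 < muMinus α D) (h0 : muMinus α D < 0)
    (hγ : IsContour γ) (hi : Isolates γ (spectrum ℂ (opA α D 0)) β₀) (hβ0 : β₀ ≠ 0) {z : ℂ}
    (hz : ‖z‖ < rStar α D (contourDist γ (spectrum ℂ (opA α D 0)))) :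
    ∃ s : Finset ℂ, (∀ b, b ∈ s ↔ b ∈ spectrum ℂ (opA α D z) ∧ windingNumber γ b = 1) ∧ 0 ∉ s ∧
      IsIdempotentElem (spectralProj (opA α D z) γ) ∧
      Commute (opA α D z) (spectralProj (opA α D z) γ) ∧
      LinearMap.range (spectralProj (opA α D z) γ : L2Y →ₗ[ℂ] L2Y) =
        ⨆ b ∈ s, rootSpace (opA α D z) b := by
  have := nontrivial_L2Y α D
  have hw0 : windingNumber γ 0 = 0 := hi.2.2 0 (zero_mem_spectrum_opA α D 0) hβ0.symm
  obtain ⟨s, h1, h2, -, h3, h4, h5⟩ := hγ.rieszProjection (isCompactOperator_opA (α := α) (D := D) z)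
    (image_subset_resolventSet h h0 hγ hi hz) hi.zero_notMem_image hw0
  exact ⟨s, h1, h2, h3, h4, h5⟩

theorem analyticOnNhd_opA (h : -1 / 2 < muMinus α D) (h0 : muMinus α D < 0) (hγ : IsContour γ)
    (hi : Isolates γ (spectrum ℂ (opA α D 0)) β₀) :
    AnalyticOnNhd ℂ (fun z => opA α D z)
    (Metric.ball 0 (rStar α D (contourDist γ (spectrum ℂ (opA α D 0))))) := fun _ hz =>
  analyticAt_opA (isUnit_pencil_one h h0
    (lt_abs_zStar h h0 (contourDist_spectrum_pos hγ hi) (mem_ball_zero_iff.1 hz)))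

theorem analyticOnNhd_spectralProj (h : -1 / 2 < muMinus α D) (h0 : muMinus α D < 0) (hγ : IsContour γ)
    (hi : Isolates γ (spectrum ℂ (opA α D 0)) β₀) :
    AnalyticOnNhd ℂ (fun z => spectralProj (opA α D z) γ)
    (Metric.ball 0 (rStar α D (contourDist γ (spectrum ℂ (opA α D 0))))) := fun z hz => by
  simp only [spectralProj_eq_contourIntegral]
  exact hγ.analyticAt_contourIntegral_resolvent (analyticOnNhd_opA h h0 hγ hi z hz)
    (image_subset_resolventSet h h0 hγ hi (mem_ball_zero_iff.1 hz))

theorem analyticAt_groupSum (h : -1 / 2 < muMinus α D) (h0 : muMinus α D < 0)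
    (hγ : IsContour γ) (hi : Isolates γ (spectrum ℂ (opA α D 0)) β₀) (hβ0 : β₀ ≠ 0) {z : ℂ}
    (hz : z ∈ Metric.ball 0 (rStar α D (contourDist γ (spectrum ℂ (opA α D 0))))) :
    (∀ p : ℤ, AnalyticAt ℂ (fun z => groupSum (opA α D z) γ fun β => β ^ p) z) ∧
      ∀ᶠ w in 𝓝 z, groupSum (opA α D w) γ (fun _ => 1) = groupSum (opA α D z) γ (fun _ => 1) := by
  -- A choice of finite sets for all z, with the empty set as a dummy outside the disc.
  have key : ∀ z, ∃ s : Finset ℂ, z ∈ Metric.ball (0 : ℂ) (rStar α D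
      (contourDist γ (spectrum ℂ (opA α D 0)))) →
      (∀ b, b ∈ s ↔ b ∈ spectrum ℂ (opA α D z) ∧ windingNumber γ b = 1) ∧ 0 ∉ s ∧
      IsIdempotentElem (spectralProj (opA α D z) γ) ∧
      Commute (opA α D z) (spectralProj (opA α D z) γ) ∧
      LinearMap.range (spectralProj (opA α D z) γ : L2Y →ₗ[ℂ] L2Y) =
        ⨆ b ∈ s, rootSpace (opA α D z) b := fun z => by
    by_cases hz : z ∈ Metric.ball (0 : ℂ) (rStar α D (contourDist γ (spectrum ℂ (opA α D 0))))
    · obtain ⟨s, hs⟩ := exists_spectrumInside h h0 hγ hi hβ0 (mem_ball_zero_iff.1 hz)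
      exact ⟨s, fun _ => hs⟩
    · exact ⟨∅, fun h => absurd h hz⟩
  choose s hs using key
  have hnhds := Metric.isOpen_ball.mem_nhds hz
  obtain ⟨h1, h2⟩ := analyticAt_sum_zpow (s := s) (analyticOnNhd_opA h h0 hγ hi z hz)
    (analyticOnNhd_spectralProj h h0 hγ hi z hz)
    (fun b hb => finiteDimensional_rootSpace_opA z fun hb0 => (hs z hz).2.1 (hb0 ▸ hb))
    (by
      filter_upwards [hnhds] with w hw
      exact ⟨(hs w hw).2.2.1, (hs w hw).2.2.2.1, (hs w hw).2.1, (hs w hw).2.2.2.2⟩)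
  refine ⟨fun p => (h1 p).congr ?_, ?_⟩
  · filter_upwards [hnhds] with w hw
    exact (groupSum_eq_sum (hs w hw).1 _).symm
  · filter_upwards [hnhds, h2] with w hw hw2
    rw [groupSum_eq_sum (hs w hw).1, groupSum_eq_sum (hs z hz).1]
    simp only [mul_one]
    exact_mod_cast hw2

/-- The total multiplicity is analytic and constant near 0, so the identity theorem on the connected
disc carries its value at 0 everywhere. -/
theorem groupSum_one (h : -1 / 2 < muMinus α D) (h0 : muMinus α D < 0)
    (hγ : IsContour γ) (hi : Isolates γ (spectrum ℂ (opA α D 0)) β₀) (hβ0 : β₀ ≠ 0)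
    (hβ : β₀ ∈ spectrum ℂ (opA α D 0)) {z : ℂ}
    (hz : z ∈ Metric.ball 0 (rStar α D (contourDist γ (spectrum ℂ (opA α D 0))))) :
    groupSum (opA α D z) γ (fun _ => 1) = Module.finrank ℂ (eigSpace (opA α D 0) β₀) := by
  rw [← groupSum_opA_zero hβ hi]
  have hr := rStar_pos h h0 (contourDist_spectrum_pos hγ hi)
  have h1 : AnalyticOnNhd ℂ (fun z => groupSum (opA α D z) γ fun _ => 1)
      (Metric.ball 0 (rStar α D (contourDist γ (spectrum ℂ (opA α D 0))))) := fun w hw => by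
    simpa only [zpow_zero] using (analyticAt_groupSum h h0 hγ hi hβ0 hw).1 0
  exact h1.eqOn_of_preconnected_of_eventuallyEq analyticOnNhd_const
    (convex_ball _ _).isPreconnected (Metric.mem_ball_self hr)
    (analyticAt_groupSum h h0 hγ hi hβ0 (Metric.mem_ball_self hr)).2 hz

end EigenvalueGroup

end

end PhotonicCrystal

/-! ### Assembly of the theorem. -/

theorem mainTheorem4 (D : Inclusion) (α : brillouinZone) :
    -- the operator, its inverse and the solution operator are holomorphic off `Z`
    (IsOpen (excludedSet α D)ᶜ ∧
      AnalyticOnNhd ℂ (fun k => opTk α D k) (excludedSet α D)ᶜ ∧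
      (∀ k ∉ excludedSet α D, IsUnit (opTk α D k)) ∧
      AnalyticOnNhd ℂ (fun k => Ring.inverse (opTk α D k)) (excludedSet α D)ᶜ ∧
      AnalyticOnNhd ℂ (fun k => opB α D k) (excludedSet α D)ᶜ) ∧
    -- the Bloch spectrum for complex `k`
    (∀ k ∉ excludedSet α D,
      opA α D k⁻¹ = opB α D k ∧
      IsCompactOperator (opB α D k) ∧
      (∀ ξ : ℂ, IsBlochEigenvalue α D k ξ ↔ ξ ≠ 0 ∧ ξ⁻¹ ∈ spectrum ℂ (opA α D k⁻¹)) ∧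
      (∀ ξ : ℂ, ξ ≠ 0 → (blochEigenspace α D k ξ).map (emb α : JSpace α →ₗ[ℂ] L2Y) =
        eigSpace (opA α D k⁻¹) ξ⁻¹) ∧
      (∀ R : ℝ, {ξ : ℂ | IsBlochEigenvalue α D k ξ ∧ ‖ξ‖ ≤ R}.Finite) ∧
      (∀ ξ : ℂ, IsBlochEigenvalue α D k ξ →
        FiniteDimensional ℂ (blochEigenspace α D k ξ) ∧
        FiniteDimensional ℂ (rootSpace (opA α D k⁻¹) ξ⁻¹))) ∧
    -- analyticity of each eigenvalue group for `|k| > 1 / r*`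
    (-1 / 2 < muMinus α D → muMinus α D < 0 →
      ∀ β₀ ∈ spectrum ℂ (opA α D 0), β₀ ≠ 0 →
      ∀ γ : ℝ → ℂ, IsContour γ → Isolates γ (spectrum ℂ (opA α D 0)) β₀ →
      ∀ (r : ℝ) (m : ℕ), r = rStar α D (contourDist γ (spectrum ℂ (opA α D 0))) →
      m = Module.finrank ℂ (eigSpace (opA α D 0) β₀) →
        0 < r ∧ 0 < m ∧
        {k : ℂ | r⁻¹ < ‖k‖} ⊆ (excludedSet α D)ᶜ ∧
        (∀ z : ℂ, ‖z‖ < r →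
          γ '' Set.Icc 0 1 ⊆ resolventSet ℂ (opA α D z) ∧
          (spectrumInside (opA α D z) γ).Finite ∧
          0 ∉ spectrumInside (opA α D z) γ ∧
          (∀ β ∈ spectrumInside (opA α D z) γ, eigSpace (opA α D z) β ≠ ⊥ ∧
            FiniteDimensional ℂ (rootSpace (opA α D z) β)) ∧
          groupSum (opA α D z) γ (fun _ => 1) = m ∧
          IsIdempotentElem (spectralProj (opA α D z) γ) ∧
          LinearMap.range (spectralProj (opA α D z) γ : L2Y →ₗ[ℂ] L2Y) =
            ⨆ β ∈ spectrumInside (opA α D z) γ, rootSpace (opA α D z) β) ∧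
        AnalyticOnNhd ℂ (fun z => opA α D z) (Metric.ball 0 r) ∧
        AnalyticOnNhd ℂ (fun z => spectralProj (opA α D z) γ) (Metric.ball 0 r) ∧
        (∀ p : ℤ, AnalyticOnNhd ℂ (fun z => groupSum (opA α D z) γ (fun β => β ^ p))
          (Metric.ball 0 r)) ∧
        AnalyticOnNhd ℂ (fun z => (1 / m : ℂ) * groupSum (opA α D z) γ (fun β => β))
          (Metric.ball 0 r) ∧
        AnalyticOnNhd ℂ (fun z => (1 / m : ℂ) * groupSum (opA α D z) γ (fun β => β⁻¹))
          (Metric.ball 0 r) ∧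
        AnalyticOnNhd ℂ (fun k => (1 / m : ℂ) * groupSum (opA α D k⁻¹) γ (fun β => β⁻¹))
          {k : ℂ | r⁻¹ < ‖k‖}) := by
  refine ⟨⟨isOpen_compl_excludedSet α D, fun k _ => analyticAt_opTk α D k,
    fun k hk => isUnit_opTk hk, fun k hk => analyticAt_inverse_opTk hk,
    fun k hk => analyticAt_opB hk⟩, fun k hk => ⟨opA_inv hk, ?_, isBlochEigenvalue_iff hk,
    fun ξ hξ => map_blochEigenspace hk hξ, finite_blochEigenvalues hk, fun ξ hξ => ?_⟩, ?_⟩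
  · rw [← opA_inv hk]
    exact isCompactOperator_opA _
  · have h0 := ((isBlochEigenvalue_iff hk ξ).1 hξ).1
    exact ⟨finiteDimensional_blochEigenspace hk h0,
      finiteDimensional_rootSpace_opA _ (inv_ne_zero h0)⟩
  · rintro h h0 β₀ hβ hβ0 γ hγ hi r m rfl rfl
    have hd := contourDist_spectrum_pos hγ hi
    have hr := rStar_pos h h0 hd
    have hsub := setOf_inv_lt_norm_subset h h0 hr fun z hz => lt_abs_zStar h h0 hd hz
    have hsum : ∀ p : ℤ, AnalyticOnNhd ℂ (fun z => groupSum (opA α D z) γ (fun β => β ^ p))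
        (Metric.ball 0 (rStar α D (contourDist γ (spectrum ℂ (opA α D 0))))) := fun p z hz =>
      (analyticAt_groupSum h h0 hγ hi hβ0 hz).1 p
    -- The disc contains z = 0, which is k = ∞ in the variable z = 1/k.
    have hinv : AnalyticOnNhd ℂ (fun z => groupSum (opA α D z) γ (fun β => β⁻¹))
        (Metric.ball 0 (rStar α D (contourDist γ (spectrum ℂ (opA α D 0))))) := by
      simpa only [zpow_neg_one] using hsum (-1)
    refine ⟨hr, finrank_eigSpace_pos hβ hβ0, hsub, fun z hz => ?_, analyticOnNhd_opA h h0 hγ hi,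
      analyticOnNhd_spectralProj h h0 hγ hi, hsum, fun z hz => analyticAt_const.mul ?_,
      fun z hz => analyticAt_const.mul (hinv z hz), fun k hk => analyticAt_const.mul ?_⟩
    · obtain ⟨s, h1, h2, h3, -, h4⟩ := exists_spectrumInside h h0 hγ hi hβ0 hz
      have hs : spectrumInside (opA α D z) γ = ↑s := Set.ext fun b => (h1 b).symm
      refine ⟨image_subset_resolventSet h h0 hγ hi hz, hs ▸ s.finite_toSet, hs ▸ h2,
        fun b hb => ?_, groupSum_one h h0 hγ hi hβ0 hβ (mem_ball_zero_iff.2 hz), h3, ?_⟩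
      · have hb0 : b ≠ 0 := by
          rintro rfl
          exact h2 ((h1 0).2 hb)
        exact ⟨((isCompactOperator_opA z).hasEigenvalue_iff_mem_spectrum hb0).2 hb.1,
          finiteDimensional_rootSpace_opA z hb0⟩
      · rw [h4, hs]
        rfl
    · simpa only [zpow_one] using hsum 1 z hz
    · have hk0 : 0 < ‖k‖ := (inv_pos.2 hr).trans hk
      have hk1 : k⁻¹ ∈ Metric.ball (0 : ℂ)
          (rStar α D (contourDist γ (spectrum ℂ (opA α D 0)))) := by
        rw [mem_ball_zero_iff, norm_inv]
        exact inv_lt_of_inv_lt₀ hr hk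
      exact (hinv k⁻¹ hk1).comp (f := fun k => k⁻¹) (analyticAt_inv (norm_pos_iff.1 hk0))
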